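/- Setting. Let $G$ be a graph on the vertex set $V=\{1,\dots,n\}$, $n\ge 2$, with $m$ edges, let $k\ge 2$, let $n_k$ be the number of $k$-cliques of $G$, and let $\alpha$ be a real upper bound on the arboricity of $G$ (the least number of forests covering its edges). Let $0<\varepsilon\le 1/(2k^2)$, $0<\delta<1$, and let $\tilde n_k>0$ and $\tilde m$ be real numbers (estimates of $n_k$ and $m$). $G$ is accessed by degree queries, neighbour queries (the $j$-th neighbour of $v$, adjacency lists being in arbitrary order) and pair queries. The running time counts queries, draws of uniform random integers, and elementary operations (unit-cost RAM on real numbers). Put $\beta=1/(6k)$, $\gamma=\varepsilon/(8k\cdot k!)$, and define the sociability thresholds $$\tau_1=\frac{k^{4k}}{\gamma^2}\min\{\alpha^{k-1},\tilde n_k^{(k-1)/k}\},\qquad \tau_t=\frac{k^{4k}}{\beta^k\gamma^2}\alpha^{k-t}\ (2\le t\le k-1),\qquad \tau_k=1.$$ An ordered $t$-clique is a $t$-tuple $T$ of pairwise adjacent vertices; $T_{\le j}$ is its prefix of length $j$. Its degree $d(T)$ is the degree of its minimum-degree vertex $u(T)$ (ties broken by vertex ids), and $d(R)=\sum_{T\in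 R}d(T)$ for a multiset $R$. Sample-Set$(t,R,s)$ makes $s$ independent attempts; each draws $T\in R$ with probability $d(T)/d(R)$ (by the alias method) and then a uniform neighbour $v$ of $u(T)$; the multiset of those $(T,v)$ that are ordered $(t+1)$-cliques is returned. Is-Active on an ordered $i$-clique $I$, $1\le i\le k-1$: make $q=\lceil 12\ln(n^k/\delta)\rceil$ independent trials. A trial starts with $R_i=\{I\}$ and $\tilde\omega_i=(1-\varepsilon/2)\tau_i$. For $t=i,\dots,k-1$ it computes $d(R_t)$, sets $\tilde\omega_t=(1-\gamma)\tilde\omega_{t-1}s_t/d(R_{t-1})$ if $t>i$, and sets $$s_{t+1}=\left\lceil\frac{d(R_t)\,\tau_{t+1}}{\tilde\omega_t}\cdot\frac{3\ln(2/\beta)}{\gamma^2}\right\rceil .$$ If $s_{t+1}>\frac{2\tilde m\alpha^{t-1}\tau_{t+1}}{\tilde n_k}\cdot\frac{12\ln(1/\beta)}{\beta^k\gamma^3}$, the trial ends with $\chi=0$; otherwise $R_{t+1}$ is the result of Sample-Set$(t,R_t,s_{t+1})$. After the last round, $\chi=1$ if $$\frac{d(R_i)\cdots d(R_{k-1})}{s_{i+1}\cdots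 s_k}\,|R_k|\le\tau_i/4$$ (the left side, as well as $s_{t+1}$, being read as $0$ once some $d(R_t)=0$), and $\chi=0$ otherwise. Is-Active returns Active if at least $q/2$ trials have $\chi=1$, and Non-Active otherwise. For a set $\mathcal A$ of ordered cliques, an ordered clique is fully active if all its prefixes (itself included) lie in $\mathcal A$. A $k$-clique $C$ is assigned to the lexicographically first fully active ordered $k$-clique with vertex set $C$ and to all prefixes of it; if there is none, $C$ is unassigned. The weight $\omega^{\mathcal A}(T)$ is the number of $k$-cliques assigned to $T$. For $\tau=(\tau_1,\dots,\tau_k)$, $\mathcal A$ is $\tau$-bounded if $\omega^{\mathcal A}(T)\le\tau_t$ for every $1\le t\le k$ and every ordered $t$-clique $T$; it is $(\varepsilon,\tau)$-good if moreover $\sum_{v\in V}\omega^{\mathcal A}(v)\ge(1-\varepsilon/2)n_k$. Statement. Run Is-Active once, independently, on each ordered clique of size $t\in\{1,\dots,k-1\}$, and let $\mathcal A$ consist of the ordered cliques on which it returns Active, together with all ordered $k$-cliques. (1) If $n_k/4\le\tilde n_k\le n_k$ and $\tilde m\ge m/2$, then $\mathcal A$ is $(\varepsilon,\tau)$-good with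 probability at least $1-\delta$. (2) If $\tilde n_k>n_k$, then $\mathcal A$ is $\tau$-bounded with probability at least $1-\delta$. (3) With $X=\frac{\tilde m}{\tilde n_k}\sum_{t=2}^{k}\alpha^{t-2}\tau_t$, the query complexity and the running time of a single invocation of Is-Active are, for every outcome of its random choices, $$O(\max\{1,X\})\cdot\frac{k^{6k}\log^2(n/\delta)}{\varepsilon^3},$$ and they are $O(X)\cdot k^{6k}\log^2(n/\delta)/\varepsilon^3$ whenever $\tilde n_k\le n_k$ and $\tilde m\ge m/2$. The constants in $O(\cdot)$ are absolute. -/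

import Mathlib

open scoped ENNReal

/-! ### Graphs: arboricity and ordered cliques -/

/-- The arboricity of a finite graph: the least number of forests whose union covers all edges. -/
noncomputable def graphArboricity {n : ℕ} (G : SimpleGraph (Fin n)) : ℕ :=
  sInf {a : ℕ | ∃ F : Fin a → SimpleGraph (Fin n), (∀ i, (F i).IsAcyclic) ∧ G ≤ ⨆ i, F i}

/-- An ordered `t`-clique is a tuple of `t` pairwise adjacent (hence distinct) vertices, given as a
list of length `t`. -/
def IsOrderedClique {n : ℕ} (G : SimpleGraph (Fin n)) (T : List (Fin n)) : Prop :=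
  T.Pairwise G.Adj

/-- The ordered cliques of size `t` for `1 ≤ t ≤ k - 1`. -/
abbrev SmallOrderedClique {n : ℕ} (G : SimpleGraph (Fin n)) (k : ℕ) : Type :=
  {T : List (Fin n) // 1 ≤ T.length ∧ T.length < k ∧ IsOrderedClique G T}

instance {n : ℕ} (G : SimpleGraph (Fin n)) (k : ℕ) : Finite (SmallOrderedClique G k) :=
  ((List.finite_length_lt (Fin n) k).subset (fun _ h => h.2.1)).to_subtype

noncomputable instance {n : ℕ} (G : SimpleGraph (Fin n)) (k : ℕ) :
    Fintype (SmallOrderedClique G k) :=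
  Fintype.ofFinite _

/-! ### Assignment of `k`-cliques, weights, good and bounded active subsets -/

/-- `T` is fully active with respect to `A` if all its (nonempty) prefixes, `T` included,
belong to `A`. -/
def FullyActive {n : ℕ} (A : Set (List (Fin n))) (T : List (Fin n)) : Prop :=
  ∀ j : ℕ, 1 ≤ j → j ≤ T.length → T.take j ∈ A

/-- `L` is the lexicographically first among the fully active orderings of the clique `C`. -/
def IsFirstFullyActive {n : ℕ} (A : Set (List (Fin n))) (C : Finset (Fin n))
    (L : List (Fin n)) : Prop :=
  (L.Nodup ∧ L.toFinset = C ∧ FullyActive A L) ∧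
    ∀ L' : List (Fin n), L'.Nodup → L'.toFinset = C → FullyActive A L' → L ≤ L'

open Classical in
/-- The weight of the ordered clique `T` with respect to `A`: the number of `k`-cliques assigned to
`T`, where a `k`-clique is assigned to its first fully active ordering, if there is one, and to all
prefixes of that ordering. -/
noncomputable def cliqueWeight {n : ℕ} (G : SimpleGraph (Fin n)) [DecidableRel G.Adj] (k : ℕ)
    (A : Set (List (Fin n))) (T : List (Fin n)) : ℕ :=
  ((G.cliqueFinset k).filter fun C => ∃ L, IsFirstFullyActive A C L ∧ T <+: L).card

/-- `A` is `τ`-bounded. -/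
def IsTauBounded {n : ℕ} (G : SimpleGraph (Fin n)) [DecidableRel G.Adj] (k : ℕ)
    (τ : ℕ → ℝ) (A : Set (List (Fin n))) : Prop :=
  ∀ T : List (Fin n), 1 ≤ T.length → T.length ≤ k → IsOrderedClique G T →
    (cliqueWeight G k A T : ℝ) ≤ τ T.length

/-- `A` is `(ε, τ)`-good. -/
def IsGood {n : ℕ} (G : SimpleGraph (Fin n)) [DecidableRel G.Adj] (k : ℕ) (ε : ℝ)
    (τ : ℕ → ℝ) (A : Set (List (Fin n))) : Prop :=
  IsTauBounded G k τ A ∧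
    (1 - ε / 2) * ((G.cliqueFinset k).card : ℝ) ≤ ∑ v : Fin n, (cliqueWeight G k A [v] : ℝ)

/-! ### Parameters -/

/-- The parameter `β`. -/
noncomputable def betaPar (k : ℕ) : ℝ := 1 / (6 * k)

/-- The parameter `γ`. -/
noncomputable def gammaPar (k : ℕ) (ε : ℝ) : ℝ := ε / (8 * k * k.factorial)

/-- The sociability thresholds, for sizes `1 ≤ t ≤ k`. -/
noncomputable def tauU (k : ℕ) (α ε nk : ℝ) (t : ℕ) : ℝ :=
  if t = k then 1
  else if t = 1 then
    (k : ℝ) ^ (4 * k) / gammaPar k ε ^ 2 * min (α ^ (k - 1)) (nk ^ (((k : ℝ) - 1) / k))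
  else (k : ℝ) ^ (4 * k) / (betaPar k ^ k * gammaPar k ε ^ 2) * α ^ (k - t)

/-! ### Randomized algorithms with query access to a graph

The graph can be accessed only through degree, neighbour and pair queries. The cost model is a
unit-cost RAM: every query, every uniform random integer and every elementary operation (arithmetic
on numbers, including rounding and logarithm, comparison, access to an array cell) is one step. -/

/-- Randomized query algorithms on graphs with vertex set `Fin n` with output in `X`. -/
inductive Prog (n : ℕ) (X : Type) : Type
  /-- halt with an output -/
  | ret (x : X) : Prog n X
  /-- one elementary step of local computation -/
  | step (p : Prog n X) : Prog n X
  /-- query the degree of `v` -/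
  | degree (v : Fin n) (f : ℕ → Prog n X) : Prog n X
  /-- query the `j`-th neighbour of `v` (counting from `0`; no answer if `j ≥ d(v)`) -/
  | neighbor (v : Fin n) (j : ℕ) (f : Option (Fin n) → Prog n X) : Prog n X
  /-- query whether `u` and `v` are adjacent -/
  | pair (u v : Fin n) (f : Bool → Prog n X) : Prog n X
  /-- draw a uniformly random element of `{0, …, N}` -/
  | rand (N : ℕ) (f : ℕ → Prog n X) : Prog n X

namespace Prog

/-- Sequential composition. -/
def andThen {n : ℕ} {X Y : Type} : Prog n X → (X → Prog n Y) → Prog n Y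
  | ret x, g => g x
  | step p, g => step (andThen p g)
  | degree v f, g => degree v fun d => andThen (f d) g
  | neighbor v j f, g => neighbor v j fun w => andThen (f w) g
  | pair u v f, g => pair u v fun b => andThen (f b) g
  | rand N f, g => rand N fun j => andThen (f j) g

instance {n : ℕ} : Monad (Prog n) where
  pure := ret
  bind := andThen

/-- `c` elementary steps. -/
def tick {n : ℕ} : ℕ → Prog n Unit
  | 0 => ret ()
  | c + 1 => step (tick c)

def askDegree {n : ℕ} (v : Fin n) : Prog n ℕ := degree v ret
def askNeighbor {n : ℕ} (v : Fin n) (j : ℕ) : Prog n (Option (Fin n)) := neighbor v j ret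
def askPair {n : ℕ} (u v : Fin n) : Prog n Bool := pair u v ret
def draw {n : ℕ} (N : ℕ) : Prog n ℕ := rand N ret

end Prog

/-- The result of an execution: output, number of queries, number of steps (queries included). -/
structure Execution (X : Type) where
  output : X
  queries : ℕ
  steps : ℕ

def Execution.addStep {X : Type} (r : Execution X) : Execution X :=
  ⟨r.output, r.queries, r.steps + 1⟩

def Execution.addQuery {X : Type} (r : Execution X) : Execution X :=
  ⟨r.output, r.queries + 1, r.steps + 1⟩

/-- Adjacency lists of `G`, each in an arbitrary order. -/
abbrev NeighborLists {n : ℕ} (G : SimpleGraph (Fin n)) [DecidableRel G.Adj] : Type :=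
  ∀ v : Fin n, Fin (G.degree v) ≃ G.neighborSet v

/-- The distribution of the execution of a program on the graph `G`. -/
noncomputable def Prog.run {n : ℕ} (G : SimpleGraph (Fin n)) [DecidableRel G.Adj]
    (nbr : NeighborLists G) {X : Type} : Prog n X → PMF (Execution X)
  | .ret x => PMF.pure ⟨x, 0, 0⟩
  | .step p => (p.run G nbr).map Execution.addStep
  | .degree v f => ((f (G.degree v)).run G nbr).map Execution.addQuery
  | .neighbor v j f =>
      ((f (if h : j < G.degree v then some (nbr v ⟨j, h⟩ : Fin n) else none)).run G nbr).map
        Execution.addQuery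
  | .pair u v f => ((f (decide (G.Adj u v))).run G nbr).map Execution.addQuery
  | .rand N f =>
      (PMF.uniformOfFintype (Fin (N + 1))).bind fun j =>
        ((f j).run G nbr).map Execution.addStep

/-! ### Weighted sampling by the alias method -/

/-- A cell of an alias table: a draw that hits the cell with `r < cut` returns `low`, and `high`
otherwise. -/
structure AliasCell (X : Type) where
  cut : ℕ
  low : X
  high : X

/-- Build the cells of an alias table, each of capacity `W`, from the items of weight `< W`
(second argument) and those of weight `≥ W` (third argument). The first argument is the number
of cells still to be built; each cell uses up one item. -/
def aliasCells {n : ℕ} {X : Type} (W : ℕ) :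
    ℕ → List (X × ℕ) → List (X × ℕ) → Prog n (List (AliasCell X))
  | c + 1, (a, p) :: small, (b, q) :: large => do
      Prog.tick 6
      let cells ←
        if p + q - W < W then aliasCells W c ((b, p + q - W) :: small) large
        else aliasCells W c small ((b, p + q - W) :: large)
      return ⟨p, a, b⟩ :: cells
  | c + 1, [], (b, _) :: large => do
      Prog.tick 6
      let cells ← aliasCells W c [] large
      return ⟨W, b, b⟩ :: cells
  | c + 1, (a, _) :: small, [] => do
      Prog.tick 6
      let cells ← aliasCells W c small []
      return ⟨W, a, a⟩ :: cells
  | _, _, _ => return []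

/-- The alias table for a list of weighted items with total weight `W`: the weights are scaled by
the number of items, so that the average weight becomes `W`. -/
def aliasTable {n : ℕ} {X : Type} (W : ℕ) (items : List (X × ℕ)) :
    Prog n (List (AliasCell X)) := do
  Prog.tick (4 * items.length)
  let scaled := items.map fun x => (x.1, items.length * x.2)
  aliasCells W items.length (scaled.filter fun x => x.2 < W) (scaled.filter fun x => W ≤ x.2)

/-- Draw an item from an alias table whose cells have capacity `W > 0`. -/
def aliasDraw {n : ℕ} {X : Type} (W : ℕ) (table : List (AliasCell X)) : Prog n (Option X) := do
  let j ← Prog.draw (table.length - 1)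
  let r ← Prog.draw (W - 1)
  Prog.tick 3
  return table[j]?.map fun c => if r < c.cut then c.low else c.high

/-! ### The procedure Sample-Set -/

/-- Minimum-degree vertex (ties broken by vertex ids) together with its degree among `best` and the
vertices of a list. -/
def minDegreeFrom {n : ℕ} (best : Fin n × ℕ) : List (Fin n) → Prog n (Fin n × ℕ)
  | [] => return best
  | v :: T => do
      let d ← Prog.askDegree v
      Prog.tick 3
      minDegreeFrom (if d < best.2 ∨ (d = best.2 ∧ v < best.1) then (v, d) else best) T

/-- Minimum-degree vertex of a nonempty tuple, together with its degree, which is the degree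
`d(T)` of the tuple. -/
def minDegree {n : ℕ} : List (Fin n) → Prog n (Option (Fin n × ℕ))
  | [] => return none
  | v :: T => do
      let d ← Prog.askDegree v
      let best ← minDegreeFrom (v, d) T
      return some best

/-- Pair each (nonempty) tuple `T` of the sample with its degree `d(T)`. -/
def withDegrees {n : ℕ} : List (List (Fin n)) → Prog n (List (List (Fin n) × ℕ))
  | [] => return []
  | T :: R => do
      let best ← minDegree T
      Prog.tick 2
      let rest ← withDegrees R
      return (T, (best.map Prod.snd).getD 0) :: rest

/-- `d(R)`, from the degrees of the members of `R`. -/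
def totalDegree {n : ℕ} (w : List (List (Fin n) × ℕ)) : ℕ := (w.map Prod.snd).sum

/-- Is `v` adjacent to all members of the list? -/
def adjacentToAll {n : ℕ} (v : Fin n) : List (Fin n) → Prog n Bool
  | [] => return true
  | u :: T => do
      let b ← Prog.askPair v u
      Prog.tick 1
      let c ← adjacentToAll v T
      return b && c

/-- One attempt of Sample-Set: draw `T` with probability `d(T) / d(R)`, draw a uniform neighbour `v`
of the minimum-degree vertex of `T`, and return `(T, v)` if this is an ordered clique. -/
def sampleExtension {n : ℕ} (W : ℕ) (table : List (AliasCell (List (Fin n)))) :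
    Prog n (Option (List (Fin n))) := do
  match ← aliasDraw W table with
  | none => return none
  | some T =>
    match ← minDegree T with
    | none => return none
    | some (u, d) =>
      let j ← Prog.draw (d - 1)
      match ← Prog.askNeighbor u j with
      | none => return none
      | some v =>
        let b ← adjacentToAll v T
        Prog.tick (T.length + 1)
        return if b then some (T ++ [v]) else none

/-- Collect the successful ones among `s` attempts. -/
def sampleExtensions {n : ℕ} (W : ℕ) (table : List (AliasCell (List (Fin n)))) :
    ℕ → Prog n (List (List (Fin n)))
  | 0 => return []
  | s + 1 => do
      let T ← sampleExtension W table
      Prog.tick 2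
      let R ← sampleExtensions W table s
      return T.toList ++ R

/-- Sample-Set on the multiset `R` (as a list) of ordered cliques with `s` attempts. -/
def sampleSet {n : ℕ} (R : List (List (Fin n))) (s : ℕ) : Prog n (List (List (Fin n))) := do
  let w ← withDegrees R
  Prog.tick R.length
  let table ← aliasTable (totalDegree w) w
  sampleExtensions (totalDegree w) table s

/-! ### The procedure Is-Active -/

/-- The number of samples `s_{t+1}`, from `d = d(R_t)` and the weight guess `ω = ω̃_t`. -/
noncomputable def sampleSize (k : ℕ) (ε : ℝ) (τ : ℕ → ℝ) (t d : ℕ) (ω : ℝ) : ℕ :=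
  ⌈(d * τ (t + 1) / ω) * (3 * Real.log (2 / betaPar k) / gammaPar k ε ^ 2)⌉₊

/-- The threshold for `s_{t+1}` above which a trial is given up. -/
noncomputable def sampleBound (k : ℕ) (α ε nk mt : ℝ) (τ : ℕ → ℝ) (t : ℕ) : ℝ :=
  2 * mt * α ^ (t - 1) * τ (t + 1) / nk *
    (12 * Real.log (1 / betaPar k) / (betaPar k ^ k * gammaPar k ε ^ 3))

/-- The rounds `t, …, k - 1` of one trial of Is-Active on an ordered `i`-clique, where the first
argument is the number `k - t` of rounds left, `R = R_t`, `ω = ω̃_t` and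
`ρ = d(R_i) ⋯ d(R_{t-1}) / (s_{i+1} ⋯ s_t)`. If `d(R_t) = 0` then no samples are drawn, and the
estimate becomes `0` (division by zero being zero here). -/
noncomputable def trialRounds {n : ℕ} (i k : ℕ) (α ε nk mt : ℝ) (τ : ℕ → ℝ) :
    ℕ → ℕ → List (List (Fin n)) → ℝ → ℝ → Prog n Bool
  | 0, _, R, _, ρ => do
      Prog.tick (R.length + 3)
      return decide (ρ * R.length ≤ τ i / 4)
  | c + 1, t, R, ω, ρ => do
      let w ← withDegrees R
      Prog.tick (R.length + 2 * k + 40)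
      let d := totalDegree w
      let s := sampleSize k ε τ t d ω
      if sampleBound k α ε nk mt τ t < s then return false
      else do
        let R' ← sampleSet R s
        trialRounds i k α ε nk mt τ c (t + 1) R'
          ((1 - gammaPar k ε) * (ω * s / d)) (ρ * d / s)

/-- One trial (the computation of one indicator `χ_ℓ`) of Is-Active on the ordered clique `I`. -/
noncomputable def activeTrial {n : ℕ} (I : List (Fin n)) (k : ℕ) (α ε nk mt : ℝ)
    (τ : ℕ → ℝ) : Prog n Bool := do
  Prog.tick (k + 20)
  trialRounds I.length k α ε nk mt τ (k - I.length) I.length [I]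
    ((1 - ε / 2) * τ I.length) 1

/-- The number of successes (`χ_ℓ = 1`) in a number of independent repetitions of a trial. -/
def countSuccesses {n : ℕ} (p : Prog n Bool) : ℕ → Prog n ℕ
  | 0 => return 0
  | c + 1 => do
      let b ← p
      Prog.tick 2
      let x ← countSuccesses p c
      return x + b.toNat

/-- Is-Active on the ordered clique `I`; the output `true` means Active. -/
noncomputable def isActive {n : ℕ} (I : List (Fin n)) (k : ℕ) (α ε δ nk mt : ℝ)
    (τ : ℕ → ℝ) : Prog n Bool := do
  let q := ⌈12 * Real.log ((n : ℝ) ^ k / δ)⌉₊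
  Prog.tick (k + 10)
  let x ← countSuccesses (activeTrial I k α ε nk mt τ) q
  return decide ((q : ℝ) / 2 ≤ x)

/-- The joint distribution of the answers of one (independent) invocation of Is-Active, with the
thresholds `tauU`, on each ordered clique of size in `{1, …, k - 1}`. -/
noncomputable def answersLaw {n : ℕ} (G : SimpleGraph (Fin n)) [DecidableRel G.Adj]
    (nbr : NeighborLists G) (k : ℕ) (α ε δ nk mt : ℝ) :
    MeasureTheory.Measure (SmallOrderedClique G k → Bool) :=
  MeasureTheory.Measure.pi fun I =>
    (((isActive I.1 k α ε δ nk mt (tauU k α ε nk)).run G nbr).map Execution.output).toMeasure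

/-- The active subset given by the answers of Is-Active on ordered cliques of size less than `k`;
the ordered `k`-cliques, on which Is-Active is not run, all count as active. -/
def activeSet {n : ℕ} (G : SimpleGraph (Fin n)) (k : ℕ) (ans : SmallOrderedClique G k → Bool) :
    Set (List (Fin n)) :=
  {T | (∃ I : SmallOrderedClique G k, I.1 = T ∧ ans I = true) ∨
    (T.length = k ∧ IsOrderedClique G T)}

/-!
Every ordered clique is the subject of an independent invocation of Is-Active, and there are at most
`n ^ k` invocations. So it suffices that every single invocation errs with probability at most
`δ / n ^ k`, and by the Chernoff bound for the majority vote over the trials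
(`expect_isActive_true_le`, `expect_isActive_false_le`) that a single trial errs with probability at
most `1 / 4`. Sample-Set gives every extension of every sampled tuple the same chance `1 / d(R)`
(`expect_sampleExtension`), because a tuple is drawn with weight `d(T)` and then one of the `d(T)`
neighbours of its minimum-degree vertex is drawn uniformly.

**Heavy tuples are rejected.** If an ordered `i`-clique `I` has weight above its threshold and no
longer tuple does, the weights of the extensions of `I` are bounded, so by a lower-tail bound for
sums of bounded independent variables (`sampleSet_lower_tail`) the sampled weight drops below
`1 - γ` times its mean in one round with probability at most `β`. Otherwise the sample still
carries the guessed weight at the end and the estimate exceeds `τ_i / 4`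
(`expect_trialRounds_true_le`). The weights depend on the answers of the other invocations, but the
error event of `I` is determined by those and the answer on `I`, so that independence applies;
a longest tuple violating boundedness is then impossible unless some invocation errs
(`answersLaw_bounded_and_active`). This gives boundedness for arbitrary estimates.

**Light tuples are accepted.** A trial fails to have `χ = 1` only if it is given up, in which case
the scaled degree sum of some sample is large, or if the final estimate is large. Both quantities
are unbiased, so Markov's inequality, unrolled over the rounds, bounds the failure probability by a
potential of `I`: the number of its extensions to ordered `k`-cliques and the degrees of its
extensions of smaller sizes, with suitable coefficients (`expect_trialRounds_false_le`). The sum of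
the potentials of all ordered `i`-cliques is at most `8 * k! * n_k / τ_i` (`sum_trialPotential_le`),
so few ordered `i`-cliques are heavy in the sense that their potential exceeds `1 / 4`. All others
are active with high probability.

**Few cliques are lost.** The clique counts rest on an orientation with out-degrees at most the
arboricity: every clique contains a directed Hamiltonian path, and there are few directed walks
(`sum_orderedClique_le`). If each ordering of a `k`-clique `C` has a heavy proper prefix, then
building an ordering greedily gets stuck at some tuple `T` in `C` all of whose extensions within `C`
are heavy (`exists_blockedCompletion`). For given `T` the rest of `C` is a clique within the heavy
extensions of `T`, so the number of such `C` is at most a multiple of `α ^ (k - j - 1)` times the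
number of heavy tuples of size `j + 1`, where `j = |T|` (`sum_card_blockedCompletions_le`). For
`j = 0` and the second form of `τ_1`, the `k`-th power of the number of heavy vertices is small
enough (`card_blockedCompletions_nil_heavyCliques_le`).

**Cost.** A trial is given up as soon as a sample would be larger than the threshold, so the running
time is bounded in every outcome by the sum of the thresholds (`within_isActive`,
`steps_isActive_le`). If `ñ_k ≤ n_k` and `m̃ ≥ m / 2`, the bound `n_k ≤ m * α ^ (k - 2)` makes `X` at
least `1 / 2` (`half_le_mul_sum_tauU`).
-/

section IsActive

open Prog

/-! ### Expectations and certain properties of a program -/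

section Semantics

variable {n : ℕ} (G : SimpleGraph (Fin n)) [DecidableRel G.Adj] (nbr : NeighborLists G)

/-- The expectation of `f` of the output of a program, computed by recursion on the program. All
probabilities are finite averages, so real arithmetic suffices. -/
noncomputable def Prog.expect {X : Type} : Prog n X → (X → ℝ) → ℝ
  | .ret x, F => F x
  | .step p, F => p.expect F
  | .degree v f, F => (f (G.degree v)).expect F
  | .neighbor v j f, F =>
      (f (if h : j < G.degree v then some (nbr v ⟨j, h⟩ : Fin n) else none)).expect F
  | .pair u v f, F => (f (decide (G.Adj u v))).expect F
  | .rand N f, F => (∑ j : Fin (N + 1), (f j).expect F) / (N + 1 : ℕ)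

/-- Every execution of `p` ends with an output satisfying `P` after at most `c` steps. -/
def Prog.Within {X : Type} (p : Prog n X) (P : X → Prop) (c : ℕ) : Prop :=
  ∀ r ∈ (p.run G nbr).support, P r.output ∧ r.queries ≤ r.steps ∧ r.steps ≤ c

variable {G nbr}

namespace Prog

variable {X Y : Type}

/-! #### Expectation -/

@[simp] theorem expect_pure (x : X) (F : X → ℝ) : expect G nbr (pure x : Prog n X) F = F x := rfl

@[simp] theorem expect_bind (p : Prog n X) (g : X → Prog n Y) (F : Y → ℝ) :
    expect G nbr (p >>= g) F = expect G nbr p fun x => expect G nbr (g x) F := by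
  change expect G nbr (p.andThen g) F = _
  induction p with
  | ret x => rfl
  | step p ih => exact ih
  | degree v f ih => exact ih _
  | neighbor v j f ih => exact ih _
  | pair u v f ih => exact ih _
  | rand N f ih => simp only [andThen, expect, ih]

@[simp] theorem expect_tick (c : ℕ) (F : Unit → ℝ) : expect G nbr (tick c) F = F () := by
  induction c with
  | zero => rfl
  | succ c ih => exact ih

theorem expect_askNeighbor (v : Fin n) (j : Fin (G.degree v)) (F : Option (Fin n) → ℝ) :
    expect G nbr (askNeighbor v j) F = F (some (nbr v j)) := by
  simp [askNeighbor, expect, j.2]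

/-- Drawing from `{0, …, N - 1}` when `N > 0`. -/
theorem expect_draw {N : ℕ} (hN : 0 < N) (F : ℕ → ℝ) :
    expect G nbr (draw (N - 1)) F = (∑ j : Fin N, F j) / N := by
  obtain ⟨M, rfl⟩ : ∃ M, N = M + 1 := ⟨N - 1, by omega⟩
  simp [draw, expect]

theorem expect_const (p : Prog n X) (a : ℝ) : expect G nbr p (fun _ => a) = a := by
  induction p with
  | ret x => rfl
  | step p ih => exact ih
  | degree v f ih => exact ih _
  | neighbor v j f ih => exact ih _
  | pair u v f ih => exact ih _
  | rand N f ih =>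
    simp only [expect, ih, Finset.sum_const, Finset.card_univ, Fintype.card_fin, nsmul_eq_mul]
    field_simp

theorem expect_add (p : Prog n X) (F H : X → ℝ) :
    expect G nbr p (fun x => F x + H x) = expect G nbr p F + expect G nbr p H := by
  induction p with
  | ret x => rfl
  | step p ih => exact ih
  | degree v f ih => exact ih _
  | neighbor v j f ih => exact ih _
  | pair u v f ih => exact ih _
  | rand N f ih => simp only [expect, ih, Finset.sum_add_distrib, add_div]

theorem expect_const_mul (p : Prog n X) (a : ℝ) (F : X → ℝ) :
    expect G nbr p (fun x => a * F x) = a * expect G nbr p F := by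
  induction p with
  | ret x => rfl
  | step p ih => exact ih
  | degree v f ih => exact ih _
  | neighbor v j f ih => exact ih _
  | pair u v f ih => exact ih _
  | rand N f ih => simp only [expect, ih, ← Finset.mul_sum, mul_div_assoc]

/-! #### Supports -/

theorem mem_support_run_rand {N : ℕ} {f : ℕ → Prog n X} {r : Execution X} :
    r ∈ ((rand N f).run G nbr).support ↔
      ∃ j : Fin (N + 1), ∃ r' ∈ ((f j).run G nbr).support, r'.addStep = r := by
  simp [run]

/-- The executions described by `ν` are those described by `μ` followed by one of a second stage. -/
def SplitsAs (ν : PMF (Execution Y)) (μ : PMF (Execution X)) (second : X → PMF (Execution Y)) :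
    Prop :=
  ∀ r ∈ ν.support, ∃ r₁ ∈ μ.support, ∃ r₂ ∈ (second r₁.output).support,
    r = ⟨r₂.output, r₁.queries + r₂.queries, r₁.steps + r₂.steps⟩

theorem SplitsAs.map {ν : PMF (Execution Y)} {μ : PMF (Execution X)}
    {second : X → PMF (Execution Y)} (h : SplitsAs ν μ second) (c : ℕ) :
    SplitsAs (ν.map fun r => ⟨r.output, r.queries + c, r.steps + 1⟩)
      (μ.map fun r => ⟨r.output, r.queries + c, r.steps + 1⟩) second := by
  intro r hr
  rw [PMF.mem_support_map_iff] at hr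
  obtain ⟨r', hr', rfl⟩ := hr
  obtain ⟨r₁, h₁, r₂, h₂, rfl⟩ := h r' hr'
  exact ⟨_, (PMF.mem_support_map_iff _ _ _).2 ⟨r₁, h₁, rfl⟩, r₂, h₂,
    by simp [add_right_comm]⟩

theorem splitsAs_run_bind (p : Prog n X) (g : X → Prog n Y) :
    SplitsAs ((p >>= g).run G nbr) (p.run G nbr) fun x => (g x).run G nbr := by
  change SplitsAs ((p.andThen g).run G nbr) _ _
  induction p with
  | ret x => exact fun r hr => ⟨⟨x, 0, 0⟩, by simp [run], r, hr, by simp⟩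
  | step p ih => exact ih.map 0
  | degree v f ih => exact (ih _).map 1
  | neighbor v j f ih => exact (ih _).map 1
  | pair u v f ih => exact (ih _).map 1
  | rand N f ih =>
    intro r hr
    obtain ⟨j, r', hr', rfl⟩ := mem_support_run_rand.1 hr
    obtain ⟨r₁, h₁, r₂, h₂, rfl⟩ := ih j r' hr'
    exact ⟨r₁.addStep, mem_support_run_rand.2 ⟨j, r₁, h₁, rfl⟩, r₂, h₂,
      by simp [Execution.addStep, add_right_comm]⟩

theorem expect_mono {p : Prog n X} {F H : X → ℝ}
    (h : ∀ r ∈ (p.run G nbr).support, F r.output ≤ H r.output) :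
    expect G nbr p F ≤ expect G nbr p H := by
  induction p with
  | ret x => exact h ⟨x, 0, 0⟩ (by simp [run])
  | step p ih =>
    exact ih fun r hr => h r.addStep ((PMF.mem_support_map_iff _ _ _).2 ⟨r, hr, rfl⟩)
  | degree v f ih =>
    exact ih _ fun r hr => h r.addQuery ((PMF.mem_support_map_iff _ _ _).2 ⟨r, hr, rfl⟩)
  | neighbor v j f ih =>
    exact ih _ fun r hr => h r.addQuery ((PMF.mem_support_map_iff _ _ _).2 ⟨r, hr, rfl⟩)
  | pair u v f ih =>
    exact ih _ fun r hr => h r.addQuery ((PMF.mem_support_map_iff _ _ _).2 ⟨r, hr, rfl⟩)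
  | rand N f ih =>
    simp only [expect]
    gcongr with j
    exact ih j fun r hr => h r.addStep (mem_support_run_rand.2 ⟨j, r, hr, rfl⟩)

/-- The output distribution of a program, expressed through expectations. -/
theorem map_output_run_apply [DecidableEq X] (p : Prog n X) (x : X) :
    ((p.run G nbr).map Execution.output) x =
      ENNReal.ofReal (expect G nbr p fun y => if y = x then 1 else 0) := by
  induction p with
  | ret y =>
    by_cases h : y = x
    · subst h
      simp [run, PMF.pure_map, expect]
    · simp [run, PMF.pure_map, expect, h, PMF.pure_apply, Ne.symm h]
  | step p ih => simp only [run, PMF.map_comp]; exact ih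
  | degree v f ih => simp only [run, PMF.map_comp]; exact ih _
  | neighbor v j f ih => simp only [run, PMF.map_comp]; exact ih _
  | pair u v f ih => simp only [run, PMF.map_comp]; exact ih _
  | rand N f ih =>
    have hnn : ∀ j : Fin (N + 1), 0 ≤ expect G nbr (f j) fun y => if y = x then 1 else 0 :=
      fun j => (expect_const (G := G) (nbr := nbr) (f j) 0).symm.le.trans
        (expect_mono fun r _ => by split_ifs <;> norm_num)
    have hcomp : Execution.output ∘ Execution.addStep = (Execution.output : Execution X → X) := rfl
    simp only [run, PMF.map_bind, PMF.map_comp, hcomp, PMF.bind_apply, tsum_fintype, ih, expect,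
      PMF.uniformOfFintype_apply, Fintype.card_fin]
    rw [ENNReal.ofReal_div_of_pos (by positivity), ENNReal.ofReal_sum_of_nonneg fun j _ => hnn j,
      ← Finset.mul_sum, ENNReal.div_eq_inv_mul, ENNReal.ofReal_natCast]

/-! #### Certain properties of executions -/

theorem Within.mono {p : Prog n X} {P Q : X → Prop} {c d : ℕ} (h : Within G nbr p P c)
    (hPQ : ∀ x, P x → Q x) (hcd : c ≤ d) : Within G nbr p Q d :=
  fun r hr => ⟨hPQ _ (h r hr).1, (h r hr).2.1, (h r hr).2.2.trans hcd⟩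

theorem within_pure {x : X} {P : X → Prop} (hx : P x) {c : ℕ} :
    Within G nbr (pure x : Prog n X) P c := by
  intro r hr
  change r ∈ (PMF.pure (⟨x, 0, 0⟩ : Execution X)).support at hr
  rw [PMF.support_pure, Set.mem_singleton_iff] at hr
  subst hr
  exact ⟨hx, le_rfl, Nat.zero_le c⟩

theorem Within.bind {p : Prog n X} {g : X → Prog n Y} {P : X → Prop} {Q : Y → Prop} {c d e : ℕ}
    (hp : Within G nbr p P c) (hg : ∀ x, P x → Within G nbr (g x) Q d) (hcd : c + d ≤ e) :
    Within G nbr (p >>= g) Q e := by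
  intro r hr
  obtain ⟨r₁, h₁, r₂, h₂, rfl⟩ := splitsAs_run_bind p g r hr
  obtain ⟨hP, hq₁, hs₁⟩ := hp r₁ h₁
  obtain ⟨hQ, hq₂, hs₂⟩ := hg _ hP r₂ h₂
  exact ⟨hQ, by simp only; omega, by simp only; omega⟩

theorem within_pure_eq (x : X) {c : ℕ} : Within G nbr (pure x : Prog n X) (· = x) c :=
  within_pure (P := (· = x)) rfl

theorem Within.bind_eq {p : Prog n X} {g : X → Prog n Y} {x : X} {Q : Y → Prop} {c d e : ℕ}
    (hp : Within G nbr p (· = x) c) (hg : Within G nbr (g x) Q d) (hcd : c + d ≤ e) :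
    Within G nbr (p >>= g) Q e :=
  hp.bind (fun _ hx => hx ▸ hg) hcd

theorem within_step {p : Prog n X} {P : X → Prop} {c : ℕ} (h : Within G nbr p P c) :
    Within G nbr (step p) P (c + 1) := by
  intro r hr
  obtain ⟨r', hr', rfl⟩ := (PMF.mem_support_map_iff _ _ _).1 hr
  obtain ⟨hP, hq, hs⟩ := h r' hr'
  exact ⟨hP, by simp only [Execution.addStep]; omega, by simp only [Execution.addStep]; omega⟩

theorem within_tick (c : ℕ) : Within G nbr (tick c : Prog n Unit) (fun _ => True) c := by
  induction c with
  | zero => exact within_pure trivial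
  | succ c ih => exact within_step ih

theorem Within.tick_bind {g : Unit → Prog n X} {Q : X → Prop} {c d e : ℕ}
    (hg : Within G nbr (g ()) Q d) (hcd : c + d ≤ e) : Within G nbr (tick c >>= g) Q e :=
  (within_tick c).bind (fun _ _ => hg) hcd

theorem within_of_run_map_addQuery {p q : Prog n X} {P : X → Prop} {c : ℕ}
    (hrun : p.run G nbr = (q.run G nbr).map Execution.addQuery) (h : Within G nbr q P c) :
    Within G nbr p P (c + 1) := by
  intro r hr
  rw [hrun] at hr
  obtain ⟨r', hr', rfl⟩ := (PMF.mem_support_map_iff _ _ _).1 hr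
  obtain ⟨hP, hq, hs⟩ := h r' hr'
  exact ⟨hP, by simp only [Execution.addQuery]; omega, by simp only [Execution.addQuery]; omega⟩

theorem within_askDegree (v : Fin n) : Within G nbr (askDegree v) (· = G.degree v) 1 :=
  within_of_run_map_addQuery rfl (within_pure (P := (· = G.degree v)) (c := 0) rfl)

theorem within_askPair (u v : Fin n) :
    Within G nbr (askPair u v) (· = decide (G.Adj u v)) 1 :=
  within_of_run_map_addQuery rfl (within_pure (P := (· = decide (G.Adj u v))) (c := 0) rfl)

theorem within_askNeighbor (v : Fin n) (j : ℕ) :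
    Within G nbr (askNeighbor v j) (fun _ => True) 1 :=
  within_of_run_map_addQuery rfl (within_pure (c := 0) trivial)

theorem within_draw (N : ℕ) : Within G nbr (draw N) (fun _ => True) 1 := by
  intro r hr
  obtain ⟨j, r', hr', rfl⟩ := mem_support_run_rand.1 hr
  obtain ⟨-, hq, hs⟩ :=
    within_pure (G := G) (nbr := nbr) (P := fun _ => True) (c := 0) trivial r' hr'
  exact ⟨trivial, by simp only [Execution.addStep]; omega,
    by simp only [Execution.addStep]; omega⟩

theorem Within.expect_mono {p : Prog n X} {P : X → Prop} {c : ℕ} (h : Within G nbr p P c)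
    {F H : X → ℝ} (hFH : ∀ x, P x → F x ≤ H x) : expect G nbr p F ≤ expect G nbr p H :=
  Prog.expect_mono fun r hr => hFH _ (h r hr).1

theorem Within.expect_congr {p : Prog n X} {P : X → Prop} {c : ℕ} (h : Within G nbr p P c)
    {F H : X → ℝ} (hFH : ∀ x, P x → F x = H x) : expect G nbr p F = expect G nbr p H :=
  le_antisymm (h.expect_mono fun x hx => (hFH x hx).le) (h.expect_mono fun x hx => (hFH x hx).ge)

/-- A program with only one possible output. -/
theorem Within.expect_eq {p : Prog n X} {x : X} {c : ℕ} (h : Within G nbr p (· = x) c)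
    (F : X → ℝ) : expect G nbr p F = F x := by
  rw [h.expect_congr (H := fun _ => F x) (fun y hy => by rw [hy]), expect_const]

theorem expect_nonneg {p : Prog n X} {F : X → ℝ} (h : ∀ x, 0 ≤ F x) : 0 ≤ expect G nbr p F :=
  (expect_const (G := G) (nbr := nbr) p 0).symm.le.trans (expect_mono fun _ _ => h _)

theorem expect_mono' {p : Prog n X} {F H : X → ℝ} (h : ∀ x, F x ≤ H x) :
    expect G nbr p F ≤ expect G nbr p H :=
  expect_mono fun _ _ => h _

end Prog

end Semantics

/-! ### The alias method -/

section Alias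

variable {n : ℕ} {G : SimpleGraph (Fin n)} [DecidableRel G.Adj] {nbr : NeighborLists G} {X : Type}

/-- The total weight that an alias table of capacity `W` gives to a function of the items. -/
noncomputable def aliasWeight (W : ℕ) (table : List (AliasCell X)) (F : X → ℝ) : ℝ :=
  (table.map fun c => c.cut * F c.low + ((W : ℝ) - c.cut) * F c.high).sum

/-- The weighted sum of a function over a list of weighted items. -/
noncomputable def itemWeight (items : List (X × ℕ)) (F : X → ℝ) : ℝ :=
  (items.map fun x => x.2 * F x.1).sum

/-- There are `c` items, of average weight `W`, divided into those of weight `< W` and those of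
weight `≥ W`. -/
def AliasAdmissible (W c : ℕ) (small large : List (X × ℕ)) : Prop :=
  (∀ x ∈ small, x.2 < W) ∧ (∀ x ∈ large, W ≤ x.2) ∧ small.length + large.length = c ∧
    (small.map Prod.snd).sum + (large.map Prod.snd).sum = c * W

theorem sum_map_snd_le {W : ℕ} {l : List (X × ℕ)} (h : ∀ x ∈ l, x.2 < W) :
    (l.map Prod.snd).sum ≤ l.length * W := by
  have := List.sum_le_card_nsmul (l.map Prod.snd) W (by
    intro m hm
    obtain ⟨x, hx, rfl⟩ := List.mem_map.1 hm
    exact (h x hx).le)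
  simpa using this

theorem le_sum_map_snd {W : ℕ} {l : List (X × ℕ)} (h : ∀ x ∈ l, W ≤ x.2) :
    l.length * W ≤ (l.map Prod.snd).sum := by
  have := List.card_nsmul_le_sum (l.map Prod.snd) W (by
    intro m hm
    obtain ⟨x, hx, rfl⟩ := List.mem_map.1 hm
    exact h x hx)
  simpa using this

/-- The construction of the cells is deterministic, uses only the given items, and preserves the
weight of each item. -/
theorem exists_aliasCells (W c : ℕ) (small large : List (X × ℕ)) :
    ∃ cells, Within G nbr (aliasCells W c small large) (· = cells) (6 * c) ∧
      (∀ P : X → Prop, (∀ x ∈ small, P x.1) → (∀ x ∈ large, P x.1) →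
        ∀ x ∈ cells, P x.low ∧ P x.high) ∧
      (AliasAdmissible W c small large → cells.length = c ∧ (∀ x ∈ cells, x.cut ≤ W) ∧
          ∀ F, aliasWeight W cells F = itemWeight small F + itemWeight large F) := by
  have step : ∀ {c : ℕ} {cell : AliasCell X} {p : Prog n (List (AliasCell X))} {cells},
      Within G nbr p (· = cells) (6 * c) → Within G nbr (do
        Prog.tick 6
        let cells ← p
        return cell :: cells) (· = cell :: cells) (6 * (c + 1)) := fun {c _ _ _} h =>
    Within.tick_bind (d := 6 * c)
      (h.bind_eq (d := 0) (within_pure_eq _) le_rfl) (by omega)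
  induction c generalizing small large with
  | zero =>
    refine ⟨[], by rw [aliasCells]; exact within_pure_eq _; all_goals simp, by simp, ?_⟩
    rintro ⟨-, -, h, -⟩
    obtain ⟨rfl, rfl⟩ : small = [] ∧ large = [] := by simpa using h
    simp [aliasWeight, itemWeight]
  | succ c ih =>
    match small, large with
    | [], [] =>
      refine ⟨[], by rw [aliasCells]; exact within_pure_eq _; all_goals simp, by simp, ?_⟩
      rintro ⟨-, -, h, -⟩
      simp at h
    | (a, p) :: small, (b, q) :: large =>
      have hw : AliasAdmissible W (c + 1) ((a, p) :: small) ((b, q) :: large) →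
          p < W ∧ W ≤ q ∧ (∀ x ∈ small, x.2 < W) ∧ (∀ x ∈ large, W ≤ x.2) ∧
            small.length + large.length + 1 = c ∧
            p + q - W + (small.map Prod.snd).sum + (large.map Prod.snd).sum = c * W := by
        rintro ⟨h₁, h₂, h₃, h₄⟩
        simp only [List.mem_cons, forall_eq_or_imp, List.length_cons, List.map_cons, List.sum_cons,
          add_mul, one_mul] at h₁ h₂ h₃ h₄
        exact ⟨h₁.1, h₂.1, h₁.2, h₂.2, by omega, by omega⟩
      by_cases hlt : p + q - W < W
      · obtain ⟨cells, hrun, hP, hcells⟩ := ih ((b, p + q - W) :: small) large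
        refine ⟨⟨p, a, b⟩ :: cells, ?_, fun P hs hl => ?_, fun h => ?_⟩
        · rw [aliasCells]
          simp only [hlt, if_true]
          exact step hrun
        · simp only [List.mem_cons, forall_eq_or_imp] at hs hl ⊢
          refine ⟨⟨hs.1, hl.1⟩, hP P ?_ hl.2⟩
          simpa using ⟨hl.1, fun x y => hs.2 (x, y)⟩
        · obtain ⟨h₁, h₂, h₃, h₄, h₅, h₆⟩ := hw h
          obtain ⟨hlen, hcut, hF⟩ := hcells ⟨by simpa using ⟨hlt, fun x y => h₃ (x, y)⟩, h₄,
            by simp only [List.length_cons]; omega,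
            by simp only [List.map_cons, List.sum_cons]; omega⟩
          refine ⟨by simp [hlen], by simpa using ⟨h₁.le, hcut⟩, fun F => ?_⟩
          have := hF F
          have hc : ((p + q - W : ℕ) : ℝ) = p + q - W := by
            push_cast [show W ≤ p + q by omega]; ring
          simp only [aliasWeight, itemWeight, List.map_cons, List.sum_cons] at this ⊢
          rw [this, hc]
          ring
      · obtain ⟨cells, hrun, hP, hcells⟩ := ih small ((b, p + q - W) :: large)
        refine ⟨⟨p, a, b⟩ :: cells, ?_, fun P hs hl => ?_, fun h => ?_⟩
        · rw [aliasCells]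
          simp only [hlt, if_false]
          exact step hrun
        · simp only [List.mem_cons, forall_eq_or_imp] at hs hl ⊢
          refine ⟨⟨hs.1, hl.1⟩, hP P hs.2 ?_⟩
          simpa using ⟨hl.1, fun x y => hl.2 (x, y)⟩
        · obtain ⟨h₁, h₂, h₃, h₄, h₅, h₆⟩ := hw h
          obtain ⟨hlen, hcut, hF⟩ := hcells ⟨h₃,
            by simpa using ⟨not_lt.1 hlt, fun x y => h₄ (x, y)⟩,
            by simp only [List.length_cons]; omega,
            by simp only [List.map_cons, List.sum_cons]; omega⟩
          refine ⟨by simp [hlen], by simpa using ⟨h₁.le, hcut⟩, fun F => ?_⟩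
          have := hF F
          have hc : ((p + q - W : ℕ) : ℝ) = p + q - W := by
            push_cast [show W ≤ p + q by omega]; ring
          simp only [aliasWeight, itemWeight, List.map_cons, List.sum_cons] at this ⊢
          rw [this, hc]
          ring
    | [], (b, q) :: large =>
      obtain ⟨cells, hrun, hP, hcells⟩ := ih [] large
      refine ⟨⟨W, b, b⟩ :: cells, ?_, fun P hs hl => ?_, ?_⟩
      · rw [aliasCells]
        exact step hrun
      · simp only [List.mem_cons, forall_eq_or_imp] at hl ⊢
        exact ⟨⟨hl.1, hl.1⟩, hP P (by simp) hl.2⟩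
      · rintro ⟨-, h₂, h₃, h₄⟩
        simp only [List.mem_cons, forall_eq_or_imp, List.length_cons, List.map_cons, List.sum_cons,
          add_mul, one_mul, List.length_nil, List.map_nil, List.sum_nil] at h₂ h₃ h₄
        have hle := le_sum_map_snd h₂.2
        have hlc : large.length = c := by omega
        rw [hlc] at hle
        -- every heavy item has weight exactly `W` once there are no light ones
        obtain rfl : q = W := by omega
        obtain ⟨hlen, hcut, hF⟩ := hcells ⟨by simp, h₂.2, by simpa using hlc, by simp; omega⟩
        refine ⟨by simp [hlen], by simpa using hcut, fun F => ?_⟩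
        have := hF F
        simp only [aliasWeight, itemWeight, List.map_cons, List.sum_cons, List.map_nil,
          List.sum_nil] at this ⊢
        rw [this]
        ring
    | (a, p) :: small, [] =>
      obtain ⟨cells, hrun, hP, hcells⟩ := ih small []
      refine ⟨⟨W, a, a⟩ :: cells, ?_, fun P hs hl => ?_, ?_⟩
      · rw [aliasCells]
        exact step hrun
      · simp only [List.mem_cons, forall_eq_or_imp] at hs ⊢
        exact ⟨⟨hs.1, hs.1⟩, hP P hs.2 (by simp)⟩
      · rintro ⟨h₁, -, h₃, h₄⟩
        simp only [List.mem_cons, forall_eq_or_imp, List.length_cons, List.map_cons, List.sum_cons,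
          add_mul, one_mul, List.length_nil, List.map_nil, List.sum_nil] at h₁ h₃ h₄
        have hle := sum_map_snd_le h₁.2
        have hlc : small.length = c := by omega
        rw [hlc] at hle
        omega

theorem itemWeight_filter_add (W : ℕ) (items : List (X × ℕ)) (F : X → ℝ) :
    itemWeight (items.filter fun x => x.2 < W) F + itemWeight (items.filter fun x => W ≤ x.2) F =
      itemWeight items F := by
  induction items with
  | nil => simp [itemWeight]
  | cons x items ih =>
    rcases lt_or_ge x.2 W with h | h
    · simp only [itemWeight, h, decide_true, List.filter_cons_of_pos, List.map_cons,
        List.sum_cons, not_le.2 h, decide_false, Bool.false_eq_true, not_false_eq_true,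
        List.filter_cons_of_neg] at ih ⊢
      rw [← ih]; ring
    · simp only [itemWeight, h, decide_true, List.filter_cons_of_pos, List.map_cons,
        List.sum_cons, not_lt.2 h, decide_false, Bool.false_eq_true, not_false_eq_true,
        List.filter_cons_of_neg] at ih ⊢
      rw [← ih]; ring

theorem length_filter_lt_add (W : ℕ) (items : List (X × ℕ)) :
    (items.filter fun x => x.2 < W).length + (items.filter fun x => W ≤ x.2).length =
      items.length := by
  rw [List.length_eq_length_filter_add (l := items) fun x => decide (x.2 < W)]
  congr 2
  exact List.filter_congr fun x _ => by rw [← decide_not]; simp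

/-- The alias table of a list of weighted items of total weight `W` represents their weights. -/
theorem exists_aliasTable {W : ℕ} {items : List (X × ℕ)} (hW : (items.map Prod.snd).sum = W) :
    ∃ table, Within G nbr (aliasTable W items) (· = table) (10 * items.length) ∧
      (∀ P : X → Prop, (∀ x ∈ items, P x.1) → ∀ x ∈ table, P x.low ∧ P x.high) ∧
      table.length = items.length ∧ (∀ x ∈ table, x.cut ≤ W) ∧
        ∀ F, aliasWeight W table F = items.length * itemWeight items F := by
  obtain ⟨table, hrun, hP, htable⟩ := exists_aliasCells (G := G) (nbr := nbr) W items.length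
    ((items.map fun x => (x.1, items.length * x.2)).filter fun x => x.2 < W)
    ((items.map fun x => (x.1, items.length * x.2)).filter fun x => W ≤ x.2)
  have hscaled : ∀ F : X → ℝ, itemWeight (items.map fun x => (x.1, items.length * x.2)) F =
      items.length * itemWeight items F := by
    intro F
    simp only [itemWeight, List.map_map, ← List.sum_map_mul_left]
    congr 1
    refine List.map_congr_left fun x _ => ?_
    simp only [Function.comp, Nat.cast_mul]; ring
  have hsum : ∀ l : List (X × ℕ), ((l.map Prod.snd).sum : ℝ) = itemWeight l fun _ => 1 := by
    intro l
    simp [itemWeight, Nat.cast_list_sum, Function.comp_def]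
  obtain ⟨hlen, hcut, hF⟩ := htable ⟨by simp, by simp, by
    rw [length_filter_lt_add, List.length_map], by
    rw [← @Nat.cast_inj ℝ, Nat.cast_add, Nat.cast_mul]
    rw [hsum, hsum, itemWeight_filter_add, hscaled, ← hW, hsum]⟩
  refine ⟨table, ?_, fun P h => hP P ?_ ?_, hlen, hcut, fun F => ?_⟩
  · rw [aliasTable]
    exact hrun.tick_bind (by omega)
  · intro x hx
    obtain ⟨y, hy, rfl⟩ := List.mem_map.1 (List.mem_of_mem_filter hx)
    exact h y hy
  · intro x hx
    obtain ⟨y, hy, rfl⟩ := List.mem_map.1 (List.mem_of_mem_filter hx)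
    exact h y hy
  · rw [hF, itemWeight_filter_add, hscaled]

theorem sum_fin_ite_lt {W cut : ℕ} (h : cut ≤ W) (a b : ℝ) :
    ∑ r : Fin W, (if (r : ℕ) < cut then a else b) = cut * a + ((W : ℝ) - cut) * b := by
  rw [Fin.sum_univ_eq_sum_range fun r => if r < cut then a else b, Finset.sum_ite,
    Finset.sum_const, Finset.sum_const]
  have h₁ : (Finset.range W).filter (fun r => r < cut) = Finset.range cut := by
    ext r; simp only [Finset.mem_filter, Finset.mem_range]; omega
  have h₂ : (Finset.range W).filter (fun r => ¬ r < cut) = Finset.Ico cut W := by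
    ext r; simp only [Finset.mem_filter, Finset.mem_range, Finset.mem_Ico]; omega
  rw [h₁, h₂, Finset.card_range, Nat.card_Ico, nsmul_eq_mul, nsmul_eq_mul, Nat.cast_sub h]

theorem expect_aliasDraw {W : ℕ} {table : List (AliasCell X)} (hW : 0 < W)
    (hlen : 0 < table.length) (hcut : ∀ x ∈ table, x.cut ≤ W) (F : Option X → ℝ) :
    expect G nbr (aliasDraw W table) F =
      aliasWeight W table (fun x => F (some x)) / (table.length * W) := by
  simp only [aliasDraw, expect_bind, expect_tick, expect_pure, expect_draw hW, expect_draw hlen]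
  rw [← Finset.sum_div, div_div, mul_comm (W : ℝ)]
  congr 1
  rw [aliasWeight]
  conv_rhs => rw [← List.ofFn_getElem (xs := table.map _), List.sum_ofFn]
  refine Fintype.sum_equiv (finCongr (by simp)) _ _ fun j => ?_
  simp only [finCongr_apply, Fin.val_cast, List.getElem_map]
  rw [← sum_fin_ite_lt (hcut _ (List.getElem_mem _))]
  refine Finset.sum_congr rfl fun r _ => ?_
  simp only [Fin.is_lt, getElem?_pos, Option.map_some]
  split_ifs <;> rfl

theorem within_aliasDraw {W : ℕ} {table : List (AliasCell X)} {P : X → Prop}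
    (hP : ∀ x ∈ table, P x.low ∧ P x.high) :
    Within G nbr (aliasDraw W table) (fun o => ∀ x ∈ o, P x) 5 := by
  refine (within_draw _).bind (d := 4) (fun j _ => (within_draw _).bind (d := 3) (fun r _ =>
    Within.tick_bind (d := 0) (within_pure ?_) le_rfl) le_rfl) le_rfl
  intro x hx
  obtain ⟨c, hc, rfl⟩ := Option.map_eq_some_iff.1 (Option.mem_def.1 hx)
  have := hP c (List.mem_of_getElem? hc)
  split_ifs
  exacts [this.1, this.2]

end Alias

/-! ### Sample-Set -/

section SampleSet

variable {n : ℕ} (G : SimpleGraph (Fin n)) [DecidableRel G.Adj]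

/-- The degree of a tuple: the least degree of its members (`0` for the empty tuple). -/
def tupleDegree (T : List (Fin n)) : ℕ := ((T.map fun v => G.degree v).min?).getD 0

/-- The vertices that extend the tuple `T` to a larger ordered clique, if it is one. -/
def extensions (T : List (Fin n)) : Finset (Fin n) := Finset.univ.filter fun v => ∀ u ∈ T, G.Adj v u

/-- The sum of `f` over the one-vertex extensions of `T`. -/
def extSum (f : List (Fin n) → ℝ) (T : List (Fin n)) : ℝ := ∑ v ∈ extensions G T, f (T ++ [v])

variable {G} {nbr : NeighborLists G}

theorem tupleDegree_eq {T : List (Fin n)} {u : Fin n} (hu : u ∈ T)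
    (hmin : ∀ v ∈ T, G.degree u ≤ G.degree v) : tupleDegree G T = G.degree u := by
  have : (T.map fun v => G.degree v).min? = some (G.degree u) := by
    rw [List.min?_eq_some_iff]
    exact ⟨List.mem_map_of_mem hu, by simpa using hmin⟩
  simp [tupleDegree, this]

theorem exists_mem_tupleDegree_eq {T : List (Fin n)} (hT : T ≠ []) :
    ∃ u ∈ T, tupleDegree G T = G.degree u ∧ ∀ v ∈ T, G.degree u ≤ G.degree v := by
  obtain ⟨u, hu, hmin⟩ := Finset.exists_min_image T.toFinset (fun v => G.degree v)
    (by simpa using hT)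
  simp only [List.mem_toFinset] at hu hmin
  exact ⟨u, hu, tupleDegree_eq hu hmin, hmin⟩

theorem exists_minDegreeFrom (u : Fin n) (T : List (Fin n)) :
    ∃ w, (w = u ∨ w ∈ T) ∧ G.degree w ≤ G.degree u ∧ (∀ v ∈ T, G.degree w ≤ G.degree v) ∧
      Within G nbr (minDegreeFrom (u, G.degree u) T) (· = (w, G.degree w)) (4 * T.length) := by
  induction T generalizing u with
  | nil => exact ⟨u, by simp, le_rfl, by simp, within_pure_eq _⟩
  | cons v T ih =>
    have key : ∀ b : Fin n, (b = u ∨ b = v) → G.degree b ≤ G.degree u → G.degree b ≤ G.degree v →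
        (if G.degree v < G.degree u ∨ (G.degree v = G.degree u ∧ v < u) then (v, G.degree v)
          else (u, G.degree u)) = (b, G.degree b) →
        ∃ w, (w = u ∨ w ∈ v :: T) ∧ G.degree w ≤ G.degree u ∧
          (∀ x ∈ v :: T, G.degree w ≤ G.degree x) ∧
          Within G nbr (minDegreeFrom (u, G.degree u) (v :: T)) (· = (w, G.degree w))
            (4 * (v :: T).length) := by
      intro b hb hbu hbv hif
      obtain ⟨w, hw, hwb, hwT, hrun⟩ := ih b
      refine ⟨w, ?_, hwb.trans hbu, ?_, ?_⟩
      · rcases hw with rfl | hw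
        · rcases hb with rfl | rfl <;> simp
        · simp [hw]
      · simpa using ⟨hwb.trans hbv, hwT⟩
      · rw [minDegreeFrom]
        refine (within_askDegree v).bind_eq (d := 3 + 4 * T.length) ?_
          (by simp only [List.length_cons]; omega)
        refine Within.tick_bind (d := 4 * T.length) ?_ le_rfl
        simp only [hif]
        exact hrun
    by_cases hlt : G.degree v < G.degree u ∨ (G.degree v = G.degree u ∧ v < u)
    · exact key v (Or.inr rfl) (by omega) le_rfl (by rw [if_pos hlt])
    · exact key u (Or.inl rfl) le_rfl (by omega) (by rw [if_neg hlt])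

theorem exists_minDegree {T : List (Fin n)} (hT : T ≠ []) :
    ∃ u ∈ T, tupleDegree G T = G.degree u ∧
      Within G nbr (minDegree T) (· = some (u, G.degree u)) (4 * T.length) := by
  match T with
  | v :: T =>
    obtain ⟨w, hw, hwv, hwT, hrun⟩ := exists_minDegreeFrom (G := G) (nbr := nbr) v T
    have hmem : w ∈ v :: T := by rcases hw with rfl | hw <;> simp [*]
    refine ⟨w, hmem, tupleDegree_eq hmem (by simpa using ⟨hwv, hwT⟩), ?_⟩
    rw [minDegree]
    refine (within_askDegree v).bind_eq (d := 4 * T.length) ?_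
      (by simp only [List.length_cons]; omega)
    exact hrun.bind_eq (d := 0) (within_pure_eq _) le_rfl

theorem within_withDegrees {t : ℕ} (ht : 1 ≤ t) {R : List (List (Fin n))}
    (hR : ∀ T ∈ R, T.length = t) :
    Within G nbr (withDegrees R) (· = R.map fun T => (T, tupleDegree G T))
      ((4 * t + 2) * R.length) := by
  induction R with
  | nil => exact within_pure_eq _
  | cons T R ih =>
    simp only [List.mem_cons, forall_eq_or_imp] at hR
    obtain ⟨u, -, hu, hrun⟩ := exists_minDegree (G := G) (nbr := nbr) (T := T)
      (by rintro rfl; simp at hR; omega)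
    rw [hR.1] at hrun
    rw [withDegrees]
    refine hrun.bind_eq (d := 2 + (4 * t + 2) * R.length) ?_
      (by simp only [List.length_cons]; ring_nf; omega)
    refine Within.tick_bind (d := (4 * t + 2) * R.length) ?_ le_rfl
    refine (ih hR.2).bind_eq (d := 0) ?_ le_rfl
    simp only [Option.map_some, Option.getD_some, List.map_cons, hu]
    exact within_pure_eq _

theorem within_adjacentToAll (v : Fin n) (T : List (Fin n)) :
    Within G nbr (adjacentToAll v T) (· = decide (∀ u ∈ T, G.Adj v u)) (2 * T.length) := by
  induction T with
  | nil => exact within_pure (by simp)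
  | cons u T ih =>
    rw [adjacentToAll]
    refine (within_askPair v u).bind_eq (d := 1 + 2 * T.length) ?_
      (by simp only [List.length_cons]; omega)
    refine Within.tick_bind (d := 2 * T.length) ?_ le_rfl
    exact ih.bind_eq (d := 0) (within_pure (by simp)) le_rfl

theorem within_sampleExtension {t W : ℕ} (ht : 1 ≤ t) {table : List (AliasCell (List (Fin n)))}
    (htable : ∀ x ∈ table, x.low.length = t ∧ x.high.length = t) :
    Within G nbr (sampleExtension W table) (fun o => ∀ T ∈ o, T.length = t + 1) (7 * t + 8) := by
  refine (within_aliasDraw (P := fun T => T.length = t) htable).bind (d := 7 * t + 3)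
    (fun o ho => ?_) (by omega)
  match o with
  | none => exact within_pure (by simp)
  | some T =>
    have hT : T.length = t := ho T rfl
    obtain ⟨u, -, -, hrun⟩ := exists_minDegree (G := G) (nbr := nbr) (T := T)
      (by rintro rfl; simp at hT; omega)
    rw [hT] at hrun
    refine hrun.bind_eq (d := 3 * t + 3) ?_ (by omega)
    refine (within_draw _).bind (d := 3 * t + 2) (fun j _ => ?_) (by omega)
    refine (within_askNeighbor u j).bind (d := 3 * t + 1) (fun o _ => ?_) (by omega)
    match o with
    | none => exact within_pure (by simp)
    | some v =>
      refine (within_adjacentToAll v T).bind (d := t + 1) (fun b _ => ?_) (by omega)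
      refine Within.tick_bind (d := 0) (within_pure ?_) (by omega)
      intro T' hT'
      split_ifs at hT'
      · simp only [Option.mem_def, Option.some.injEq] at hT'
        simp [← hT', hT]
      · simp at hT'

theorem within_sampleExtensions {t W : ℕ} (ht : 1 ≤ t) {table : List (AliasCell (List (Fin n)))}
    (htable : ∀ x ∈ table, x.low.length = t ∧ x.high.length = t) (s : ℕ) :
    Within G nbr (sampleExtensions W table s)
      (fun R => R.length ≤ s ∧ ∀ T ∈ R, T.length = t + 1) (s * (7 * t + 10)) := by
  induction s with
  | zero => exact within_pure (by simp)
  | succ s ih =>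
    rw [sampleExtensions]
    refine (within_sampleExtension ht htable).bind (d := 2 + s * (7 * t + 10)) (fun o ho => ?_)
      (by ring_nf; omega)
    refine Within.tick_bind (d := s * (7 * t + 10)) ?_ le_rfl
    refine ih.bind (d := 0) (fun R hR => within_pure ?_) le_rfl
    match o with
    | none => simpa using ⟨by omega, hR.2⟩
    | some T => simpa using ⟨by omega, ho T rfl, hR.2⟩

theorem totalDegree_withDegrees (R : List (List (Fin n))) :
    totalDegree (R.map fun T => (T, tupleDegree G T)) = (R.map (tupleDegree G)).sum := by
  simp [totalDegree, Function.comp_def]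

/-- Sample-Set amounts to building an alias table and drawing from it. -/
theorem exists_sampleSet {t : ℕ} (ht : 1 ≤ t) {R : List (List (Fin n))}
    (hR : ∀ T ∈ R, T.length = t) (s : ℕ) :
    ∃ table : List (AliasCell (List (Fin n))),
      (∀ x ∈ table, x.low.length = t ∧ x.high.length = t) ∧ table.length = R.length ∧
      (∀ x ∈ table, x.cut ≤ (R.map (tupleDegree G)).sum) ∧
      (∀ F, aliasWeight (R.map (tupleDegree G)).sum table F =
        R.length * (R.map fun T => tupleDegree G T * F T).sum) ∧
      (∀ F, expect G nbr (sampleSet R s) F =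
        expect G nbr (sampleExtensions (R.map (tupleDegree G)).sum table s) F) ∧
      Within G nbr (sampleSet R s) (fun R' => R'.length ≤ s ∧ ∀ T ∈ R', T.length = t + 1)
        ((4 * t + 13) * R.length + s * (7 * t + 10)) := by
  obtain ⟨table, hrun, hP, hlen, hcut, hF⟩ := exists_aliasTable (G := G) (nbr := nbr)
    (items := R.map fun T => (T, tupleDegree G T)) rfl
  change Within G nbr (aliasTable (totalDegree _) _) _ _ at hrun
  change ∀ x ∈ table, x.cut ≤ totalDegree _ at hcut
  change ∀ F, aliasWeight (totalDegree _) _ _ = _ at hF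
  have hw := within_withDegrees (G := G) (nbr := nbr) ht hR
  have htable := hP (fun T => T.length = t) (by simpa using hR)
  rw [List.length_map] at hlen hrun
  rw [totalDegree_withDegrees] at hcut hF hrun
  refine ⟨table, htable, hlen, hcut, fun F => ?_, fun F => ?_, ?_⟩
  · rw [hF, List.length_map, itemWeight, List.map_map]
    rfl
  · rw [sampleSet, expect_bind, hw.expect_eq, expect_bind, expect_tick, expect_bind,
      totalDegree_withDegrees, hrun.expect_eq]
  · rw [sampleSet]
    refine hw.bind_eq (d := 11 * R.length + s * (7 * t + 10)) ?_ (by ring_nf; omega)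
    refine Within.tick_bind (d := 10 * R.length + s * (7 * t + 10)) ?_ (by omega)
    rw [totalDegree_withDegrees]
    exact hrun.bind_eq (within_sampleExtensions ht htable s) le_rfl

/-- A uniform neighbour of the minimum-degree vertex, drawn with weight `d(T)`: each extension of
`T` gets weight one. -/
theorem tupleDegree_mul_expect {T : List (Fin n)} (hT : T ≠ []) (F : Option (List (Fin n)) → ℝ)
    (hF : F none = 0) :
    tupleDegree G T * expect G nbr (do
      match ← minDegree T with
      | none => return none
      | some (u, d) =>
        let j ← Prog.draw (d - 1)
        match ← Prog.askNeighbor u j with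
        | none => return none
        | some v =>
          let b ← adjacentToAll v T
          Prog.tick (T.length + 1)
          return if b then some (T ++ [v]) else none) F = extSum G (fun T => F (some T)) T := by
  obtain ⟨u, hu, hdeg, hrun⟩ := exists_minDegree (G := G) (nbr := nbr) hT
  have hsub : extensions G T ⊆ G.neighborFinset u := fun v hv => by
    simp only [extensions, Finset.mem_filter, Finset.mem_univ, true_and] at hv
    simpa using (hv u hu).symm
  rcases Nat.eq_zero_or_pos (G.degree u) with h0 | hpos
  · have : extensions G T = ∅ := by
      rw [← Finset.subset_empty,
        ← Finset.card_eq_zero.1 (show (G.neighborFinset u).card = 0 from h0)]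
      exact hsub
    simp [hdeg, h0, extSum, this]
  rw [expect_bind, hrun.expect_eq, hdeg]
  simp only [expect_bind, expect_draw hpos, expect_askNeighbor,
    (within_adjacentToAll _ T).expect_eq, expect_tick, expect_pure]
  rw [mul_div_cancel₀ _ (by positivity)]
  rw [(nbr u).sum_comp (fun v => F (if decide (∀ w ∈ T, G.Adj v w) = true then some (T ++ [v.1])
    else none))]
  rw [← Finset.sum_subtype (p := (· ∈ G.neighborSet u)) (G.neighborFinset u) (fun v => by simp)
    (fun v => F (if decide (∀ w ∈ T, G.Adj v w) = true then some (T ++ [v]) else none)),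
    extSum, ← Finset.sum_subset hsub]
  · refine Finset.sum_congr rfl fun v hv => ?_
    simp only [extensions, Finset.mem_filter, Finset.mem_univ, true_and] at hv
    rw [if_pos (by simpa using hv)]
  · intro v _ hv
    simp only [extensions, Finset.mem_filter, Finset.mem_univ, true_and] at hv
    rw [if_neg (by simpa using hv), hF]

/-- One attempt of Sample-Set hits every extension of every member of `R` with probability
`1 / d(R)`. -/
theorem expect_sampleExtension {R : List (List (Fin n))} (hR : ∀ T ∈ R, T ≠ [])
    (hpos : 0 < (R.map (tupleDegree G)).sum) {table : List (AliasCell (List (Fin n)))}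
    (hlen : table.length = R.length) (hcut : ∀ x ∈ table, x.cut ≤ (R.map (tupleDegree G)).sum)
    (hweight : ∀ F, aliasWeight (R.map (tupleDegree G)).sum table F =
        R.length * (R.map fun T => tupleDegree G T * F T).sum)
    (F : Option (List (Fin n)) → ℝ) (hF : F none = 0) :
    expect G nbr (sampleExtension (R.map (tupleDegree G)).sum table) F =
      (R.map (extSum G fun T => F (some T))).sum / ((R.map (tupleDegree G)).sum : ℕ) := by
  have hRlen : 0 < R.length := by
    rcases R with _ | ⟨T, R⟩ <;> simp at hpos ⊢
  rw [sampleExtension, expect_bind, expect_aliasDraw hpos (hlen ▸ hRlen) hcut, hweight, hlen,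
    mul_div_mul_left _ _ (by positivity)]
  congr 2
  exact List.map_congr_left fun T hT => tupleDegree_mul_expect (hR T hT) F hF

theorem expect_sampleExtensions_sum (W : ℕ) (table : List (AliasCell (List (Fin n)))) (s : ℕ)
    (f : List (Fin n) → ℝ) :
    expect G nbr (sampleExtensions W table s) (fun R => (R.map f).sum) =
      s * expect G nbr (sampleExtension W table) fun o => (o.map f).getD 0 := by
  induction s with
  | zero => simp [sampleExtensions]
  | succ s ih =>
    have hsum : ∀ (o : Option (List (Fin n))) (R : List (List (Fin n))),
        ((o.toList ++ R).map f).sum = (o.map f).getD 0 + (R.map f).sum := by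
      rintro (_ | T) R <;> simp
    simp only [sampleExtensions, expect_bind, expect_pure, hsum, expect_add, ih,
      expect_const]
    push_cast
    ring

theorem expect_sampleExtensions_prod (W : ℕ) (table : List (AliasCell (List (Fin n)))) (s : ℕ)
    (h : List (Fin n) → ℝ) :
    expect G nbr (sampleExtensions W table s) (fun R => (R.map h).prod) =
      (expect G nbr (sampleExtension W table) fun o => (o.map h).getD 1) ^ s := by
  induction s with
  | zero => simp [sampleExtensions]
  | succ s ih =>
    have hprod : ∀ (o : Option (List (Fin n))) (R : List (List (Fin n))),
        ((o.toList ++ R).map h).prod = (o.map h).getD 1 * (R.map h).prod := by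
      rintro (_ | T) R <;> simp
    simp only [sampleExtensions, expect_bind, expect_tick, expect_pure, hprod, expect_const_mul, ih]
    simp only [mul_comm _ (_ ^ s), expect_const_mul]
    ring

/-- The sum of `f` over the sample is `s / d(R)` times the sum over all extensions on average. -/
theorem expect_sampleSet_sum {t : ℕ} (ht : 1 ≤ t) {R : List (List (Fin n))}
    (hR : ∀ T ∈ R, T.length = t) (hpos : 0 < (R.map (tupleDegree G)).sum) (s : ℕ)
    (f : List (Fin n) → ℝ) :
    expect G nbr (sampleSet R s) (fun R' => (R'.map f).sum) =
      s * ((R.map (extSum G f)).sum / ((R.map (tupleDegree G)).sum : ℕ)) := by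
  obtain ⟨table, -, hlen, hcut, hweight, hexp, -⟩ :=
    exists_sampleSet (G := G) (nbr := nbr) ht hR s
  rw [hexp, expect_sampleExtensions_sum, expect_sampleExtension
    (fun T hT h => by have := hR T hT; simp [h] at this; omega) hpos hlen hcut hweight _ rfl]
  rfl

theorem exp_neg_le_one_sub_add {x : ℝ} (hx : 0 ≤ x) : Real.exp (-x) ≤ 1 - x + x ^ 2 / 2 := by
  have h := Real.quadratic_le_exp_of_nonneg hx
  rw [Real.exp_neg, inv_le_iff_one_le_mul₀ (Real.exp_pos x)]
  have h2 : 0 ≤ 1 - x + x ^ 2 / 2 := by nlinarith [sq_nonneg (x - 1)]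
  nlinarith [mul_le_mul_of_nonneg_left h h2, sq_nonneg (x ^ 2)]

/-- The lower tail of a sample: if every extension has `f`-value in `[0, M]`, then the sum over the
sample falls below `1 - g` times its mean with exponentially small probability. -/
theorem sampleSet_lower_tail {t : ℕ} (ht : 1 ≤ t) {R : List (List (Fin n))}
    (hR : ∀ T ∈ R, T.length = t) (hpos : 0 < (R.map (tupleDegree G)).sum) (s : ℕ)
    {f : List (Fin n) → ℝ} {M g μ : ℝ} (hM : 0 < M) (hg : 0 ≤ g)
    (hf0 : ∀ T, 0 ≤ f T) (hfM : ∀ T, T.length = t + 1 → f T ≤ M)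
    (hμ : μ = (R.map (extSum G f)).sum / ((R.map (tupleDegree G)).sum : ℕ)) :
    expect G nbr (sampleSet R s)
        (fun R' => if (1 - g) * (s * μ) ≤ (R'.map f).sum then 0 else 1) ≤
      Real.exp (-(g ^ 2 * (s * μ) / (2 * M))) := by
  obtain ⟨table, htable, hlen, hcut, hweight, hexp, -⟩ :=
    exists_sampleSet (G := G) (nbr := nbr) ht hR s
  set W := (R.map (tupleDegree G)).sum with hW
  have hR0 : ∀ T ∈ R, T ≠ [] := fun T hT h => by have := hR T hT; simp [h] at this; omega
  set l : ℝ := g / M with hl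
  have hl0 : 0 ≤ l := by positivity
  have hprod : ∀ R' : List (List (Fin n)),
      (R'.map fun T => Real.exp (-(l * f T))).prod = Real.exp (-(l * (R'.map f).sum)) := by
    intro R'
    induction R' with
    | nil => simp
    | cons T R' ih => rw [List.map_cons, List.prod_cons, ih, List.map_cons, List.sum_cons,
        ← Real.exp_add]; ring_nf
  have hone : ∀ (f : List (Fin n) → ℝ), expect G nbr (sampleExtension W table)
      (fun o => (o.map f).getD 0) = (R.map (extSum G f)).sum / (W : ℝ) := fun f =>
    expect_sampleExtension hR0 hpos hlen hcut hweight _ rfl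
  -- the exponential moment of one attempt
  have hmoment : expect G nbr (sampleExtension W table)
      (fun o => (o.map fun T => Real.exp (-(l * f T))).getD 1) ≤
        Real.exp (-(l * μ) + l ^ 2 * M / 2 * μ) := by
    calc _ ≤ expect G nbr (sampleExtension W table)
          (fun o => 1 + (-l + l ^ 2 * M / 2) * (o.map f).getD 0) := by
          refine (within_sampleExtension ht htable).expect_mono fun o ho => ?_
          match o with
          | none => simp
          | some T =>
            have h1 := exp_neg_le_one_sub_add (mul_nonneg hl0 (hf0 T))
            have h2 := hfM T (ho T rfl)
            simp only [Option.map_some, Option.getD_some]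
            have h3 : (l * f T) ^ 2 ≤ l ^ 2 * M * f T := by
              have := mul_le_mul_of_nonneg_left h2 (mul_nonneg (sq_nonneg l) (hf0 T))
              nlinarith
            linarith
      _ = 1 + (-l + l ^ 2 * M / 2) * μ := by
          rw [expect_add, expect_const, expect_const_mul, hone, hμ]
      _ ≤ _ := by
          have := Real.add_one_le_exp (-(l * μ) + l ^ 2 * M / 2 * μ)
          linarith
  have hnn : 0 ≤ expect G nbr (sampleExtension W table)
      (fun o => (o.map fun T => Real.exp (-(l * f T))).getD 1) :=
    expect_nonneg fun o => by rcases o with _ | T <;> simp [Real.exp_nonneg]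
  calc _ ≤ expect G nbr (sampleSet R s) (fun R' => Real.exp (l * ((1 - g) * (s * μ))) *
        (R'.map fun T => Real.exp (-(l * f T))).prod) := by
        refine expect_mono' fun R' => ?_
        rw [hprod, ← Real.exp_add]
        split_ifs with h
        · exact Real.exp_nonneg _
        · rw [Real.one_le_exp_iff]
          have := mul_le_mul_of_nonneg_left (not_le.1 h).le hl0
          linarith
    _ ≤ Real.exp (l * ((1 - g) * (s * μ))) * Real.exp (-(l * μ) + l ^ 2 * M / 2 * μ) ^ s := by
        rw [expect_const_mul, hexp, expect_sampleExtensions_prod]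
        gcongr
    _ = _ := by
        rw [← Real.exp_nat_mul, ← Real.exp_add]
        congr 1
        rw [hl]
        field_simp
        ring

end SampleSet

/-! ### One trial of Is-Active -/

section Trial

variable {n : ℕ} {G : SimpleGraph (Fin n)} [DecidableRel G.Adj] {nbr : NeighborLists G}
  {i k : ℕ} {α ε nk mt : ℝ} {τ : ℕ → ℝ}

theorem expect_trialRounds_zero (t : ℕ) (R : List (List (Fin n))) (ω ρ : ℝ) (F : Bool → ℝ) :
    expect G nbr (trialRounds i k α ε nk mt τ 0 t R ω ρ) F =
      F (decide (ρ * R.length ≤ τ i / 4)) := by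
  rw [trialRounds, expect_bind, expect_tick, expect_pure]

theorem expect_trialRounds_succ (c : ℕ) {t : ℕ} (ht : 1 ≤ t) {R : List (List (Fin n))}
    (hR : ∀ T ∈ R, T.length = t) (ω ρ : ℝ) (F : Bool → ℝ) {d s : ℕ}
    (hd : (R.map (tupleDegree G)).sum = d) (hs : sampleSize k ε τ t d ω = s) :
    expect G nbr (trialRounds i k α ε nk mt τ (c + 1) t R ω ρ) F =
      if sampleBound k α ε nk mt τ t < s then F false
      else expect G nbr (sampleSet R s) fun R' =>
        expect G nbr (trialRounds i k α ε nk mt τ c (t + 1) R'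
          ((1 - gammaPar k ε) * (ω * s / d)) (ρ * d / s)) F := by
  subst hd hs
  rw [trialRounds, expect_bind, (within_withDegrees ht hR).expect_eq, expect_bind, expect_tick,
    totalDegree_withDegrees]
  by_cases h : sampleBound k α ε nk mt τ t <
      sampleSize k ε τ t (R.map (tupleDegree G)).sum ω
  · simp only [if_pos h, expect_pure]
  · simp only [if_neg h, expect_bind]

theorem extSum_eq_zero {T : List (Fin n)} (hT : T ≠ []) (h : tupleDegree G T = 0)
    (f : List (Fin n) → ℝ) : extSum G f T = 0 := by
  obtain ⟨u, hu, hdeg, -⟩ := exists_mem_tupleDegree_eq (G := G) hT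
  refine Finset.sum_eq_zero fun v hv => ?_
  simp only [extensions, Finset.mem_filter, Finset.mem_univ, true_and] at hv
  have : 0 < G.degree u := (G.degree_pos_iff_exists_adj u).2 ⟨v, (hv u hu).symm⟩
  omega

theorem extSum_nonneg {f : List (Fin n) → ℝ} (hf : ∀ T, 0 ≤ f T) (T : List (Fin n)) :
    0 ≤ extSum G f T :=
  Finset.sum_nonneg fun _ _ => hf _

variable (G) in
/-- The potential of a tuple with `c` rounds to go: `b` for each of its extensions to full length,
and `θ t` times the degree of each of its extensions to length `t`. Up to the scale of the current
sample it bounds the probability that a trial ends with `χ = 0`. -/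
noncomputable def potential (θ : ℕ → ℝ) (b : ℝ) : ℕ → ℕ → List (Fin n) → ℝ
  | 0, _, _ => b
  | c + 1, t, T => θ t * tupleDegree G T + extSum G (potential θ b c (t + 1)) T

theorem potential_nonneg {θ : ℕ → ℝ} {b : ℝ} (hb : 0 ≤ b) :
    ∀ c t : ℕ, (∀ t', t ≤ t' → t' < t + c → 0 ≤ θ t') → ∀ T, 0 ≤ potential G θ b c t T := by
  intro c
  induction c with
  | zero => intro t _ T; exact hb
  | succ c ih =>
    intro t hθ T
    exact add_nonneg (mul_nonneg (hθ t le_rfl (by omega)) (Nat.cast_nonneg _))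
      (extSum_nonneg (ih _ fun t' h h' => hθ t' (by omega) (by omega)) T)

/-- The conditions under which both error probabilities of a trial are analysed: `κ t` is the value
of `ρ * ω`, where `ω` is the weight guess and `ρ` the scale of the sample, before round `t`. -/
structure TrialSetup (i k : ℕ) (ε : ℝ) (τ κ : ℕ → ℝ) : Prop where
  one_le : 1 ≤ i
  tau_pos : ∀ t, i ≤ t → t ≤ k → 0 < τ t
  gamma_pos : 0 < gammaPar k ε
  gamma_lt : gammaPar k ε < 1
  beta_pos : 0 < betaPar k
  beta_lt : betaPar k < 1
  kappa_succ : ∀ t, κ (t + 1) = (1 - gammaPar k ε) * κ t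
  kappa_ge : ∀ t, t ≤ k → τ i / 2 ≤ κ t

variable {κ : ℕ → ℝ}

theorem TrialSetup.log_pos (h : TrialSetup i k ε τ κ) : 0 < Real.log (2 / betaPar k) :=
  Real.log_pos (by
    rw [one_lt_div h.beta_pos]; linarith [h.beta_lt])

theorem TrialSetup.kappa_pos (h : TrialSetup i k ε τ κ) (hi : i ≤ k) {t : ℕ} (ht : t ≤ k) :
    0 < κ t := by
  have := h.tau_pos i le_rfl hi
  linarith [h.kappa_ge t ht]

theorem sampleSize_pos (h : TrialSetup i k ε τ κ) {t d : ℕ} (hit : i ≤ t) (htk : t < k) (hd : 0 < d)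
    {ω : ℝ} (hω : 0 < ω) : 0 < sampleSize k ε τ t d ω := by
  rw [sampleSize, Nat.ceil_pos]
  have := h.tau_pos (t + 1) (by omega) htk
  have := h.log_pos
  have := h.gamma_pos
  positivity

/-- The coefficient of the degrees in the potential: a trial is given up in round `t` with
probability at most `θ t` times the mean of the degree sum of its (scaled) sample. -/
noncomputable def abortCoeff (k : ℕ) (α ε nk mt : ℝ) (τ κ : ℕ → ℝ) (t : ℕ) : ℝ :=
  2 * (τ (t + 1) * (3 * Real.log (2 / betaPar k) / gammaPar k ε ^ 2)) /
    (κ t * sampleBound k α ε nk mt τ t)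

/-- Markov's inequality, unrolled over the rounds of a trial. -/
theorem expect_trialRounds_false_le (h : TrialSetup i k ε τ κ) (hik : i ≤ k)
    (hbound : ∀ t, i ≤ t → t < k → 2 ≤ sampleBound k α ε nk mt τ t) :
    ∀ (c t : ℕ) (R : List (List (Fin n))) (ω ρ : ℝ), t + c = k → i ≤ t →
      (∀ T ∈ R, T.length = t) → 0 ≤ ρ → (ρ * ω = κ t ∨ R = []) →
      expect G nbr (trialRounds i k α ε nk mt τ c t R ω ρ) (fun b => if b = false then 1 else 0) ≤
        ρ * (R.map (potential G (abortCoeff k α ε nk mt τ κ) (4 / τ i) c t)).sum := by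
  have hτi := h.tau_pos i le_rfl hik
  have hθ : ∀ t, i ≤ t → t < k → 0 ≤ abortCoeff k α ε nk mt τ κ t := by
    intro t hit htk
    have := h.tau_pos (t + 1) (by omega) htk
    have := h.log_pos
    have := h.gamma_pos
    have := h.kappa_pos hik htk.le
    have := hbound t hit htk
    rw [abortCoeff]
    positivity
  intro c
  induction c with
  | zero =>
    intro t R ω ρ _ _ _ hρ _
    rw [expect_trialRounds_zero]
    have hsum : (R.map (potential G (abortCoeff k α ε nk mt τ κ) (4 / τ i) 0 t)).sum =
        R.length * (4 / τ i) := by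
      simp [potential, List.map_const']
    rw [hsum]
    by_cases hle : ρ * R.length ≤ τ i / 4
    · simp only [hle, decide_true, Bool.true_eq_false, if_false]
      positivity
    · simp only [hle, decide_false, if_true]
      rw [← mul_assoc, mul_div_assoc', le_div_iff₀ hτi]
      linarith
  | succ c ih =>
    intro t R ω ρ htc hit hR hρ hκ
    have ht1 : 1 ≤ t := h.one_le.trans hit
    have htk : t < k := by omega
    have hb := hbound t hit htk
    have hpot : ∀ T, 0 ≤ potential G (abortCoeff k α ε nk mt τ κ) (4 / τ i) c (t + 1) T :=
      potential_nonneg (by positivity) c (t + 1) fun t' h1 h2 => hθ t' (by omega) (by omega)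
    have hext : 0 ≤ (R.map (extSum G (potential G (abortCoeff k α ε nk mt τ κ) (4 / τ i) c
        (t + 1)))).sum := List.sum_nonneg (by
      intro x hx
      obtain ⟨T, -, rfl⟩ := List.mem_map.1 hx
      exact extSum_nonneg hpot T)
    have hsum : (R.map (potential G (abortCoeff k α ε nk mt τ κ) (4 / τ i) (c + 1) t)).sum =
        abortCoeff k α ε nk mt τ κ t * ((R.map (tupleDegree G)).sum : ℕ) +
          (R.map (extSum G (potential G (abortCoeff k α ε nk mt τ κ) (4 / τ i) c
            (t + 1)))).sum := by
      clear hR hκ hext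
      induction R with
      | nil => simp
      | cons T R ihR =>
        rw [List.map_cons, List.sum_cons, ihR, List.map_cons, List.sum_cons, List.map_cons,
          List.sum_cons, Nat.cast_add, potential]
        ring
    rw [hsum, expect_trialRounds_succ c ht1 hR ω ρ _ rfl rfl]
    set d := (R.map (tupleDegree G)).sum with hd
    set s := sampleSize k ε τ t d ω with hs
    obtain ⟨table, -, -, -, -, -, hwithin⟩ := exists_sampleSet (G := G) (nbr := nbr) ht1 hR s
    rcases Nat.eq_zero_or_pos d with hd0 | hdpos
    · -- nothing to sample from: the estimate becomes zero
      have hs0 : s = 0 := by rw [hs, hd0]; simp [sampleSize]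
      rw [if_neg (by rw [hs0]; push_cast; linarith)]
      refine (hwithin.expect_mono (H := fun _ => 0) fun R' hR' => ?_).trans ?_
      · have hnil : R' = [] := List.length_eq_zero_iff.1 (by omega)
        refine (ih (t + 1) R' _ _ (by omega) (by omega) hR'.2 (by positivity)
          (Or.inr hnil)).trans ?_
        simp [hnil]
      · rw [expect_const]
        have := hθ t hit htk
        positivity
    · have hne : R ≠ [] := by rintro rfl; simp at hd; omega
      have hκt : ρ * ω = κ t := hκ.resolve_right hne
      have hκpos := h.kappa_pos hik htk.le
      have hωpos : 0 < ω := by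
        rcases lt_or_ge 0 ω with h0 | h0
        · exact h0
        · have := mul_nonpos_of_nonneg_of_nonpos hρ h0
          linarith
      have hρpos : 0 < ρ := by
        rcases hρ.eq_or_lt with h0 | h0
        · rw [← h0] at hκt; simp at hκt; linarith
        · exact h0
      have hspos : 0 < s := sampleSize_pos h hit htk hdpos hωpos
      have hτpos := h.tau_pos (t + 1) (by omega) htk
      have hlog := h.log_pos
      have hγ := h.gamma_pos
      by_cases habort : sampleBound k α ε nk mt τ t < s
      · -- the trial is given up, so that the degree sum is large
        rw [if_pos habort, if_pos rfl]
        have hceil : (s : ℝ) < d * τ (t + 1) / ω *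
            (3 * Real.log (2 / betaPar k) / gammaPar k ε ^ 2) + 1 :=
          Nat.ceil_lt_add_one (by positivity)
        have hkey : 1 ≤ ρ * (abortCoeff k α ε nk mt τ κ t * d) := by
          rw [abortCoeff, ← hκt]
          have : ρ * (2 * (τ (t + 1) * (3 * Real.log (2 / betaPar k) / gammaPar k ε ^ 2)) /
              (ρ * ω * sampleBound k α ε nk mt τ t) * d) =
              2 * (d * τ (t + 1) / ω * (3 * Real.log (2 / betaPar k) / gammaPar k ε ^ 2)) /
                sampleBound k α ε nk mt τ t := by
            field_simp
          rw [this, le_div_iff₀ (by linarith)]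
          linarith
        nlinarith [mul_nonneg hρ hext]
      · rw [if_neg habort]
        have hstep : ρ * d / s * (s * ((R.map (extSum G (potential G (abortCoeff k α ε nk mt τ κ)
            (4 / τ i) c (t + 1)))).sum / d)) = ρ * (R.map (extSum G (potential G
              (abortCoeff k α ε nk mt τ κ) (4 / τ i) c (t + 1)))).sum := by
          field_simp
        refine (hwithin.expect_mono fun R' hR' => ih (t + 1) R' _ _ (by omega) (by omega) hR'.2
          (by positivity) (Or.inl ?_)).trans ?_
        · rw [h.kappa_succ, ← hκt]
          field_simp
        · rw [expect_const_mul, expect_sampleSet_sum ht1 hR hdpos, hstep]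
          have := hθ t hit htk
          have : 0 ≤ ρ * (abortCoeff k α ε nk mt τ κ t * d) := by positivity
          linarith

/-- If the tuples sampled so far carry at least the guessed weight and no longer tuple is too
heavy, then the estimate stays large except with probability `β` per round. -/
theorem expect_trialRounds_true_le (h : TrialSetup i k ε τ κ) (hik : i ≤ k)
    {w : List (Fin n) → ℝ} (hw0 : ∀ T, 0 ≤ w T)
    (hwext : ∀ T, 1 ≤ T.length → T.length < k → extSum G w T = w T)
    (hwτ : ∀ T, i < T.length → T.length ≤ k → w T ≤ τ T.length)
    (hwk : ∀ T, T.length = k → w T ≤ 1) :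
    ∀ (c t : ℕ) (R : List (List (Fin n))) (ω ρ : ℝ), t + c = k → i ≤ t →
      (∀ T ∈ R, T.length = t) → 0 < ω → 0 ≤ ρ → ρ * ω = κ t → ω ≤ (R.map w).sum →
      expect G nbr (trialRounds i k α ε nk mt τ c t R ω ρ) (fun b => if b = true then 1 else 0) ≤
        c * betaPar k := by
  have hτi := h.tau_pos i le_rfl hik
  have hβ := h.beta_pos
  intro c
  induction c with
  | zero =>
    intro t R ω ρ htc hit hR hω hρ hκ hle
    rw [expect_trialRounds_zero]
    have hlen : (R.map w).sum ≤ R.length := by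
      have := List.sum_le_card_nsmul (R.map w) 1 (by
        intro x hx
        obtain ⟨T, hT, rfl⟩ := List.mem_map.1 hx
        exact hwk T (by rw [hR T hT]; omega))
      simpa using this
    have := mul_le_mul_of_nonneg_left (hle.trans hlen) hρ
    have hκ' := h.kappa_ge t (by omega)
    have : ¬ ρ * R.length ≤ τ i / 4 := by
      intro h'
      linarith
    simp [this]
  | succ c ih =>
    intro t R ω ρ htc hit hR hω hρ hκ hle
    have ht1 : 1 ≤ t := h.one_le.trans hit
    have htk : t < k := by omega
    have hsumw : (R.map (extSum G w)).sum = (R.map w).sum := by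
      congr 1
      exact List.map_congr_left fun T hT =>
        hwext T (by rw [hR T hT]; exact ht1) (by rw [hR T hT]; exact htk)
    rw [expect_trialRounds_succ c ht1 hR ω ρ _ rfl rfl]
    set d := (R.map (tupleDegree G)).sum with hd
    set s := sampleSize k ε τ t d ω with hs
    obtain ⟨table, -, -, -, -, -, hwithin⟩ := exists_sampleSet (G := G) (nbr := nbr) ht1 hR s
    have hdpos : 0 < d := by
      rcases Nat.eq_zero_or_pos d with hd0 | hdpos
      · have : (R.map (extSum G w)).sum = 0 := by
          refine List.sum_eq_zero fun x hx => ?_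
          obtain ⟨T, hT, rfl⟩ := List.mem_map.1 hx
          refine extSum_eq_zero (fun h => ?_) ?_ w
          · have := hR T hT
            simp [h] at this
            omega
          · have := List.sum_eq_zero_iff.1 (hd.symm.trans hd0) (tupleDegree G T)
              (List.mem_map_of_mem hT)
            exact this
        linarith
      · exact hdpos
    have hspos : 0 < s := sampleSize_pos h hit htk hdpos hω
    have hτpos := h.tau_pos (t + 1) (by omega) htk
    have hlog := h.log_pos
    have hγ := h.gamma_pos
    have hγ1 := h.gamma_lt
    by_cases habort : sampleBound k α ε nk mt τ t < s
    · rw [if_pos habort, if_neg Bool.false_ne_true]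
      positivity
    · rw [if_neg habort]
      set μ := (R.map (extSum G w)).sum / (d : ℝ) with hμ
      have hμω : ω / d ≤ μ := by
        rw [hμ, hsumw]
        gcongr
      have htail := sampleSet_lower_tail (nbr := nbr) ht1 hR hdpos s hτpos hγ.le hw0
        (fun T hT => by
          have := hwτ T (by omega) (by omega)
          rwa [hT] at this) hμ
      -- the number of samples is chosen to make the exponent at least `3 / 2 * log (2 / β)`
      have hexp : Real.exp (-(gammaPar k ε ^ 2 * (s * μ) / (2 * τ (t + 1)))) ≤ betaPar k := by
        have hs1 : d * τ (t + 1) / ω * (3 * Real.log (2 / betaPar k) / gammaPar k ε ^ 2) ≤ s :=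
          Nat.le_ceil _
        have h1 : τ (t + 1) * (3 * Real.log (2 / betaPar k) / gammaPar k ε ^ 2) ≤ s * μ := by
          calc _ = d * τ (t + 1) / ω * (3 * Real.log (2 / betaPar k) / gammaPar k ε ^ 2) *
                (ω / d) := by field_simp
            _ ≤ s * μ := by gcongr
        have h2 : Real.log (2 / betaPar k) ≤ gammaPar k ε ^ 2 * (s * μ) / (2 * τ (t + 1)) := by
          rw [le_div_iff₀ (by positivity)]
          have h3 : gammaPar k ε ^ 2 * (τ (t + 1) * (3 * Real.log (2 / betaPar k) /
              gammaPar k ε ^ 2)) = 3 * (τ (t + 1) * Real.log (2 / betaPar k)) := by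
            field_simp
          have h4 := mul_le_mul_of_nonneg_left h1 (sq_nonneg (gammaPar k ε))
          rw [h3] at h4
          have : 0 < τ (t + 1) * Real.log (2 / betaPar k) := by positivity
          linarith
        calc _ ≤ Real.exp (-Real.log (2 / betaPar k)) := Real.exp_le_exp.2 (by linarith)
          _ = betaPar k / 2 := by
            rw [Real.exp_neg, Real.exp_log (by positivity), inv_div]
          _ ≤ betaPar k := by linarith
      calc _ ≤ expect G nbr (sampleSet R s) (fun R' =>
            (if (1 - gammaPar k ε) * (s * μ) ≤ (R'.map w).sum then 0 else 1) +
              c * betaPar k) := by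
            refine hwithin.expect_mono fun R' hR' => ?_
            split_ifs with hlarge
            · rw [zero_add]
              refine ih (t + 1) R' _ _ (by omega) (by omega) hR'.2 ?_ (by positivity) ?_ ?_
              · have : 0 < 1 - gammaPar k ε := by linarith
                positivity
              · rw [h.kappa_succ, ← hκ]
                field_simp
              · refine le_trans ?_ hlarge
                have : 0 ≤ 1 - gammaPar k ε := by linarith
                have h5 : ω * s / d = s * (ω / d) := by ring
                rw [h5]
                gcongr
            · have h1 : ∀ p : Prog n Bool,
                  expect G nbr p (fun b => if b = true then 1 else 0) ≤ 1 := fun p =>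
                (expect_mono' fun b => by split_ifs <;> norm_num).trans (expect_const p 1).le
              have : 0 ≤ c * betaPar k := by positivity
              linarith [h1 (trialRounds i k α ε nk mt τ c (t + 1) R'
                ((1 - gammaPar k ε) * (ω * s / d)) (ρ * d / s))]
        _ ≤ _ := by
            rw [expect_add, expect_const]
            push_cast
            linarith

end Trial

/-! ### Amplification -/

section Amplification

variable {n : ℕ} {G : SimpleGraph (Fin n)} [DecidableRel G.Adj] {nbr : NeighborLists G}

theorem expect_countSuccesses_pow (p : Prog n Bool) (a : ℝ) (q : ℕ) :
    expect G nbr (countSuccesses p q) (fun x => a ^ x) =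
      (expect G nbr p fun b => a ^ b.toNat) ^ q := by
  induction q with
  | zero => simp [countSuccesses]
  | succ q ih =>
    simp only [countSuccesses, expect_bind, expect_tick, expect_pure, pow_add,
      mul_comm _ (a ^ Bool.toNat _), expect_const_mul, ih]
    rw [pow_one, ← expect_const_mul]
    congr 1
    ext b
    ring

/-- A majority of `q` trials, each of which succeeds with probability at most `1 / 4`, succeeds with
probability at most `(√3 / 2) ^ q`. -/
theorem expect_majority_true_le {p : Prog n Bool}
    (hp : expect G nbr p (fun b => if b = true then 1 else 0) ≤ 1 / 4) (q : ℕ) :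
    expect G nbr (countSuccesses p q) (fun x => if (q : ℝ) / 2 ≤ x then 1 else 0) ≤
      (√3 / 2) ^ q := by
  have h3 : (0 : ℝ) < √3 := by positivity
  have hsq : √3 ^ 2 = 3 := Real.sq_sqrt (by norm_num)
  have hpow : ∀ x : ℕ, (3 : ℝ) ^ x = √3 ^ (2 * x) := fun x => by rw [pow_mul, hsq]
  have h1 : 1 ≤ √3 := by rw [Real.one_le_sqrt]; norm_num
  calc _ ≤ expect G nbr (countSuccesses p q) (fun x => (√3 ^ q)⁻¹ * 3 ^ x) := by
        refine expect_mono' fun x => ?_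
        split_ifs with hx
        · rw [← div_eq_inv_mul, one_le_div (by positivity), hpow]
          have : q ≤ 2 * x := by
            have : (q : ℝ) ≤ 2 * x := by linarith
            exact_mod_cast this
          exact pow_le_pow_right₀ h1 this
        · positivity
    _ ≤ (√3 ^ q)⁻¹ * (3 / 2) ^ q := by
        rw [expect_const_mul, expect_countSuccesses_pow]
        have h1 : expect G nbr p (fun b => (3 : ℝ) ^ b.toNat) =
            1 + 2 * expect G nbr p (fun b => if b = true then 1 else 0) := by
          rw [← expect_const_mul, ← expect_const (G := G) (nbr := nbr) p 1, ← expect_add,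
            expect_const]
          congr 1
          ext b
          cases b <;> norm_num
        have h0 : 0 ≤ expect G nbr p (fun b => (3 : ℝ) ^ b.toNat) :=
          expect_nonneg fun b => by positivity
        gcongr
        linarith
    _ = _ := by
        rw [← inv_pow, ← mul_pow]
        congr 1
        field_simp
        linarith

theorem expect_majority_false_le {p : Prog n Bool}
    (hp : expect G nbr p (fun b => if b = false then 1 else 0) ≤ 1 / 4) (q : ℕ) :
    expect G nbr (countSuccesses p q) (fun x => if (q : ℝ) / 2 ≤ x then 0 else 1) ≤
      (√3 / 2) ^ q := by
  have h3 : (0 : ℝ) < √3 := by positivity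
  have hsq : √3 ^ 2 = 3 := Real.sq_sqrt (by norm_num)
  have hpow : ∀ x : ℕ, (3 : ℝ) ^ x = √3 ^ (2 * x) := fun x => by rw [pow_mul, hsq]
  have h1 : 1 ≤ √3 := by rw [Real.one_le_sqrt]; norm_num
  calc _ ≤ expect G nbr (countSuccesses p q) (fun x => √3 ^ q * (1 / 3) ^ x) := by
        refine expect_mono' fun x => ?_
        split_ifs with hx
        · positivity
        · rw [one_div, inv_pow, ← div_eq_mul_inv, one_le_div (by positivity), hpow]
          have : 2 * x ≤ q := by
            have : 2 * (x : ℝ) ≤ q := by linarith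
            exact_mod_cast this
          exact pow_le_pow_right₀ h1 this
    _ ≤ √3 ^ q * (1 / 2) ^ q := by
        rw [expect_const_mul, expect_countSuccesses_pow]
        have h1 : expect G nbr p (fun b => (1 / 3 : ℝ) ^ b.toNat) =
            1 / 3 + 2 / 3 * expect G nbr p (fun b => if b = false then 1 else 0) := by
          rw [← expect_const_mul, ← expect_const (G := G) (nbr := nbr) p (1 / 3), ← expect_add,
            expect_const]
          congr 1
          ext b
          cases b <;> norm_num
        have h0 : 0 ≤ expect G nbr p (fun b => (1 / 3 : ℝ) ^ b.toNat) :=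
          expect_nonneg fun b => by positivity
        gcongr
        linarith
    _ = _ := by
        rw [← mul_pow]
        congr 1
        ring

/-- As `√3 / 2 ≤ exp (-1 / 12)`, this many trials suffice. -/
theorem sqrt_three_div_two_pow_le {N δ : ℝ} (hN : 0 < N) (hδ : 0 < δ) :
    (√3 / 2) ^ ⌈12 * Real.log (N / δ)⌉₊ ≤ δ / N := by
  have hbase : √3 / 2 ≤ Real.exp (-(1 / 12)) := by
    have h1 := Real.add_one_le_exp (-(1 / 12 : ℝ))
    have h2 : √3 ≤ 11 / 6 := by
      rw [Real.sqrt_le_left (by norm_num)]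
      norm_num
    linarith
  calc _ ≤ Real.exp (-(1 / 12)) ^ ⌈12 * Real.log (N / δ)⌉₊ := by gcongr
    _ = Real.exp (-(⌈12 * Real.log (N / δ)⌉₊ / 12)) := by
        rw [← Real.exp_nat_mul]
        congr 1
        ring
    _ ≤ Real.exp (-Real.log (N / δ)) := by
        have := Nat.le_ceil (12 * Real.log (N / δ))
        exact Real.exp_le_exp.2 (by linarith)
    _ = δ / N := by rw [Real.exp_neg, Real.exp_log (by positivity), inv_div]

theorem expect_isActive (I : List (Fin n)) (k : ℕ) (α ε δ nk mt : ℝ) (τ : ℕ → ℝ) (F : Bool → ℝ) :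
    expect G nbr (isActive I k α ε δ nk mt τ) F =
      expect G nbr (countSuccesses (activeTrial I k α ε nk mt τ)
        ⌈12 * Real.log ((n : ℝ) ^ k / δ)⌉₊)
        fun x => F (decide ((⌈12 * Real.log ((n : ℝ) ^ k / δ)⌉₊ : ℝ) / 2 ≤ x)) := by
  simp [isActive]

theorem expect_activeTrial (I : List (Fin n)) (k : ℕ) (α ε nk mt : ℝ) (τ : ℕ → ℝ) (F : Bool → ℝ) :
    expect G nbr (activeTrial I k α ε nk mt τ) F =
      expect G nbr (trialRounds I.length k α ε nk mt τ (k - I.length) I.length [I]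
        ((1 - ε / 2) * τ I.length) 1) F := by
  simp [activeTrial]

/-- Is-Active rarely returns Active if its trials rarely do. -/
theorem expect_isActive_true_le {I : List (Fin n)} {k : ℕ} {α ε δ nk mt : ℝ} {τ : ℕ → ℝ}
    (hn : 0 < n) (hδ : 0 < δ)
    (hp : expect G nbr (activeTrial I k α ε nk mt τ) (fun b => if b = true then 1 else 0) ≤ 1 / 4) :
    expect G nbr (isActive I k α ε δ nk mt τ) (fun b => if b = true then 1 else 0) ≤
      δ / (n : ℝ) ^ k := by
  rw [expect_isActive]
  simp only [decide_eq_true_eq]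
  exact (expect_majority_true_le hp _).trans (sqrt_three_div_two_pow_le (by positivity) hδ)

theorem expect_isActive_false_le {I : List (Fin n)} {k : ℕ} {α ε δ nk mt : ℝ} {τ : ℕ → ℝ}
    (hn : 0 < n) (hδ : 0 < δ)
    (hp : expect G nbr (activeTrial I k α ε nk mt τ) (fun b => if b = false then 1 else 0) ≤
      1 / 4) :
    expect G nbr (isActive I k α ε δ nk mt τ) (fun b => if b = false then 1 else 0) ≤
      δ / (n : ℝ) ^ k := by
  rw [expect_isActive]
  simp only [decide_eq_false_iff_not, ite_not]
  exact (expect_majority_false_le hp _).trans (sqrt_three_div_two_pow_le (by positivity) hδ)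

end Amplification

/-! ### Orientations from forests -/

section Orientation

/-- In a forest every vertex has a parent (its predecessor on the path from the root of its
component), such that every edge joins a vertex to its parent. -/
theorem SimpleGraph.IsAcyclic.exists_parent {V : Type*} {F : SimpleGraph V} (hF : F.IsAcyclic) :
    ∃ f : V → V, ∀ u v, F.Adj u v → f u = v ∨ f v = u := by
  have hpath : ∀ v, ∃ p : F.Walk (F.connectedComponentMk v).nonempty_supp.some v, p.IsPath := by
    intro v
    have hr : F.Reachable (F.connectedComponentMk v).nonempty_supp.some v :=
      SimpleGraph.ConnectedComponent.exact (F.connectedComponentMk v).nonempty_supp.some_mem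
    exact hr.exists_isPath
  choose p hp using hpath
  refine ⟨fun v => (p v).penultimate, fun u v huv => ?_⟩
  have hroot : ∀ {c : V} (q : F.Walk c v), q.IsPath →
      c = (F.connectedComponentMk u).nonempty_supp.some →
      (p u).penultimate = v ∨ q.penultimate = u := by
    rintro c q hq rfl
    by_cases hv : v ∈ (p u).support
    · exact Or.inl (hF.eq_penultimate_of_adj_end (hp u) huv hv).symm
    · have hu := hF.mem_support_of_ne_mem_support_of_adj_of_isPath hq (hp u) huv.symm hv
      exact Or.inr (hF.eq_penultimate_of_adj_end hq huv.symm hu).symm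
  refine hroot (p v) (hp v) ?_
  rw [SimpleGraph.ConnectedComponent.sound huv.reachable]

variable {n : ℕ} (G : SimpleGraph (Fin n))

theorem exists_forest_cover : ∃ F : Fin (graphArboricity G) → SimpleGraph (Fin n),
    (∀ i, (F i).IsAcyclic) ∧ G ≤ ⨆ i, F i := by
  refine Nat.sInf_mem (s := {a : ℕ | ∃ F : Fin a → SimpleGraph (Fin n),
    (∀ i, (F i).IsAcyclic) ∧ G ≤ ⨆ i, F i}) ⟨n * n, fun i =>
      SimpleGraph.edge (finProdFinEquiv.symm i).1 (finProdFinEquiv.symm i).2, fun i => ?_, ?_⟩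
  · dsimp only
    by_cases h : (finProdFinEquiv.symm i).1 = (finProdFinEquiv.symm i).2
    · rw [h]; simp
    · have := SimpleGraph.isAcyclic_bot.sup_edge_of_not_reachable
        (u := (finProdFinEquiv.symm i).1) (v := (finProdFinEquiv.symm i).2) (by simpa using h)
      simpa using this
  · intro u v huv
    rw [SimpleGraph.iSup_adj]
    refine ⟨finProdFinEquiv (u, v), ?_⟩
    simp [SimpleGraph.edge_adj, huv.ne]

/-- The edges can be oriented such that the out-degrees are at most the arboricity. -/
theorem exists_orientation : ∃ out : Fin n → Finset (Fin n),
    (∀ v, (out v).card ≤ graphArboricity G) ∧ ∀ u v, G.Adj u v → v ∈ out u ∨ u ∈ out v := by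
  obtain ⟨F, hF, hG⟩ := exists_forest_cover G
  choose f hf using fun i => (hF i).exists_parent
  refine ⟨fun v => Finset.univ.image fun i => f i v, fun v => ?_, fun u v huv => ?_⟩
  · exact Finset.card_image_le.trans (by simp)
  · obtain ⟨i, hi⟩ := (SimpleGraph.iSup_adj.1 (hG huv))
    rcases hf i u v hi with h | h
    · exact Or.inl (Finset.mem_image.2 ⟨i, Finset.mem_univ _, h⟩)
    · exact Or.inr (Finset.mem_image.2 ⟨i, Finset.mem_univ _, h⟩)

end Orientation

/-! ### Hamiltonian paths of tournaments -/

section HamiltonianPath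

variable {V : Type*} {r : V → V → Prop}

/-- In a chain `L` for a relation that compares `a` with every member of `L`, the element `a` can be
inserted. The last condition controls the first element of the result, so that the induction on `L`
can put the old first element in front of it. -/
theorem List.IsChain.exists_insert {a : V} {L : List V} (hL : L.IsChain r)
    (ha : ∀ b ∈ L, r a b ∨ r b a) :
    ∃ L' : List V, L'.Perm (a :: L) ∧ L'.IsChain r ∧ ∀ x, r x a → (∀ y ∈ L.head?, r x y) →
      ∀ z ∈ L'.head?, r x z := by
  induction L with
  | nil => exact ⟨[a], .refl _, by simp, by simp +contextual⟩
  | cons b L ih =>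
    simp only [List.mem_cons, forall_eq_or_imp] at ha
    by_cases hab : r a b
    · exact ⟨a :: b :: L, .refl _, List.isChain_cons_cons.2 ⟨hab, hL⟩, by simp +contextual⟩
    · obtain ⟨L', hperm, hchain, hhead⟩ := ih hL.tail ha.2
      refine ⟨b :: L', (hperm.cons b).trans (List.Perm.swap a b L), ?_, by simp +contextual⟩
      rw [List.isChain_cons] at hL ⊢
      exact ⟨hhead b (ha.1.resolve_left hab) hL.1, hchain⟩

/-- A tournament has a Hamiltonian path. -/
theorem List.Pairwise.exists_perm_isChain {L : List V}
    (h : L.Pairwise fun a b => r a b ∨ r b a) : ∃ L' : List V, L'.Perm L ∧ L'.IsChain r := by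
  induction L with
  | nil => exact ⟨[], .refl _, by simp⟩
  | cons a L ih =>
    rw [List.pairwise_cons] at h
    obtain ⟨L', hperm, hchain⟩ := ih h.2
    obtain ⟨L'', hperm', hchain', -⟩ := hchain.exists_insert (a := a)
      fun b hb => h.1 b (hperm.mem_iff.1 hb)
    exact ⟨L'', hperm'.trans (hperm.cons a), hchain'⟩

end HamiltonianPath

/-! ### Counting ordered cliques -/

section Counting

variable {n : ℕ}

/-- The directed walks with `r` steps from `v`, as lists of vertices. -/
def walksFrom (out : Fin n → Finset (Fin n)) : ℕ → Fin n → Finset (List (Fin n))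
  | 0, v => {[v]}
  | r + 1, v => (out v).biUnion fun u => (walksFrom out r u).image (v :: ·)

theorem card_walksFrom_le {out : Fin n → Finset (Fin n)} {a : ℕ} (h : ∀ v, (out v).card ≤ a)
    (r : ℕ) (v : Fin n) : (walksFrom out r v).card ≤ a ^ r := by
  induction r generalizing v with
  | zero => simp [walksFrom]
  | succ r ih =>
    rw [walksFrom, pow_succ']
    refine Finset.card_biUnion_le.trans ((Finset.sum_le_card_nsmul _ _ (a ^ r) fun u _ =>
      Finset.card_image_le.trans (ih u)).trans ?_)
    rw [smul_eq_mul]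
    gcongr
    exact h v

theorem mem_walksFrom {out : Fin n → Finset (Fin n)} {v : Fin n} {L : List (Fin n)}
    (h : (v :: L).IsChain fun a b => b ∈ out a) : v :: L ∈ walksFrom out L.length v := by
  induction L generalizing v with
  | nil => simp [walksFrom]
  | cons u L ih =>
    rw [List.isChain_cons_cons] at h
    exact Finset.mem_biUnion.2 ⟨u, h.1, Finset.mem_image.2 ⟨_, ih h.2, rfl⟩⟩

variable (G : SimpleGraph (Fin n))

/-- For an orientation with out-degrees at most the arboricity, every ordered clique can be
rearranged into a directed walk. There are at most `α ^ r` walks with `r` steps from a vertex, and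
each of them is a rearrangement of at most `(r + 1)!` tuples. -/
theorem sum_orderedClique_le {r : ℕ} {𝒯 : Finset (List (Fin n))} {S : Finset (Fin n)}
    {w : List (Fin n) → ℝ} {f : Fin n → ℝ} {α : ℝ} (hα : (graphArboricity G : ℝ) ≤ α)
    (hT : ∀ T ∈ 𝒯, IsOrderedClique G T ∧ T.length = r + 1 ∧ ∀ v ∈ T, v ∈ S)
    (hf : ∀ v, 0 ≤ f v) (hw : ∀ T ∈ 𝒯, ∀ v ∈ T, w T ≤ f v) :
    ∑ T ∈ 𝒯, w T ≤ (r + 1).factorial * α ^ r * ∑ v ∈ S, f v := by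
  obtain ⟨out, hcard, hout⟩ := exists_orientation G
  have hterm : ∀ T ∈ 𝒯, w T ≤
      ∑ v ∈ S, ∑ L ∈ walksFrom out r v, if T ∈ L.permutations.toFinset then f v else 0 := by
    intro T hTT
    obtain ⟨hcl, hlen, hS⟩ := hT T hTT
    obtain ⟨L, hperm, hchain⟩ := (hcl.imp fun {a b} h => hout a b h).exists_perm_isChain
    match L with
    | [] => have := hperm.length_eq; simp at this; omega
    | v :: L =>
      have hv : v ∈ T := hperm.mem_iff.1 (by simp)
      have hlenL : L.length = r := by have := hperm.length_eq; simp at this; omega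
      have hmem : v :: L ∈ walksFrom out r v := hlenL ▸ mem_walksFrom hchain
      have hnn : ∀ v (L : List (Fin n)), 0 ≤ if T ∈ L.permutations.toFinset then f v else 0 :=
        fun v L => by split_ifs <;> simp [hf]
      refine le_trans ?_ (Finset.single_le_sum
        (f := fun v => ∑ L ∈ walksFrom out r v, if T ∈ L.permutations.toFinset then f v else 0)
        (fun v _ => Finset.sum_nonneg fun L _ => hnn v L) (hS v hv))
      refine le_trans ?_ (Finset.single_le_sum (fun L _ => hnn v L) hmem)
      rw [if_pos (by simpa using hperm.symm)]
      exact hw T hTT v hv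
  have hlenW : ∀ v, ∀ L ∈ walksFrom out r v, L.length = r + 1 := by
    clear hT hterm
    induction r with
    | zero => simp [walksFrom]
    | succ r ih =>
      intro v L hL
      obtain ⟨u, -, hL⟩ := Finset.mem_biUnion.1 hL
      obtain ⟨L', hL', rfl⟩ := Finset.mem_image.1 hL
      simp [ih u L' hL']
  calc ∑ T ∈ 𝒯, w T ≤ ∑ T ∈ 𝒯, ∑ v ∈ S, ∑ L ∈ walksFrom out r v,
        (if T ∈ L.permutations.toFinset then f v else 0) := Finset.sum_le_sum hterm
    _ = ∑ v ∈ S, ∑ L ∈ walksFrom out r v, ∑ T ∈ 𝒯,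
        (if T ∈ L.permutations.toFinset then f v else 0) := by
      rw [Finset.sum_comm]
      exact Finset.sum_congr rfl fun v _ => Finset.sum_comm
    _ ≤ ∑ v ∈ S, ∑ L ∈ walksFrom out r v, ((r + 1).factorial * f v) := by
      refine Finset.sum_le_sum fun v _ => Finset.sum_le_sum fun L hL => ?_
      rw [← Finset.sum_filter, Finset.sum_const, nsmul_eq_mul]
      refine mul_le_mul_of_nonneg_right ?_ (hf v)
      norm_cast
      calc _ ≤ L.permutations.toFinset.card := Finset.card_le_card fun T hT =>
            (Finset.mem_filter.1 hT).2
        _ ≤ L.permutations.length := List.toFinset_card_le _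
        _ = _ := by rw [List.length_permutations, hlenW v L hL]
    _ ≤ ∑ v ∈ S, α ^ r * ((r + 1).factorial * f v) := by
      refine Finset.sum_le_sum fun v _ => ?_
      rw [Finset.sum_const, nsmul_eq_mul]
      refine mul_le_mul_of_nonneg_right ?_ (mul_nonneg (Nat.cast_nonneg _) (hf v))
      calc ((walksFrom out r v).card : ℝ) ≤ (graphArboricity G : ℝ) ^ r := by
            exact_mod_cast card_walksFrom_le hcard r v
        _ ≤ α ^ r := by gcongr
    _ = _ := by
      rw [Finset.mul_sum]
      exact Finset.sum_congr rfl fun v _ => by ring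

open Classical in
/-- The ordered cliques of size `t`. -/
noncomputable def orderedCliques (t : ℕ) : Finset (List (Fin n)) :=
  (List.finite_length_eq (Fin n) t).toFinset.filter (IsOrderedClique G)

variable {G}

theorem mem_orderedCliques {t : ℕ} {T : List (Fin n)} :
    T ∈ orderedCliques G t ↔ T.length = t ∧ IsOrderedClique G T := by
  simp [orderedCliques]

theorem IsOrderedClique.nodup {T : List (Fin n)} (h : IsOrderedClique G T) : T.Nodup :=
  h.imp fun hab => hab.ne

theorem isOrderedClique_append_singleton {T : List (Fin n)} {v : Fin n} :
    IsOrderedClique G (T ++ [v]) ↔ IsOrderedClique G T ∧ ∀ u ∈ T, G.Adj u v := by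
  simp [IsOrderedClique, List.pairwise_append]

theorem isOrderedClique_of_toFinset {T : List (Fin n)} {C : Finset (Fin n)} (hC : G.IsClique C)
    (hT : T.Nodup) (hTC : T.toFinset ⊆ C) : IsOrderedClique G T := by
  refine hT.imp_of_mem fun {a b} ha hb hab => hC ?_ ?_ hab
  · exact hTC (by simpa using ha)
  · exact hTC (by simpa using hb)

theorem isNClique_toFinset {T : List (Fin n)} (h : IsOrderedClique G T) :
    G.IsNClique T.length T.toFinset := by
  refine ⟨?_, List.toFinset_card_of_nodup h.nodup⟩
  intro u hu v hv huv
  rw [Finset.mem_coe, List.mem_toFinset] at hu hv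
  have : Std.Symm G.Adj := ⟨fun _ _ h => h.symm⟩
  exact List.Pairwise.forall (R := G.Adj) h hu hv huv

variable [DecidableRel G.Adj]

theorem mem_extensions {T : List (Fin n)} {v : Fin n} :
    v ∈ extensions G T ↔ ∀ u ∈ T, G.Adj u v := by
  simp [extensions, G.adj_comm v]

theorem sum_orderedCliques_extSum (t : ℕ) (f : List (Fin n) → ℝ) :
    ∑ T ∈ orderedCliques G t, extSum G f T = ∑ T ∈ orderedCliques G (t + 1), f T := by
  simp only [extSum]
  rw [Finset.sum_sigma']
  refine Finset.sum_bij (fun x _ => x.1 ++ [x.2]) ?_ ?_ ?_ fun _ _ => rfl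
  · rintro ⟨T, v⟩ h
    simp only [Finset.mem_sigma, mem_orderedCliques, mem_extensions] at h
    simpa [mem_orderedCliques, isOrderedClique_append_singleton, h.1.1, h.1.2] using h.2
  · rintro ⟨T, v⟩ _ ⟨T', v'⟩ _ h
    have := List.append_inj' h rfl
    simp only [List.cons.injEq, and_true] at this
    obtain ⟨rfl, rfl⟩ := this
    rfl
  · intro T hT
    rw [mem_orderedCliques] at hT
    have hne : T ≠ [] := by rintro rfl; simp at hT
    have hd := List.dropLast_append_getLast hne
    have hcl := hT.2
    rw [← hd, isOrderedClique_append_singleton] at hcl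
    exact ⟨⟨T.dropLast, T.getLast hne⟩, by
      simpa [mem_orderedCliques, mem_extensions, hcl.1, hT.1] using hcl.2, hd⟩

/-- The degree of an ordered clique is at most the degree of the first vertex of its rearrangement
as a directed walk. -/
theorem sum_tupleDegree_le {t : ℕ} {α : ℝ} (hα : (graphArboricity G : ℝ) ≤ α) :
    ∑ T ∈ orderedCliques G (t + 1), (tupleDegree G T : ℝ) ≤
      (t + 1).factorial * α ^ t * (2 * G.edgeFinset.card) := by
  have hsum : (2 * G.edgeFinset.card : ℝ) = ∑ v : Fin n, (G.degree v : ℝ) := by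
    exact_mod_cast (G.sum_degrees_eq_twice_card_edges).symm
  rw [hsum]
  refine sum_orderedClique_le G hα (fun T hT => ?_) (fun v => Nat.cast_nonneg _) ?_
  · rw [mem_orderedCliques] at hT
    exact ⟨hT.2, hT.1, by simp⟩
  · intro T hT v hv
    obtain ⟨u, hu, hdeg, hmin⟩ := exists_mem_tupleDegree_eq (G := G) (List.ne_nil_of_mem hv)
    rw [hdeg]
    exact_mod_cast hmin v hv

/-- Every `k`-clique has `k!` orderings. -/
theorem card_orderedCliques (k : ℕ) :
    (orderedCliques G k).card = k.factorial * (G.cliqueFinset k).card := by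
  rw [Finset.card_eq_sum_card_fiberwise (f := List.toFinset) (t := G.cliqueFinset k), mul_comm,
    ← smul_eq_mul, ← Finset.sum_const]
  · refine Finset.sum_congr rfl fun C hC => ?_
    rw [SimpleGraph.mem_cliqueFinset_iff] at hC
    have : {T ∈ orderedCliques G k | T.toFinset = C} = C.toList.permutations.toFinset := by
      ext T
      simp only [Finset.mem_filter, mem_orderedCliques, List.mem_toFinset, List.mem_permutations]
      constructor
      · rintro ⟨⟨-, hcl⟩, rfl⟩
        exact (List.toFinset_toList hcl.nodup).symm
      · intro h
        have hfin : T.toFinset = C := by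
          rw [List.toFinset_eq_of_perm _ _ h, Finset.toList_toFinset]
        have hnd : T.Nodup := h.nodup_iff.2 C.nodup_toList
        refine ⟨⟨?_, isOrderedClique_of_toFinset hC.1 hnd hfin.le⟩, hfin⟩
        rw [h.length_eq, Finset.length_toList, hC.2]
    rw [this, List.toFinset_card_of_nodup (List.nodup_permutations _ C.nodup_toList),
      List.length_permutations, Finset.length_toList, hC.2]
  · intro T hT
    rw [Finset.mem_coe, mem_orderedCliques] at hT
    rw [Finset.mem_coe, SimpleGraph.mem_cliqueFinset_iff, ← hT.1]
    exact isNClique_toFinset hT.2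

/-- An ordered `k`-clique is an extension of an ordered `(k - 1)`-clique by a neighbour of its
minimum-degree vertex. -/
theorem card_cliqueFinset_le {k : ℕ} (hk : 2 ≤ k) {α : ℝ} (hα : (graphArboricity G : ℝ) ≤ α) :
    ((G.cliqueFinset k).card : ℝ) ≤ G.edgeFinset.card * α ^ (k - 2) := by
  obtain ⟨t, rfl⟩ : ∃ t, k = t + 2 := ⟨k - 2, by omega⟩
  have h1 : ((t + 2).factorial : ℝ) * (G.cliqueFinset (t + 2)).card ≤
      (t + 1).factorial * α ^ t * (2 * G.edgeFinset.card) := by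
    refine le_trans ?_ (sum_tupleDegree_le hα)
    rw [← Nat.cast_mul, ← card_orderedCliques, Finset.card_eq_sum_ones, Nat.cast_sum,
      Nat.cast_one, ← sum_orderedCliques_extSum]
    refine Finset.sum_le_sum fun T hT => ?_
    rw [mem_orderedCliques] at hT
    obtain ⟨u, hu, hdeg, -⟩ := exists_mem_tupleDegree_eq (G := G) (T := T)
      (by rintro rfl; simp at hT)
    rw [hdeg, extSum, Finset.sum_const, nsmul_eq_mul, mul_one, ← G.card_neighborFinset_eq_degree]
    norm_cast
    refine Finset.card_le_card fun v hv => ?_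
    simpa using mem_extensions.1 hv u hu
  have h2 : (0 : ℝ) < (t + 1).factorial := by positivity
  have hα0 : 0 ≤ α := (Nat.cast_nonneg _).trans hα
  rw [Nat.factorial_succ (t + 1)] at h1
  push_cast at h1
  have h3 : (2 : ℝ) * (G.cliqueFinset (t + 2)).card ≤
      (t + 1 + 1) * (G.cliqueFinset (t + 2)).card := by
    gcongr
    have : (0 : ℝ) ≤ t := Nat.cast_nonneg t
    linarith
  have h4 := mul_le_mul_of_nonneg_left h3 h2.le
  have h5 : ((t + 1).factorial : ℝ) * (2 * (G.cliqueFinset (t + 2)).card) ≤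
      (t + 1).factorial * (2 * (G.edgeFinset.card * α ^ t)) := by linarith
  have := le_of_mul_le_mul_left h5 h2
  simp only [Nat.add_sub_cancel]
  linarith

end Counting

/-! ### Cliques all of whose orderings are blocked -/

section Blocked

variable {n : ℕ} {G : SimpleGraph (Fin n)}

variable (G) in
/-- The ordered cliques of size `k - |T|` that extend `T` by vertices `u` with `T ++ [u] ∈ N`. -/
noncomputable def blockedCompletions (N : Finset (List (Fin n))) (k : ℕ) (T : List (Fin n)) :
    Finset (List (Fin n)) :=
  (orderedCliques G (k - T.length)).filter fun U => ∀ u ∈ U, T ++ [u] ∈ N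

/-- If every ordering of the clique `C` has a proper prefix in `N`, then building an ordering
greedily gets stuck: some part of `C` has all its one-vertex extensions within `C` in `N`. -/
theorem exists_blockedCompletion {N : Finset (List (Fin n))} {k : ℕ} {C : Finset (Fin n)}
    (hC : G.IsNClique k C)
    (hN : ∀ L : List (Fin n), L.Nodup → L.toFinset = C → ∃ j, 1 ≤ j ∧ j < k ∧ L.take j ∈ N) :
    ∃ j < k - 1, ∃ T ∈ orderedCliques G j, ∃ U ∈ blockedCompletions G N k T,
      (T ++ U).toFinset = C := by
  have hrest : ∀ T : List (Fin n), T.Nodup → T.toFinset ⊆ C →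
      (C \ T.toFinset).toList.length = k - T.length ∧
        (T ++ (C \ T.toFinset).toList).toFinset = C ∧ (T ++ (C \ T.toFinset).toList).Nodup := by
    intro T hnd hTC
    refine ⟨?_, ?_, ?_⟩
    · rw [Finset.length_toList, Finset.card_sdiff_of_subset hTC, hC.2,
        List.toFinset_card_of_nodup hnd]
    · rw [List.toFinset_append, Finset.toList_toFinset, Finset.union_sdiff_of_subset hTC]
    · rw [List.nodup_append]
      refine ⟨hnd, Finset.nodup_toList _, ?_⟩
      intro a ha b hb hab
      subst hab
      simp only [Finset.mem_toList, Finset.mem_sdiff, List.mem_toFinset] at hb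
      exact hb.2 ha
  by_contra hcon
  have hstep : ∀ j < k - 1, ∀ T : List (Fin n), T.Nodup → T.toFinset ⊆ C → T.length = j →
      ∃ u ∈ C, u ∉ T ∧ T ++ [u] ∉ N := by
    intro j hj T hnd hTC hlen
    by_contra hno
    push Not at hno
    obtain ⟨h1, h2, h3⟩ := hrest T hnd hTC
    refine hcon ⟨j, hj, T, mem_orderedCliques.2 ⟨hlen, isOrderedClique_of_toFinset hC.1 hnd hTC⟩,
      (C \ T.toFinset).toList, ?_, h2⟩
    refine Finset.mem_filter.2 ⟨mem_orderedCliques.2 ⟨h1, isOrderedClique_of_toFinset hC.1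
      (Finset.nodup_toList _) ?_⟩, ?_⟩
    · rw [Finset.toList_toFinset]; exact Finset.sdiff_subset
    · intro u hu
      simp only [Finset.mem_toList, Finset.mem_sdiff, List.mem_toFinset] at hu
      exact hno u hu.1 hu.2
  have hgreedy : ∀ j ≤ k - 1, ∃ T : List (Fin n), T.Nodup ∧ T.toFinset ⊆ C ∧ T.length = j ∧
      ∀ i, 1 ≤ i → i ≤ j → T.take i ∉ N := by
    intro j
    induction j with
    | zero => exact fun _ => ⟨[], by simp, by simp, rfl, fun i h1 h2 => by omega⟩
    | succ j ih =>
      intro hj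
      obtain ⟨T, hnd, hTC, hlen, hT⟩ := ih (by omega)
      obtain ⟨u, huC, huT, hu⟩ := hstep j (by omega) T hnd hTC hlen
      refine ⟨T ++ [u], ?_, ?_, by simp [hlen], fun i h1 h2 => ?_⟩
      · rw [List.nodup_append]
        refine ⟨hnd, by simp, ?_⟩
        rintro a ha b hb rfl
        simp only [List.mem_singleton] at hb
        exact huT (hb ▸ ha)
      · rw [List.toFinset_append]
        exact Finset.union_subset hTC (by simpa using huC)
      · rcases h2.eq_or_lt with rfl | h2
        · rwa [List.take_of_length_le (by simp [hlen])]
        · rw [List.take_append_of_le_length (by omega)]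
          exact hT i h1 (by omega)
  obtain ⟨T, hnd, hTC, hlen, hT⟩ := hgreedy (k - 1) le_rfl
  obtain ⟨-, h2, h3⟩ := hrest T hnd hTC
  obtain ⟨j, hj1, hjk, hj⟩ := hN _ h3 h2
  rw [List.take_append_of_le_length (by omega)] at hj
  exact hT j hj1 (by omega) hj

theorem card_le_sum_blockedCompletions {N : Finset (List (Fin n))} {k : ℕ}
    {𝓑 : Finset (Finset (Fin n))} (h𝓑 : ∀ C ∈ 𝓑, G.IsNClique k C ∧
      ∀ L : List (Fin n), L.Nodup → L.toFinset = C → ∃ j, 1 ≤ j ∧ j < k ∧ L.take j ∈ N) :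
    𝓑.card ≤ ∑ j ∈ Finset.range (k - 1), ∑ T ∈ orderedCliques G j,
      (blockedCompletions G N k T).card := by
  calc 𝓑.card ≤ ((Finset.range (k - 1)).biUnion fun j => (orderedCliques G j).biUnion fun T =>
        (blockedCompletions G N k T).image fun U => (T ++ U).toFinset).card := by
        refine Finset.card_le_card fun C hC => ?_
        obtain ⟨j, hj, T, hT, U, hU, hTU⟩ := exists_blockedCompletion (h𝓑 C hC).1 (h𝓑 C hC).2
        simp only [Finset.mem_biUnion, Finset.mem_range, Finset.mem_image]
        exact ⟨j, hj, T, hT, U, hU, hTU⟩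
    _ ≤ _ := Finset.card_biUnion_le.trans (Finset.sum_le_sum fun j _ =>
        Finset.card_biUnion_le.trans (Finset.sum_le_sum fun T _ => Finset.card_image_le))

/-- The completions of `T` are ordered cliques within the set of those `u` with `T ++ [u] ∈ N`, and
a member of `N` determines both `T` and `u`. -/
theorem sum_card_blockedCompletions_le {N : Finset (List (Fin n))} {j k : ℕ} (hjk : j < k) {α : ℝ}
    (hα : (graphArboricity G : ℝ) ≤ α) :
    ((∑ T ∈ orderedCliques G j, (blockedCompletions G N k T).card : ℕ) : ℝ) ≤
      (k - j).factorial * α ^ (k - j - 1) * (N.filter fun T => T.length = j + 1).card := by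
  have hα0 : 0 ≤ α := (Nat.cast_nonneg _).trans hα
  have hinj : ∑ T ∈ orderedCliques G j, (Finset.univ.filter fun u => T ++ [u] ∈ N).card ≤
      (N.filter fun T => T.length = j + 1).card := by
    rw [← Finset.card_sigma]
    refine Finset.card_le_card_of_injOn (fun x => x.1 ++ [x.2]) ?_ ?_
    · rintro ⟨T, u⟩ h
      simp only [Finset.coe_sigma, Set.mem_sigma_iff, Finset.mem_coe, mem_orderedCliques,
        Finset.mem_filter, Finset.mem_univ, true_and] at h
      simp [h.2, h.1.1]
    · rintro ⟨T, v⟩ _ ⟨T', v'⟩ _ h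
      have := List.append_inj' h rfl
      simp only [List.cons.injEq, and_true] at this
      obtain ⟨rfl, rfl⟩ := this
      rfl
  have hterm : ∀ T ∈ orderedCliques G j, ((blockedCompletions G N k T).card : ℝ) ≤
      (k - j).factorial * α ^ (k - j - 1) *
        (Finset.univ.filter fun u => T ++ [u] ∈ N).card := by
    intro T hT
    rw [mem_orderedCliques] at hT
    have := sum_orderedClique_le G (r := k - j - 1) (𝒯 := blockedCompletions G N k T)
      (S := Finset.univ.filter fun u => T ++ [u] ∈ N) (w := fun _ => 1) (f := fun _ => 1) hα
      (fun U hU => by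
        rw [blockedCompletions, Finset.mem_filter, mem_orderedCliques] at hU
        exact ⟨hU.1.2, by omega, fun v hv => by simpa using hU.2 v hv⟩)
      (fun _ => zero_le_one) (fun _ _ _ _ => le_rfl)
    rw [Nat.sub_add_cancel (by omega : 1 ≤ k - j)] at this
    simpa using this
  rw [Nat.cast_sum]
  refine (Finset.sum_le_sum hterm).trans ?_
  rw [← Finset.mul_sum]
  gcongr
  exact_mod_cast hinj

theorem card_blockedCompletions_nil_le (N : Finset (List (Fin n))) (k : ℕ) :
    (blockedCompletions G N k []).card ≤ (N.filter fun T => T.length = 1).card ^ k := by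
  calc (blockedCompletions G N k []).card
      ≤ ((Fintype.piFinset fun _ : Fin k => Finset.univ.filter fun u => [u] ∈ N).image
          List.ofFn).card := by
        refine Finset.card_le_card fun U hU => ?_
        rw [blockedCompletions, Finset.mem_filter, mem_orderedCliques] at hU
        obtain ⟨⟨hlen, -⟩, hU⟩ := hU
        simp only [List.length_nil, Nat.sub_zero] at hlen
        subst hlen
        refine Finset.mem_image.2 ⟨fun i => U[i], ?_, by simp⟩
        simp only [Fintype.mem_piFinset, Finset.mem_filter, Finset.mem_univ, true_and]
        exact fun i => hU _ (List.getElem_mem _)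
    _ ≤ (Finset.univ.filter fun u => [u] ∈ N).card ^ k := by
        refine Finset.card_image_le.trans ?_
        simp
    _ ≤ _ := by
        gcongr
        refine Finset.card_le_card_of_injOn (fun u => [u]) ?_ ?_
        · intro u hu
          simp only [Finset.coe_filter, Finset.mem_univ, true_and] at hu
          simpa using hu
        · intro u _ v _ h
          simpa using h

end Blocked

/-! ### Weights -/

section Weights

variable {n : ℕ} {G : SimpleGraph (Fin n)} [DecidableRel G.Adj] {k : ℕ} {A : Set (List (Fin n))}

theorem IsFirstFullyActive.unique {C : Finset (Fin n)} {L L' : List (Fin n)}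
    (h : IsFirstFullyActive A C L) (h' : IsFirstFullyActive A C L') : L = L' :=
  le_antisymm (h.2 L' h'.1.1 h'.1.2.1 h'.1.2.2) (h'.2 L h.1.1 h.1.2.1 h.1.2.2)

theorem exists_isFirstFullyActive {C : Finset (Fin n)} {L : List (Fin n)} (hL : L.Nodup)
    (hLC : L.toFinset = C) (hA : FullyActive A L) : ∃ L', IsFirstFullyActive A C L' := by
  have hfin : {L : List (Fin n) | L.Nodup ∧ L.toFinset = C ∧ FullyActive A L}.Finite :=
    (List.finite_length_eq (Fin n) C.card).subset fun L h => by
      change L.length = C.card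
      rw [← h.2.1, List.toFinset_card_of_nodup h.1]
  obtain ⟨L', h, hmin⟩ := Set.exists_min_image _ id hfin ⟨L, hL, hLC, hA⟩
  exact ⟨L', h, fun L'' h1 h2 h3 => hmin L'' ⟨h1, h2, h3⟩⟩

theorem IsFirstFullyActive.length_eq {C : Finset (Fin n)} {L : List (Fin n)}
    (h : IsFirstFullyActive A C L) (hC : C ∈ G.cliqueFinset k) : L.length = k := by
  rw [SimpleGraph.mem_cliqueFinset_iff] at hC
  rw [← hC.2, ← h.1.2.1, List.toFinset_card_of_nodup h.1.1]

/-- A clique assigned to a proper tuple is assigned to exactly one of its extensions. -/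
theorem extSum_cliqueWeight {T : List (Fin n)} (hT : T.length < k) :
    extSum G (fun T => (cliqueWeight G k A T : ℝ)) T = cliqueWeight G k A T := by
  classical
  simp only [extSum, cliqueWeight]
  rw [← Nat.cast_sum, Nat.cast_inj]
  symm
  convert Finset.card_biUnion (s := extensions G T) (t := fun v => (G.cliqueFinset k).filter
    fun C => ∃ L, IsFirstFullyActive A C L ∧ T ++ [v] <+: L) ?_
  · ext C
    simp only [Finset.mem_filter, Finset.mem_biUnion]
    constructor
    · rintro ⟨hC, L, hL, W, hW⟩
      have hlen := hL.length_eq hC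
      have hCl := hC
      rw [SimpleGraph.mem_cliqueFinset_iff] at hCl
      match W with
      | [] => rw [← hW] at hlen; simp at hlen; omega
      | v :: W =>
        refine ⟨v, ?_, hC, L, hL, W, by simp [← hW]⟩
        rw [mem_extensions]
        have hcl : IsOrderedClique G L := isOrderedClique_of_toFinset hCl.1 hL.1.1 hL.1.2.1.le
        rw [← hW, IsOrderedClique, List.pairwise_append] at hcl
        exact fun u hu => hcl.2.2 u hu v (by simp)
    · rintro ⟨v, hv, hC, L, hL, hpre⟩
      exact ⟨hC, L, hL, (List.prefix_append T [v]).trans hpre⟩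
  · intro v _ v' _ hne
    rw [Function.onFun, Finset.disjoint_left]
    intro C hC hC'
    obtain ⟨-, L, hL, hpre⟩ := Finset.mem_filter.1 hC
    obtain ⟨-, L', hL', hpre'⟩ := Finset.mem_filter.1 hC'
    rw [← hL.unique hL'] at hpre'
    have := (List.prefix_of_prefix_length_le hpre hpre' (by simp)).eq_of_length (by simp)
    exact hne (by simpa using this)

theorem cliqueWeight_le_one {T : List (Fin n)} (hT : T.length = k) : cliqueWeight G k A T ≤ 1 := by
  classical
  rw [cliqueWeight, Finset.card_le_one]
  have key : ∀ C ∈ G.cliqueFinset k, (∃ L, IsFirstFullyActive A C L ∧ T <+: L) →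
      C = T.toFinset := by
    rintro C hC ⟨L, hL, hpre⟩
    rw [hpre.eq_of_length (by rw [hT, hL.length_eq hC]), hL.1.2.1]
  intro C hC C' hC'
  rw [Finset.mem_filter] at hC hC'
  rw [key C hC.1 hC.2, key C' hC'.1 hC'.2]

theorem mem_of_cliqueWeight_ne_zero {T : List (Fin n)} (hT : 1 ≤ T.length)
    (h : cliqueWeight G k A T ≠ 0) : T ∈ A := by
  classical
  rw [cliqueWeight, Finset.card_ne_zero] at h
  obtain ⟨C, hC⟩ := h
  obtain ⟨-, L, hL, hpre⟩ := Finset.mem_filter.1 hC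
  have := hL.1.2.2 T.length hT hpre.length_le
  rwa [← List.prefix_iff_eq_take.1 hpre] at this

/-- Only cliques without a fully active ordering are unassigned. -/
theorem le_sum_cliqueWeight_singleton (hk : 1 ≤ k) {B : ℝ}
    (hB : ∀ 𝓑 : Finset (Finset (Fin n)), (∀ C ∈ 𝓑, G.IsNClique k C ∧
      ∀ L : List (Fin n), L.Nodup → L.toFinset = C → ¬ FullyActive A L) → (𝓑.card : ℝ) ≤ B) :
    ((G.cliqueFinset k).card : ℝ) - B ≤ ∑ v : Fin n, (cliqueWeight G k A [v] : ℝ) := by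
  classical
  have h := extSum_cliqueWeight (G := G) (A := A) (T := []) (k := k) hk
  have hsum : extSum G (fun T => (cliqueWeight G k A T : ℝ)) [] =
      ∑ v : Fin n, (cliqueWeight G k A [v] : ℝ) := by
    simp [extSum, extensions]
  rw [← hsum, h, cliqueWeight, sub_le_iff_le_add]
  have hfil := Finset.card_filter_add_card_filter_not (s := G.cliqueFinset k)
    fun C => ∃ L, IsFirstFullyActive A C L ∧ [] <+: L
  rw [← hfil]
  push_cast
  refine add_le_add (le_of_eq (by congr)) (hB _ fun C hC => ?_)
  rw [Finset.mem_filter, SimpleGraph.mem_cliqueFinset_iff] at hC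
  refine ⟨hC.1, fun L h1 h2 h3 => hC.2 ?_⟩
  obtain ⟨L', hL'⟩ := exists_isFirstFullyActive h1 h2 h3
  exact ⟨L', hL', List.nil_prefix⟩

theorem extSum_mono {f g : List (Fin n) → ℝ} {T : List (Fin n)}
    (h : ∀ v, f (T ++ [v]) ≤ g (T ++ [v])) : extSum G f T ≤ extSum G g T :=
  Finset.sum_le_sum fun v _ => h v

/-- The weight of `T` is at most the number of extensions of `T` to an ordered `k`-clique. -/
theorem mul_cliqueWeight_le_potential {θ : ℕ → ℝ} {b : ℝ} (hb : 0 ≤ b) :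
    ∀ (c : ℕ) (T : List (Fin n)), T.length + c = k →
      (∀ t, T.length ≤ t → t < k → 0 ≤ θ t) →
      b * cliqueWeight G k A T ≤ potential G θ b c T.length T := by
  intro c
  induction c with
  | zero =>
    intro T hT _
    have : (cliqueWeight G k A T : ℝ) ≤ 1 := by exact_mod_cast cliqueWeight_le_one (by omega)
    exact mul_le_of_le_one_right hb this
  | succ c ih =>
    intro T hT hθ
    rw [potential, ← extSum_cliqueWeight (by omega)]
    have h1 : b * extSum G (fun T => (cliqueWeight G k A T : ℝ)) T =
        extSum G (fun T => b * (cliqueWeight G k A T : ℝ)) T := by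
      simp only [extSum, Finset.mul_sum]
    rw [h1]
    have h2 := extSum_mono (G := G) (T := T) (f := fun T => b * (cliqueWeight G k A T : ℝ))
      (g := potential G θ b c (T.length + 1)) fun v => by
        have := ih (T ++ [v]) (by simp; omega) fun t h1 h2 =>
          hθ t (by simp at h1; omega) h2
        simpa using this
    have h3 : 0 ≤ θ T.length * tupleDegree G T :=
      mul_nonneg (hθ _ le_rfl (by omega)) (Nat.cast_nonneg _)
    linarith

/-- The sum of the potential over all ordered cliques. -/
theorem sum_potential (θ : ℕ → ℝ) (b : ℝ) : ∀ c t : ℕ,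
    ∑ T ∈ orderedCliques G t, potential G θ b c t T =
    (∑ j ∈ Finset.Ico t (t + c), θ j * ∑ T ∈ orderedCliques G j, (tupleDegree G T : ℝ)) +
      b * (orderedCliques G (t + c)).card := by
  intro c
  induction c with
  | zero => intro t; simp [potential, mul_comm]
  | succ c ih =>
    intro t
    simp only [potential]
    rw [Finset.sum_add_distrib, sum_orderedCliques_extSum, ih, ← Finset.mul_sum,
      Finset.sum_eq_sum_Ico_succ_bot (by omega : t < t + (c + 1))]
    rw [show t + 1 + c = t + (c + 1) by ring]
    ring

end Weights

/-! ### The union bound -/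

section UnionBound

open MeasureTheory

/-- Resampling one coordinate: an event for the coordinate `i` that is determined by the other
coordinates inherits a bound that holds for each value of those. -/
theorem measure_pi_setOf_mem_le {ι : Type*} [Fintype ι] (μ : ι → Measure Bool)
    [∀ i, IsProbabilityMeasure (μ i)] (i : ι) [DecidableEq ι] (D : (ι → Bool) → Set Bool)
    (hD : ∀ x b, D (Function.update x i b) = D x) {p : ℝ≥0∞} (hp : ∀ x, μ i (D x) ≤ p) :
    Measure.pi μ {x | x i ∈ D x} ≤ p := by
  classical
  have hmeas : MeasurableSet {x : ι → Bool | x i ∈ D x} := (Set.toFinite _).measurableSet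
  have hf : Measurable ({x : ι → Bool | x i ∈ D x}.indicator fun _ => (1 : ℝ≥0∞)) :=
    measurable_const.indicator hmeas
  rw [← lintegral_indicator_one hmeas]
  change ∫⁻ x, {x : ι → Bool | x i ∈ D x}.indicator (fun _ => (1 : ℝ≥0∞)) x ∂Measure.pi μ ≤ p
  rw [lintegral_eq_lmarginal_univ (fun _ => false), lmarginal_erase' _ hf (Finset.mem_univ i)]
  have hle : (fun x => ∫⁻ b, {x : ι → Bool | x i ∈ D x}.indicator (fun _ => (1 : ℝ≥0∞))
      (Function.update x i b) ∂μ i) ≤ fun _ => p := by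
    intro x
    have : ∀ b, {x : ι → Bool | x i ∈ D x}.indicator (fun _ => (1 : ℝ≥0∞))
        (Function.update x i b) = (D x).indicator 1 b := by
      intro b
      by_cases hb : b ∈ D x
      · rw [Set.indicator_of_mem hb, Set.indicator_of_mem]
        · rfl
        · simpa [hD] using hb
      · rw [Set.indicator_of_notMem hb, Set.indicator_of_notMem]
        simpa [hD] using hb
    simp only [this]
    rw [lintegral_indicator_one (Set.toFinite _).measurableSet]
    exact hp x
  refine (lmarginal_mono hle _).trans ?_
  simp [lmarginal]

theorem card_smallOrderedClique_le {n : ℕ} (hn : 2 ≤ n) (G : SimpleGraph (Fin n)) (k : ℕ) :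
    Fintype.card (SmallOrderedClique G k) ≤ n ^ k := by
  have h := Fintype.card_le_of_injective
    (fun I : SmallOrderedClique G k =>
      (⟨⟨I.1.length, I.2.2.1⟩, ⟨I.1, rfl⟩⟩ : Σ t : Fin k, List.Vector (Fin n) t)) (by
    intro I J h
    exact Subtype.ext (congrArg (fun x : Σ t : Fin k, List.Vector (Fin n) t => x.2.toList) h))
  refine h.trans ?_
  simp only [Fintype.card_sigma, card_vector, Fintype.card_fin]
  rw [Fin.sum_univ_eq_sum_range fun t => n ^ t]
  exact (Nat.geomSum_lt hn fun t ht => Finset.mem_range.1 ht).le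

theorem mem_activeSet_iff {n k : ℕ} {G : SimpleGraph (Fin n)}
    {ans : SmallOrderedClique G k → Bool} (I : SmallOrderedClique G k) :
    I.1 ∈ activeSet G k ans ↔ ans I = true := by
  constructor
  · rintro (⟨J, hJ, h⟩ | ⟨h, -⟩)
    · rwa [← Subtype.ext hJ]
    · exact absurd h I.2.2.1.ne
  · exact fun h => Or.inl ⟨I, rfl, h⟩

variable {n : ℕ} {G : SimpleGraph (Fin n)} [DecidableRel G.Adj] {nbr : NeighborLists G} {k : ℕ}
  {α ε δ nk mt : ℝ}

theorem cliqueWeight_eq_zero {A : Set (List (Fin n))} {T : List (Fin n)}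
    (hT : ¬ IsOrderedClique G T) : cliqueWeight G k A T = 0 := by
  classical
  rw [cliqueWeight, Finset.card_eq_zero, Finset.filter_eq_empty_iff]
  rintro C hC ⟨L, hL, hpre⟩
  rw [SimpleGraph.mem_cliqueFinset_iff] at hC
  exact hT ((isOrderedClique_of_toFinset hC.1 hL.1.1 hL.1.2.1.le).sublist hpre.sublist)

/-- The answer of Is-Active on `I` is wrong, given the other answers, if it is Non-Active for a
member of `H`, or if it is Active, the weight of `I` exceeds its threshold, and no longer tuple
exceeds its threshold. The condition on the weights is determined by the other answers, since it
only matters when the answer on `I` is Active; so independence bounds the probability of a wrong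
answer for each `I`. If no answer is wrong, a longest tuple that exceeds its threshold cannot
exist. -/
theorem answersLaw_bounded_and_active (hn : 2 ≤ n) (hδ : 0 < δ)
    (hτ0 : ∀ t, 1 ≤ t → t ≤ k → 0 ≤ tauU k α ε nk t) (hτk : 1 ≤ tauU k α ε nk k)
    (H : Set (SmallOrderedClique G k))
    (hHw : ∀ I ∈ H, ∀ A, (cliqueWeight G k A I.1 : ℝ) ≤ tauU k α ε nk I.1.length)
    (hfalse : ∀ I ∈ H, expect G nbr (isActive I.1 k α ε δ nk mt (tauU k α ε nk))
      (fun b => if b = false then 1 else 0) ≤ δ / (n : ℝ) ^ k)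
    (htrue : ∀ (I : SmallOrderedClique G k) (A : Set (List (Fin n))),
      tauU k α ε nk I.1.length < cliqueWeight G k A I.1 →
      (∀ T : List (Fin n), I.1.length < T.length → T.length ≤ k →
        (cliqueWeight G k A T : ℝ) ≤ tauU k α ε nk T.length) →
      expect G nbr (isActive I.1 k α ε δ nk mt (tauU k α ε nk))
        (fun b => if b = true then 1 else 0) ≤ δ / (n : ℝ) ^ k) :
    ENNReal.ofReal (1 - δ) ≤ answersLaw G nbr k α ε δ nk mt
      {ans | IsTauBounded G k (tauU k α ε nk) (activeSet G k ans) ∧ ∀ I ∈ H, ans I = true} := by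
  classical
  set τ := tauU k α ε nk with hτ
  let viol : SmallOrderedClique G k → Set (List (Fin n)) → Prop := fun I A =>
    τ I.1.length < cliqueWeight G k A I.1 ∧ ∀ T : List (Fin n), I.1.length < T.length →
      T.length ≤ k → (cliqueWeight G k A T : ℝ) ≤ τ T.length
  let D : SmallOrderedClique G k → (SmallOrderedClique G k → Bool) → Set Bool := fun I x =>
    if I ∈ H then {false}
    else if viol I (activeSet G k (Function.update x I true)) then {true} else ∅
  let μ : SmallOrderedClique G k → Measure Bool := fun I =>
    (((isActive I.1 k α ε δ nk mt τ).run G nbr).map Execution.output).toMeasure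
  have hlaw : answersLaw G nbr k α ε δ nk mt = Measure.pi μ := rfl
  have hprob : ∀ I, IsProbabilityMeasure (μ I) := fun I => PMF.toMeasure.isProbabilityMeasure _
  have hsingle : ∀ I b, expect G nbr (isActive I.1 k α ε δ nk mt τ)
      (fun b' => if b' = b then 1 else 0) ≤ δ / (n : ℝ) ^ k →
      μ I {b} ≤ ENNReal.ofReal (δ / (n : ℝ) ^ k) := by
    intro I b h
    rw [PMF.toMeasure_apply_singleton _ _ (measurableSet_singleton b), map_output_run_apply]
    exact ENNReal.ofReal_le_ofReal h
  have hbad : ∀ I, Measure.pi μ {x | x I ∈ D I x} ≤ ENNReal.ofReal (δ / (n : ℝ) ^ k) := by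
    intro I
    refine measure_pi_setOf_mem_le μ I (D I) (fun x b => ?_) fun x => ?_
    · simp only [D, Function.update_idem]
    · simp only [D]
      split_ifs with h1 h2
      · exact hsingle I false (hfalse I h1)
      · exact hsingle I true (htrue I _ h2.1 h2.2)
      · simp
  have hunion : Measure.pi μ (⋃ I, {x | x I ∈ D I x}) ≤ ENNReal.ofReal δ := by
    have hn0 : (0 : ℝ) < (n : ℝ) ^ k := by positivity
    refine (measure_iUnion_fintype_le _ _).trans ((Finset.sum_le_sum fun I _ => hbad I).trans ?_)
    rw [Finset.sum_const, Finset.card_univ, nsmul_eq_mul, ← ENNReal.ofReal_natCast,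
      ← ENNReal.ofReal_mul (Nat.cast_nonneg _)]
    refine ENNReal.ofReal_le_ofReal ?_
    rw [mul_div_assoc', div_le_iff₀ hn0, mul_comm]
    gcongr
    exact_mod_cast card_smallOrderedClique_le hn G k
  have hsub : (⋃ I, {x | x I ∈ D I x})ᶜ ⊆ {ans | IsTauBounded G k τ (activeSet G k ans) ∧
      ∀ I ∈ H, ans I = true} := by
    intro x hx
    simp only [Set.mem_compl_iff, Set.mem_iUnion, not_exists] at hx
    refine ⟨?_, fun I hI => ?_⟩
    · -- a violating tuple of maximal length would make the answer on it wrong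
      by_contra hb
      have hex : ∃ c, ∃ T : List (Fin n), 1 ≤ T.length ∧ T.length + c = k ∧ IsOrderedClique G T ∧
          τ T.length < cliqueWeight G k (activeSet G k x) T := by
        simp only [IsTauBounded, not_forall, not_le] at hb
        obtain ⟨T, h1, h2, h3, h4⟩ := hb
        exact ⟨k - T.length, T, h1, by omega, h3, h4⟩
      obtain ⟨T, h1, h2, h3, h4⟩ := Nat.find_spec hex
      have hmax : ∀ T' : List (Fin n), T.length < T'.length → T'.length ≤ k →
          (cliqueWeight G k (activeSet G k x) T' : ℝ) ≤ τ T'.length := by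
        intro T' hlt hle
        by_cases hcl : IsOrderedClique G T'
        · by_contra hgt
          exact Nat.find_min hex (m := k - T'.length) (by omega)
            ⟨T', by omega, by omega, hcl, not_le.1 hgt⟩
        · rw [cliqueWeight_eq_zero hcl, Nat.cast_zero]
          exact hτ0 _ (by omega) hle
      have hlt : T.length < k := by
        rcases Nat.lt_or_ge T.length k with h | h
        · exact h
        · have hTk : T.length = k := by omega
          have : (cliqueWeight G k (activeSet G k x) T : ℝ) ≤ 1 := by
            exact_mod_cast cliqueWeight_le_one hTk
          rw [hTk] at h4
          linarith
      let I : SmallOrderedClique G k := ⟨T, h1, hlt, h3⟩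
      have hxI : x I = true := by
        refine (mem_activeSet_iff I).1 (mem_of_cliqueWeight_ne_zero (G := G) (k := k) h1 ?_)
        intro h0
        rw [h0, Nat.cast_zero] at h4
        linarith [hτ0 _ h1 hlt.le]
      refine hx I ?_
      have hupd : Function.update x I true = x := by
        rw [← hxI, Function.update_eq_self]
      have hIH : I ∉ H := fun h => absurd (hHw I h _) (not_le.2 h4)
      change x I ∈ D I x
      simp only [D, hIH, if_false, hupd]
      rw [if_pos ⟨h4, hmax⟩, hxI]
      rfl
    · by_contra hne
      refine hx I ?_
      change x I ∈ D I x
      simp only [D, hI, if_true]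
      simpa using hne
  rw [hlaw]
  calc ENNReal.ofReal (1 - δ) = 1 - ENNReal.ofReal δ := by
        rw [ENNReal.ofReal_sub _ hδ.le, ENNReal.ofReal_one]
    _ ≤ 1 - Measure.pi μ (⋃ I, {x | x I ∈ D I x}) := tsub_le_tsub_left hunion 1
    _ = Measure.pi μ (⋃ I, {x | x I ∈ D I x})ᶜ :=
        (prob_compl_eq_one_sub (Set.toFinite _).measurableSet).symm
    _ ≤ _ := measure_mono hsub

end UnionBound

/-! ### Running time -/

section Cost

variable {n : ℕ} {G : SimpleGraph (Fin n)} [DecidableRel G.Adj] {nbr : NeighborLists G}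
  {i k : ℕ} {α ε δ nk mt : ℝ} {τ : ℕ → ℝ}

/-- The cost of the remaining rounds of a trial, when `b t` bounds the number of samples in every
round `t` that is not given up. -/
theorem within_trialRounds (hk : 2 ≤ k) {b : ℕ → ℕ}
    (hb : ∀ (t s : ℕ), (s : ℝ) ≤ sampleBound k α ε nk mt τ t → s ≤ b t) :
    ∀ (c t : ℕ) (R : List (List (Fin n))) (ω ρ : ℝ), 1 ≤ t → t + c = k → (∀ T ∈ R, T.length = t) →
      Within G nbr (trialRounds i k α ε nk mt τ c t R ω ρ) (fun _ => True)
        (20 * k * R.length + 32 * k * ∑ j ∈ Finset.Ico t k, b j + 22 * k * c + 3) := by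
  intro c
  induction c with
  | zero =>
    intro t R ω ρ ht htc hR
    rw [trialRounds]
    refine Within.tick_bind (d := 0) (within_pure trivial) ?_
    have : R.length ≤ 20 * k * R.length := Nat.le_mul_of_pos_left _ (by omega)
    omega
  | succ c ih =>
    intro t R ω ρ ht htc hR
    have htk : t < k := by omega
    rw [trialRounds, Finset.sum_eq_sum_Ico_succ_bot htk]
    refine ((within_withDegrees ht hR).bind_eq
      (d := (R.length + 2 * k + 40) + ((4 * k + 13) * R.length + 32 * k * b t +
        (32 * k * ∑ j ∈ Finset.Ico (t + 1) k, b j + 22 * k * c + 3))) ?_ ?_)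
    · refine Within.tick_bind (d := (4 * k + 13) * R.length + 32 * k * b t +
        (32 * k * ∑ j ∈ Finset.Ico (t + 1) k, b j + 22 * k * c + 3)) ?_ le_rfl
      simp only [totalDegree_withDegrees]
      set s := sampleSize k ε τ t (R.map (tupleDegree G)).sum ω with hs
      by_cases habort : sampleBound k α ε nk mt τ t < s
      · rw [if_pos habort]
        exact within_pure trivial
      · rw [if_neg habort]
        have hsb := hb t s (not_lt.1 habort)
        obtain ⟨-, -, -, -, -, -, hsample⟩ := exists_sampleSet (G := G) (nbr := nbr) ht hR s
        refine hsample.bind (d := 20 * k * s +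
          (32 * k * ∑ j ∈ Finset.Ico (t + 1) k, b j + 22 * k * c + 3)) (fun R' hR' => ?_) ?_
        · refine (ih (t + 1) R' _ _ (by omega) (by omega) hR'.2).mono (fun _ h => h) ?_
          have := Nat.mul_le_mul_left (20 * k) hR'.1
          omega
        · have h1 : (4 * t + 13) * R.length ≤ (4 * k + 13) * R.length :=
            Nat.mul_le_mul_right _ (by omega)
          have h2 : s * (7 * t + 10) ≤ 12 * k * s := by
            rw [mul_comm]
            exact Nat.mul_le_mul_right _ (by omega)
          have h3 : 12 * k * s + 20 * k * s ≤ 32 * k * b t := by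
            rw [← add_mul, ← add_mul]
            exact Nat.mul_le_mul_left _ hsb
          omega
    · have h1 : (4 * t + 2) * R.length + (R.length + (4 * k + 13) * R.length) ≤
          20 * k * R.length := by
        calc _ = (4 * t + 2 + (1 + (4 * k + 13))) * R.length := by ring
          _ ≤ _ := Nat.mul_le_mul_right _ (by omega)
      rw [mul_add (32 * k), mul_add (22 * k)]
      omega

theorem within_countSuccesses {p : Prog n Bool} {e : ℕ} (hp : Within G nbr p (fun _ => True) e)
    (q : ℕ) : Within G nbr (countSuccesses p q) (fun _ => True) (q * (e + 2)) := by
  induction q with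
  | zero => exact within_pure trivial
  | succ q ih =>
    rw [countSuccesses]
    refine hp.bind (d := 2 + q * (e + 2)) (fun b _ => ?_) (by ring_nf; omega)
    exact Within.tick_bind (d := q * (e + 2))
      (ih.bind (d := 0) (fun _ _ => within_pure trivial) le_rfl) le_rfl

/-- The cost of an invocation of Is-Active. -/
theorem within_isActive (hk : 2 ≤ k) {b : ℕ → ℕ}
    (hb : ∀ (t s : ℕ), (s : ℝ) ≤ sampleBound k α ε nk mt τ t → s ≤ b t) {I : List (Fin n)}
    (hI : 1 ≤ I.length) (hIk : I.length < k) :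
    Within G nbr (isActive I k α ε δ nk mt τ) (fun _ => True)
      (6 * k + ⌈12 * Real.log ((n : ℝ) ^ k / δ)⌉₊ *
        (40 * k ^ 2 + 32 * k * ∑ j ∈ Finset.Ico 1 k, b j)) := by
  have htrial : Within G nbr (activeTrial I k α ε nk mt τ) (fun _ => True)
      (38 * k ^ 2 + 32 * k * ∑ j ∈ Finset.Ico 1 k, b j) := by
    rw [activeTrial]
    refine Within.tick_bind (within_trialRounds hk hb (k - I.length) I.length [I] _ _ hI (by omega)
      (by simp)) ?_
    have h1 : ∑ j ∈ Finset.Ico I.length k, b j ≤ ∑ j ∈ Finset.Ico 1 k, b j :=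
      Finset.sum_le_sum_of_subset (Finset.Ico_subset_Ico_left hI)
    have h2 := Nat.mul_le_mul_left (32 * k) h1
    have h3 : 22 * k * (k - I.length) ≤ 22 * k * (k - 1) := Nat.mul_le_mul_left _ (by omega)
    have h4 : 22 * k * (k - 1) + 22 * k = 22 * k ^ 2 := by
      obtain ⟨l, rfl⟩ : ∃ l, k = l + 1 := ⟨k - 1, by omega⟩
      simp only [Nat.add_sub_cancel]; ring
    have h5 : 2 * k ≤ k ^ 2 := by nlinarith
    simp only [List.length_cons, List.length_nil]
    omega
  rw [isActive]
  refine Within.tick_bind (d := ⌈12 * Real.log ((n : ℝ) ^ k / δ)⌉₊ *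
        (40 * k ^ 2 + 32 * k * ∑ j ∈ Finset.Ico 1 k, b j)) ?_ (by omega)
  refine (within_countSuccesses htrial _).bind (d := 0) (fun _ _ => within_pure trivial) ?_
  rw [add_zero]
  refine Nat.mul_le_mul_left _ ?_
  have : 2 ^ 2 ≤ k ^ 2 := Nat.pow_le_pow_left hk 2
  omega

end Cost

/-! ### The parameters -/

section Parameters

variable {k : ℕ} {α ε nk mt : ℝ}

theorem betaPar_pos (hk : 2 ≤ k) : 0 < betaPar k := by
  have : (0 : ℝ) < k := by positivity
  rw [betaPar]
  positivity

theorem betaPar_le (hk : 2 ≤ k) : betaPar k ≤ 1 / 12 := by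
  have : (2 : ℝ) ≤ k := by exact_mod_cast hk
  rw [betaPar]
  exact one_div_le_one_div_of_le (by norm_num) (by linarith)

theorem gammaPar_pos (hk : 2 ≤ k) (hε : 0 < ε) : 0 < gammaPar k ε := by
  have : (0 : ℝ) < k := by positivity
  rw [gammaPar]
  positivity

theorem eps_le (hk : 2 ≤ k) (hε : ε ≤ 1 / (2 * (k : ℝ) ^ 2)) : ε ≤ 1 / 8 := by
  have : (2 : ℝ) ≤ k := by exact_mod_cast hk
  exact hε.trans (one_div_le_one_div_of_le (by norm_num) (by nlinarith))

theorem mul_gammaPar_le (hk : 2 ≤ k) (hε : ε ≤ 1 / (2 * (k : ℝ) ^ 2)) :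
    k * gammaPar k ε ≤ 1 / 64 := by
  have hk0 : (0 : ℝ) < k := by positivity
  have hfac : (1 : ℝ) ≤ k.factorial := by exact_mod_cast k.factorial_pos
  have := eps_le hk hε
  rw [gammaPar, mul_div_assoc', div_le_iff₀ (by positivity)]
  nlinarith [mul_le_mul_of_nonneg_left hfac hk0.le]

theorem gammaPar_lt (hk : 2 ≤ k) (hε0 : 0 < ε) (hε : ε ≤ 1 / (2 * (k : ℝ) ^ 2)) :
    gammaPar k ε < 1 := by
  have hk1 : (2 : ℝ) ≤ k := by exact_mod_cast hk
  have := gammaPar_pos hk hε0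
  nlinarith [mul_gammaPar_le hk hε]

theorem half_le_log_inv_betaPar (hk : 2 ≤ k) : 1 / 2 ≤ Real.log (1 / betaPar k) := by
  have h := Real.one_sub_inv_le_log_of_pos (one_div_pos.2 (betaPar_pos hk))
  rw [one_div, inv_inv] at h
  rw [one_div (betaPar k)]
  linarith [betaPar_le hk]

/-- The constant factor of the threshold for giving up a trial. -/
noncomputable def boundFactor (k : ℕ) (ε : ℝ) : ℝ :=
  12 * Real.log (1 / betaPar k) / (betaPar k ^ k * gammaPar k ε ^ 3)

theorem sampleBound_eq (τ : ℕ → ℝ) (t : ℕ) : sampleBound k α ε nk mt τ t =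
    2 * mt * α ^ (t - 1) * τ (t + 1) / nk * boundFactor k ε := rfl

theorem two_le_boundFactor (hk : 2 ≤ k) (hε0 : 0 < ε) (hε : ε ≤ 1 / (2 * (k : ℝ) ^ 2)) :
    2 ≤ boundFactor k ε := by
  have hβ := betaPar_pos hk
  have hγ := gammaPar_pos hk hε0
  have h1 : betaPar k ^ k * gammaPar k ε ^ 3 ≤ 1 :=
    mul_le_one₀ (pow_le_one₀ hβ.le (by linarith [betaPar_le hk])) (by positivity)
      (pow_le_one₀ hγ.le (gammaPar_lt hk hε0 hε).le)
  rw [boundFactor, le_div_iff₀ (by positivity)]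
  linarith [half_le_log_inv_betaPar hk]

theorem tauU_self : tauU k α ε nk k = 1 := by simp [tauU]

theorem tauU_one (hk : 2 ≤ k) : tauU k α ε nk 1 =
    (k : ℝ) ^ (4 * k) / gammaPar k ε ^ 2 * min (α ^ (k - 1)) (nk ^ (((k : ℝ) - 1) / k)) := by
  rw [tauU, if_neg (by omega), if_pos rfl]

theorem tauU_of_lt {t : ℕ} (ht : 2 ≤ t) (htk : t < k) : tauU k α ε nk t =
    (k : ℝ) ^ (4 * k) / (betaPar k ^ k * gammaPar k ε ^ 2) * α ^ (k - t) := by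
  rw [tauU, if_neg (by omega), if_neg (by omega)]

theorem tauU_nonneg (hk : 2 ≤ k) (hε : 0 < ε) (hα : 0 ≤ α) (hnk : 0 < nk) (t : ℕ) :
    0 ≤ tauU k α ε nk t := by
  have := betaPar_pos hk
  have := gammaPar_pos hk hε
  rw [tauU]
  split_ifs
  · exact zero_le_one
  · refine mul_nonneg (by positivity) (le_min (by positivity) (by positivity))
  · positivity

theorem tauU_pos (hk : 2 ≤ k) (hε : 0 < ε) (hα : 0 < α) (hnk : 0 < nk) (t : ℕ) :
    0 < tauU k α ε nk t := by
  have := betaPar_pos hk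
  have := gammaPar_pos hk hε
  rw [tauU]
  split_ifs
  · exact zero_lt_one
  · refine mul_pos (by positivity) (lt_min (by positivity) (by positivity))
  · positivity

theorem pow_le_tauU (hk : 2 ≤ k) (hε0 : 0 < ε) (hε : ε ≤ 1 / (2 * (k : ℝ) ^ 2)) (hα : 0 ≤ α)
    {t : ℕ} (ht : 2 ≤ t) (htk : t ≤ k) : α ^ (k - t) ≤ tauU k α ε nk t := by
  rcases htk.eq_or_lt with rfl | hlt
  · simp [tauU_self]
  · have hβ := betaPar_pos hk
    have hγ := gammaPar_pos hk hε0
    have hk1 : (1 : ℝ) ≤ k := by exact_mod_cast (by omega : 1 ≤ k)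
    have h1 : betaPar k ^ k * gammaPar k ε ^ 2 ≤ 1 :=
      mul_le_one₀ (pow_le_one₀ hβ.le (by linarith [betaPar_le hk])) (by positivity)
        (pow_le_one₀ hγ.le (gammaPar_lt hk hε0 hε).le)
    rw [tauU_of_lt ht hlt]
    refine le_mul_of_one_le_left (by positivity) ?_
    rw [le_div_iff₀ (by positivity), one_mul]
    exact h1.trans (one_le_pow₀ hk1)

/-- The value of the product of scale and weight guess in round `t` of a trial on an ordered
`i`-clique: the initial guess times `(1 - γ) ^ (t - i)`, written with a quotient to make the
recursion in `t` valid below `i` as well. -/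
noncomputable def kappaPar (k : ℕ) (ε : ℝ) (τ : ℕ → ℝ) (i t : ℕ) : ℝ :=
  (1 - gammaPar k ε) ^ t * ((1 - ε / 2) * τ i / (1 - gammaPar k ε) ^ i)

theorem kappaPar_self (hk : 2 ≤ k) (hε0 : 0 < ε) (hε : ε ≤ 1 / (2 * (k : ℝ) ^ 2)) (τ : ℕ → ℝ)
    (i : ℕ) : kappaPar k ε τ i i = (1 - ε / 2) * τ i := by
  have : (1 - gammaPar k ε) ^ i ≠ 0 := pow_ne_zero _ (by linarith [gammaPar_lt hk hε0 hε])
  rw [kappaPar]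
  field_simp

/-- As `k * γ` and `ε` are small, the weight guesses lose less than half of `τ_i` in all rounds. -/
theorem trialSetup_tauU (hk : 2 ≤ k) (hε0 : 0 < ε) (hε : ε ≤ 1 / (2 * (k : ℝ) ^ 2)) (hα : 0 < α)
    (hnk : 0 < nk) {i : ℕ} (hi : 1 ≤ i) :
    TrialSetup i k ε (tauU k α ε nk) (kappaPar k ε (tauU k α ε nk) i) where
  one_le := hi
  tau_pos t _ _ := tauU_pos hk hε0 hα hnk t
  gamma_pos := gammaPar_pos hk hε0
  gamma_lt := gammaPar_lt hk hε0 hε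
  beta_pos := betaPar_pos hk
  beta_lt := by linarith [betaPar_le hk]
  kappa_succ t := by rw [kappaPar, kappaPar]; ring
  kappa_ge t ht := by
    have hτ := tauU_pos hk hε0 hα hnk i
    have hγ := gammaPar_pos hk hε0
    have hγ1 := gammaPar_lt hk hε0 hε
    have hg : 0 < 1 - gammaPar k ε := by linarith
    have h1 : 63 / 64 ≤ (1 - gammaPar k ε) ^ t := by
      have hb := one_add_mul_le_pow (a := -gammaPar k ε) (by linarith) k
      have ha := pow_le_pow_of_le_one hg.le (by linarith) ht
      rw [← sub_eq_add_neg] at hb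
      linarith [mul_gammaPar_le hk hε]
    have h2 : (1 - ε / 2) * tauU k α ε nk i ≤
        (1 - ε / 2) * tauU k α ε nk i / (1 - gammaPar k ε) ^ i := by
      rw [le_div_iff₀ (by positivity)]
      refine mul_le_of_le_one_right ?_ (pow_le_one₀ hg.le (by linarith))
      have := eps_le hk hε
      exact mul_nonneg (by linarith) hτ.le
    have h3 : 15 / 16 * tauU k α ε nk i ≤ (1 - ε / 2) * tauU k α ε nk i := by
      have := eps_le hk hε
      gcongr
      linarith
    calc tauU k α ε nk i / 2 ≤ 63 / 64 * (15 / 16 * tauU k α ε nk i) := by linarith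
      _ ≤ (1 - gammaPar k ε) ^ t * ((1 - ε / 2) * tauU k α ε nk i / (1 - gammaPar k ε) ^ i) := by
        gcongr
        linarith

variable {n : ℕ} {G : SimpleGraph (Fin n)} [DecidableRel G.Adj] {nbr : NeighborLists G}

/-- A graph with a `k`-clique has an edge, hence arboricity at least `1`. -/
theorem one_le_of_card_cliqueFinset_pos (hk : 2 ≤ k) (hα : (graphArboricity G : ℝ) ≤ α)
    (h : 0 < (G.cliqueFinset k).card) : 1 ≤ α := by
  rcases Nat.eq_zero_or_pos (graphArboricity G) with h0 | hpos
  · have hsum := sum_orderedClique_le G (r := k - 1) (𝒯 := orderedCliques G k) (S := Finset.univ)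
      (w := fun _ => 1) (f := fun _ => 1) (α := 0) (by simp [h0])
      (fun T hT => by
        rw [mem_orderedCliques] at hT
        exact ⟨hT.2, by omega, fun v _ => Finset.mem_univ v⟩)
      (fun _ => zero_le_one) (fun _ _ _ _ => le_rfl)
    rw [zero_pow (by omega : k - 1 ≠ 0), mul_zero, zero_mul, Finset.sum_const, card_orderedCliques,
      nsmul_eq_mul, mul_one] at hsum
    have : (0 : ℝ) < (k.factorial * (G.cliqueFinset k).card : ℕ) := by
      have := k.factorial_pos
      positivity
    linarith
  · exact le_trans (by exact_mod_cast hpos) hα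

/-- Is-Active rarely accepts an ordered clique whose weight exceeds its threshold while no longer
tuple does so. -/
theorem expect_isActive_true_le_of_lt_weight {δ : ℝ} (hn : 2 ≤ n) (hk : 2 ≤ k)
    (hα : (graphArboricity G : ℝ) ≤ α) (hε0 : 0 < ε) (hε : ε ≤ 1 / (2 * (k : ℝ) ^ 2)) (hδ : 0 < δ)
    (hnk : 0 < nk) (I : SmallOrderedClique G k) (A : Set (List (Fin n)))
    (hI : tauU k α ε nk I.1.length < cliqueWeight G k A I.1)
    (hlong : ∀ T : List (Fin n), I.1.length < T.length → T.length ≤ k →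
      (cliqueWeight G k A T : ℝ) ≤ tauU k α ε nk T.length) :
    expect G nbr (isActive I.1 k α ε δ nk mt (tauU k α ε nk))
      (fun b => if b = true then 1 else 0) ≤ δ / (n : ℝ) ^ k := by
  classical
  have hα0 : 0 ≤ α := (Nat.cast_nonneg _).trans hα
  have hcard : 0 < (G.cliqueFinset k).card := by
    have h0 := tauU_nonneg hk hε0 hα0 hnk I.1.length
    have h1 : 0 < cliqueWeight G k A I.1 := by exact_mod_cast h0.trans_lt hI
    exact h1.trans_le (Finset.card_le_card (Finset.filter_subset _ _))
  have hα1 := one_le_of_card_cliqueFinset_pos hk hα hcard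
  have hτ := tauU_pos hk hε0 (by linarith) hnk (k := k) (α := α) I.1.length
  refine expect_isActive_true_le (by omega) hδ ?_
  rw [expect_activeTrial]
  have hsetup := trialSetup_tauU (nk := nk) hk hε0 hε (by linarith : 0 < α) hnk I.2.1
  have hε8 := eps_le hk hε
  refine (expect_trialRounds_true_le hsetup I.2.2.1.le (w := fun T => (cliqueWeight G k A T : ℝ))
    (fun T => Nat.cast_nonneg _) (fun T _ h => extSum_cliqueWeight h) hlong
    (fun T hT => by exact_mod_cast cliqueWeight_le_one hT) (k - I.1.length) I.1.length [I.1]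
    ((1 - ε / 2) * tauU k α ε nk I.1.length) 1 (by have := I.2.2.1; omega) le_rfl (by simp)
    (mul_pos (by linarith) hτ) zero_le_one ?_ ?_).trans ?_
  · rw [kappaPar_self hk hε0 hε, one_mul]
  · simp only [List.map_cons, List.map_nil, List.sum_cons, List.sum_nil, add_zero]
    refine le_trans ?_ hI.le
    exact mul_le_of_le_one_left hτ.le (by linarith)
  · have hk0 : (0 : ℝ) < k := by positivity
    have : ((k - I.1.length : ℕ) : ℝ) ≤ k := by exact_mod_cast Nat.sub_le _ _
    calc _ ≤ (k : ℝ) * betaPar k := by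
          have := betaPar_pos hk
          gcongr
      _ = 1 / 6 := by rw [betaPar]; field_simp
      _ ≤ 1 / 4 := by norm_num

variable (G) in
/-- The potential of the ordered clique `I` at the start of a trial. -/
noncomputable def trialPotential (k : ℕ) (α ε nk mt : ℝ) (I : List (Fin n)) : ℝ :=
  potential G (abortCoeff k α ε nk mt (tauU k α ε nk) (kappaPar k ε (tauU k α ε nk) I.length))
    (4 / tauU k α ε nk I.length) (k - I.length) I.length I

/-- The bound `2` absorbs the rounding up in the number of samples. -/
theorem two_le_sampleBound (hk : 2 ≤ k) (hα : (graphArboricity G : ℝ) ≤ α) (hε0 : 0 < ε)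
    (hε : ε ≤ 1 / (2 * (k : ℝ) ^ 2)) (hnk : 0 < nk) (hle : nk ≤ (G.cliqueFinset k).card)
    (hmt : (G.edgeFinset.card : ℝ) / 2 ≤ mt) {t : ℕ} (ht : 1 ≤ t) (htk : t < k) :
    2 ≤ sampleBound k α ε nk mt (tauU k α ε nk) t := by
  have hα0 : 0 ≤ α := (Nat.cast_nonneg _).trans hα
  have hmt0 : 0 ≤ mt := le_trans (by positivity) hmt
  rw [sampleBound_eq]
  have h1 : 1 ≤ 2 * mt * α ^ (t - 1) * tauU k α ε nk (t + 1) / nk := by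
    rw [le_div_iff₀ hnk, one_mul]
    calc nk ≤ G.edgeFinset.card * α ^ (k - 2) := hle.trans (card_cliqueFinset_le hk hα)
      _ ≤ 2 * mt * α ^ (k - 2) := by
        gcongr
        linarith
      _ = 2 * mt * α ^ (t - 1) * α ^ (k - (t + 1)) := by
        rw [mul_assoc _ (α ^ (t - 1)), ← pow_add]
        congr 2
        omega
      _ ≤ _ := by
        gcongr
        exact pow_le_tauU hk hε0 hε hα0 (by omega) (by omega)
  nlinarith [two_le_boundFactor hk hε0 hε]

/-- Is-Active rarely rejects an ordered clique of small potential. -/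
theorem expect_isActive_false_le_of_potential {δ : ℝ} (hn : 2 ≤ n) (hk : 2 ≤ k)
    (hα : (graphArboricity G : ℝ) ≤ α) (hε0 : 0 < ε) (hε : ε ≤ 1 / (2 * (k : ℝ) ^ 2)) (hδ : 0 < δ)
    (hnk : 0 < nk) (hle : nk ≤ (G.cliqueFinset k).card)
    (hmt : (G.edgeFinset.card : ℝ) / 2 ≤ mt) (I : SmallOrderedClique G k)
    (hI : trialPotential G k α ε nk mt I.1 ≤ 1 / 4) :
    expect G nbr (isActive I.1 k α ε δ nk mt (tauU k α ε nk))
      (fun b => if b = false then 1 else 0) ≤ δ / (n : ℝ) ^ k := by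
  have hcard : 0 < (G.cliqueFinset k).card := by exact_mod_cast hnk.trans_le hle
  have hα1 := one_le_of_card_cliqueFinset_pos hk hα hcard
  refine expect_isActive_false_le (by omega) hδ ?_
  rw [expect_activeTrial]
  have hsetup := trialSetup_tauU (nk := nk) hk hε0 hε (by linarith : 0 < α) hnk I.2.1
  refine (expect_trialRounds_false_le hsetup I.2.2.1.le (fun t ht htk =>
    two_le_sampleBound hk hα hε0 hε hnk hle hmt (I.2.1.trans ht) htk) (k - I.1.length) I.1.length
    [I.1] ((1 - ε / 2) * tauU k α ε nk I.1.length) 1 (by have := I.2.2.1; omega) le_rfl (by simp)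
    zero_le_one (Or.inl ?_)).trans ?_
  · rw [kappaPar_self hk hε0 hε, one_mul]
  · simp only [List.map_cons, List.map_nil, List.sum_cons, List.sum_nil, add_zero, one_mul]
    exact hI

theorem abortCoeff_nonneg (hk : 2 ≤ k) (hε0 : 0 < ε) (hε : ε ≤ 1 / (2 * (k : ℝ) ^ 2))
    (hα : 0 < α) (hnk : 0 < nk) (hmt : 0 ≤ mt) {i t : ℕ} (hi : 1 ≤ i) (hik : i ≤ k) (ht : t ≤ k) :
    0 ≤ abortCoeff k α ε nk mt (tauU k α ε nk) (kappaPar k ε (tauU k α ε nk) i) t := by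
  have hsetup := trialSetup_tauU (nk := nk) hk hε0 hε hα hnk hi
  have := hsetup.kappa_pos hik ht
  have := hsetup.log_pos
  have := tauU_pos hk hε0 hα hnk (t + 1)
  have := gammaPar_pos hk hε0
  have := two_le_boundFactor hk hε0 hε
  rw [abortCoeff, sampleBound_eq]
  positivity

/-- The coefficients of the degree sums in the potential of an ordered `i`-clique. -/
theorem abortCoeff_le (hk : 2 ≤ k) (hε0 : 0 < ε) (hε : ε ≤ 1 / (2 * (k : ℝ) ^ 2))
    (hα : 0 < α) (hnk : 0 < nk) (hmt : 0 < mt) {i t : ℕ} (hi : 1 ≤ i) (hik : i ≤ k) (ht : t ≤ k) :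
    abortCoeff k α ε nk mt (tauU k α ε nk) (kappaPar k ε (tauU k α ε nk) i) t ≤
      nk / (tauU k α ε nk i * (mt * α ^ (t - 1))) := by
  have hsetup := trialSetup_tauU (nk := nk) hk hε0 hε hα hnk hi
  have hκ := hsetup.kappa_ge t ht
  have hκ0 := hsetup.kappa_pos hik ht
  have hτi := tauU_pos hk hε0 hα hnk (k := k) i
  have hτ := tauU_pos hk hε0 hα hnk (k := k) (t + 1)
  have hγ := gammaPar_pos hk hε0
  have hγ1 := gammaPar_lt hk hε0 hε
  have hβ := betaPar_pos hk
  have hlog := half_le_log_inv_betaPar hk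
  have hlog2 : Real.log (2 / betaPar k) ≤ 2 * Real.log (1 / betaPar k) := by
    rw [← Real.log_rpow (by positivity)]
    refine Real.log_le_log (by positivity) ?_
    rw [Real.rpow_two, div_pow, one_pow, div_le_div_iff₀ hβ (by positivity)]
    nlinarith [betaPar_le hk]
  have hlog0 : 0 < Real.log (2 / betaPar k) := hsetup.log_pos
  have hsmall : betaPar k ^ k * gammaPar k ε ≤ 1 :=
    mul_le_one₀ (pow_le_one₀ hβ.le (by linarith [betaPar_le hk])) hγ.le hγ1.le
  have heq : abortCoeff k α ε nk mt (tauU k α ε nk) (kappaPar k ε (tauU k α ε nk) i) t =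
      (Real.log (2 / betaPar k) / (2 * Real.log (1 / betaPar k))) *
        (betaPar k ^ k * gammaPar k ε) *
        (nk / (2 * kappaPar k ε (tauU k α ε nk) i t * (mt * α ^ (t - 1)))) := by
    have : Real.log (1 / betaPar k) ≠ 0 := by linarith
    rw [abortCoeff, sampleBound_eq, boundFactor]
    field_simp
    ring
  rw [heq]
  calc _ ≤ 1 * 1 * (nk / (2 * kappaPar k ε (tauU k α ε nk) i t * (mt * α ^ (t - 1)))) := by
        gcongr
        rw [div_le_one (by linarith)]
        exact hlog2
    _ ≤ nk / (tauU k α ε nk i * (mt * α ^ (t - 1))) := by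
        rw [one_mul, one_mul]
        gcongr
        linarith

/-- On average over the ordered `i`-cliques the potential is small. -/
theorem sum_trialPotential_le (hk : 2 ≤ k) (hα : (graphArboricity G : ℝ) ≤ α) (hε0 : 0 < ε)
    (hε : ε ≤ 1 / (2 * (k : ℝ) ^ 2)) (hnk : 0 < nk) (hle : nk ≤ (G.cliqueFinset k).card)
    (hmt : (G.edgeFinset.card : ℝ) / 2 ≤ mt) {i : ℕ} (hi : 1 ≤ i) (hik : i < k) :
    ∑ T ∈ orderedCliques G i, trialPotential G k α ε nk mt T ≤
      8 * k.factorial * (G.cliqueFinset k).card / tauU k α ε nk i := by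
  have hcard : 0 < (G.cliqueFinset k).card := by exact_mod_cast hnk.trans_le hle
  have hα1 := one_le_of_card_cliqueFinset_pos hk hα hcard
  have hα0 : 0 < α := by linarith
  have hτi := tauU_pos hk hε0 hα0 hnk (k := k) i
  have hmt0 : 0 < mt := by
    have h1 := card_cliqueFinset_le hk hα
    have h2 : (0 : ℝ) < (G.cliqueFinset k).card := by exact_mod_cast hcard
    have h3 : (0 : ℝ) < G.edgeFinset.card := by
      by_contra h
      have : (G.edgeFinset.card : ℝ) = 0 := le_antisymm (not_lt.1 h) (Nat.cast_nonneg _)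
      rw [this, zero_mul] at h1
      linarith
    linarith
  have hterm : ∀ j ∈ Finset.Ico i k,
      abortCoeff k α ε nk mt (tauU k α ε nk) (kappaPar k ε (tauU k α ε nk) i) j *
        ∑ T ∈ orderedCliques G j, (tupleDegree G T : ℝ) ≤
      4 * (k - 1).factorial * (G.cliqueFinset k).card / tauU k α ε nk i := by
    intro j hj
    rw [Finset.mem_Ico] at hj
    obtain ⟨l, rfl⟩ : ∃ l, j = l + 1 := ⟨j - 1, by omega⟩
    have h1 := abortCoeff_le hk hε0 hε hα0 hnk hmt0 hi hik.le hj.2.le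
    have h2 := sum_tupleDegree_le (G := G) (t := l) hα
    have h3 := abortCoeff_nonneg hk hε0 hε hα0 hnk hmt0.le hi hik.le hj.2.le
    simp only [Nat.add_sub_cancel] at h1
    have hfac : ((l + 1).factorial : ℝ) ≤ (k - 1).factorial := by
      exact_mod_cast Nat.factorial_le (by omega)
    calc _ ≤ nk / (tauU k α ε nk i * (mt * α ^ l)) *
          ((l + 1).factorial * α ^ l * (2 * G.edgeFinset.card)) := by
          gcongr
      _ ≤ (G.cliqueFinset k).card / (tauU k α ε nk i * (mt * α ^ l)) *
          ((k - 1).factorial * α ^ l * (2 * (2 * mt))) := by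
          gcongr
          linarith
      _ = _ := by
          field_simp
          ring
  have hpot : ∑ T ∈ orderedCliques G i, trialPotential G k α ε nk mt T =
      ∑ T ∈ orderedCliques G i, potential G (abortCoeff k α ε nk mt (tauU k α ε nk)
        (kappaPar k ε (tauU k α ε nk) i)) (4 / tauU k α ε nk i) (k - i) i T := by
    refine Finset.sum_congr rfl fun T hT => ?_
    rw [trialPotential, (mem_orderedCliques.1 hT).1]
  rw [hpot, sum_potential, Nat.add_sub_cancel' hik.le, card_orderedCliques]
  have hsum := Finset.sum_le_card_nsmul _ _ _ hterm
  rw [Nat.card_Ico, nsmul_eq_mul] at hsum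
  have hki : ((k - i : ℕ) : ℝ) * (4 * (k - 1).factorial * (G.cliqueFinset k).card /
      tauU k α ε nk i) ≤ 4 * k.factorial * (G.cliqueFinset k).card / tauU k α ε nk i := by
    have h1 : ((k - i : ℕ) : ℝ) ≤ k := by exact_mod_cast Nat.sub_le _ _
    have h2 : (k.factorial : ℝ) = k * (k - 1).factorial := by
      exact_mod_cast (Nat.mul_factorial_pred (by omega)).symm
    calc _ ≤ (k : ℝ) * (4 * (k - 1).factorial * (G.cliqueFinset k).card / tauU k α ε nk i) := by
          gcongr
      _ = _ := by rw [h2]; ring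
  have hlast : 4 / tauU k α ε nk i * ((k.factorial * (G.cliqueFinset k).card : ℕ) : ℝ) =
      4 * k.factorial * (G.cliqueFinset k).card / tauU k α ε nk i := by
    push_cast; ring
  rw [hlast]
  refine (add_le_add (hsum.trans hki) le_rfl).trans (le_of_eq ?_)
  ring

end Parameters

/-! ### Goodness of the active subset -/

section Goodness

theorem orderedCliques_zero {n : ℕ} {G : SimpleGraph (Fin n)} : orderedCliques G 0 = {[]} := by
  ext T
  rw [mem_orderedCliques, List.length_eq_zero_iff, Finset.mem_singleton, and_iff_left_iff_imp]
  rintro rfl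
  exact List.Pairwise.nil

variable {n : ℕ} {G : SimpleGraph (Fin n)} [DecidableRel G.Adj] {nbr : NeighborLists G} {k : ℕ}
  {α ε nk mt : ℝ}

theorem trialPotential_nonneg (hk : 2 ≤ k) (hε0 : 0 < ε) (hε : ε ≤ 1 / (2 * (k : ℝ) ^ 2))
    (hα : 0 < α) (hnk : 0 < nk) (hmt : 0 ≤ mt) {T : List (Fin n)} (h1 : 1 ≤ T.length)
    (hTk : T.length ≤ k) : 0 ≤ trialPotential G k α ε nk mt T := by
  have := tauU_pos hk hε0 hα hnk (k := k) T.length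
  exact potential_nonneg (by positivity) _ _ (fun t _ h =>
    abortCoeff_nonneg hk hε0 hε hα hnk hmt h1 hTk (by omega)) T

theorem cliqueWeight_le_of_trialPotential_le (hk : 2 ≤ k) (hε0 : 0 < ε)
    (hε : ε ≤ 1 / (2 * (k : ℝ) ^ 2)) (hα : 0 < α) (hnk : 0 < nk) (hmt : 0 ≤ mt)
    {T : List (Fin n)} (h1 : 1 ≤ T.length) (hTk : T.length ≤ k)
    (hT : trialPotential G k α ε nk mt T ≤ 1 / 4) (A : Set (List (Fin n))) :
    (cliqueWeight G k A T : ℝ) ≤ tauU k α ε nk T.length := by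
  have hτ := tauU_pos hk hε0 hα hnk (k := k) T.length
  have h := (mul_cliqueWeight_le_potential (G := G) (A := A) (k := k)
    (θ := abortCoeff k α ε nk mt (tauU k α ε nk) (kappaPar k ε (tauU k α ε nk) T.length))
    (b := 4 / tauU k α ε nk T.length) (by positivity) (k - T.length) T (by omega)
    (fun t _ h => abortCoeff_nonneg hk hε0 hε hα hnk hmt h1 hTk h.le)).trans hT
  rw [div_mul_eq_mul_div, div_le_iff₀ hτ] at h
  linarith

variable (G) in
/-- The ordered cliques of size less than `k` whose potential is too large to guarantee that a
single trial of Is-Active has `χ = 1` with probability at least `3 / 4`. -/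
noncomputable def heavyCliques (k : ℕ) (α ε nk mt : ℝ) : Finset (List (Fin n)) :=
  (Finset.Ico 1 k).biUnion fun i =>
    (orderedCliques G i).filter fun T => 1 / 4 < trialPotential G k α ε nk mt T

theorem mem_heavyCliques {T : List (Fin n)} : T ∈ heavyCliques G k α ε nk mt ↔
    (1 ≤ T.length ∧ T.length < k) ∧ IsOrderedClique G T ∧
      1 / 4 < trialPotential G k α ε nk mt T := by
  simp only [heavyCliques, Finset.mem_biUnion, Finset.mem_Ico, Finset.mem_filter,
    mem_orderedCliques]
  constructor
  · rintro ⟨i, h, ⟨rfl, hT⟩, hp⟩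
    exact ⟨h, hT, hp⟩
  · rintro ⟨h, hT, hp⟩
    exact ⟨_, h, ⟨rfl, hT⟩, hp⟩

theorem card_heavyCliques_le (hk : 2 ≤ k) (hα : (graphArboricity G : ℝ) ≤ α) (hε0 : 0 < ε)
    (hε : ε ≤ 1 / (2 * (k : ℝ) ^ 2)) (hnk : 0 < nk) (hle : nk ≤ (G.cliqueFinset k).card)
    (hmt : (G.edgeFinset.card : ℝ) / 2 ≤ mt) {i : ℕ} (hi : 1 ≤ i) (hik : i < k) :
    (((heavyCliques G k α ε nk mt).filter fun T => T.length = i).card : ℝ) ≤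
      32 * k.factorial * (G.cliqueFinset k).card / tauU k α ε nk i := by
  have hcard : 0 < (G.cliqueFinset k).card := by exact_mod_cast hnk.trans_le hle
  have hα1 := one_le_of_card_cliqueFinset_pos hk hα hcard
  have hmt0 : 0 ≤ mt := le_trans (by positivity) hmt
  have hsub : ((heavyCliques G k α ε nk mt).filter fun T => T.length = i) ⊆
      orderedCliques G i := by
    intro T hT
    rw [Finset.mem_filter, mem_heavyCliques] at hT
    exact mem_orderedCliques.2 ⟨hT.2, hT.1.2.1⟩
  have h1 : (((heavyCliques G k α ε nk mt).filter fun T => T.length = i).card : ℝ) * (1 / 4) ≤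
      ∑ T ∈ (heavyCliques G k α ε nk mt).filter fun T => T.length = i,
        trialPotential G k α ε nk mt T := by
    rw [← nsmul_eq_mul]
    refine Finset.card_nsmul_le_sum _ _ _ fun T hT => ?_
    rw [Finset.mem_filter, mem_heavyCliques] at hT
    exact hT.1.2.2.le
  have h2 := Finset.sum_le_sum_of_subset_of_nonneg (f := trialPotential G k α ε nk mt) hsub
    fun T hT _ => by
      rw [mem_orderedCliques] at hT
      exact trialPotential_nonneg hk hε0 hε (by linarith) hnk hmt0 (by omega) (by omega)
  have h3 := sum_trialPotential_le hk hα hε0 hε hnk hle hmt hi hik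
  have h4 : 32 * k.factorial * (G.cliqueFinset k).card / tauU k α ε nk i =
      4 * (8 * k.factorial * (G.cliqueFinset k).card / tauU k α ε nk i) := by ring
  rw [h4]
  linarith

/-- The fraction of `k`-cliques lost on account of the heavy ordered cliques of one size. -/
theorem lossFactor_le (hk : 2 ≤ k) (hε0 : 0 < ε) (hε : ε ≤ 1 / (2 * (k : ℝ) ^ 2)) :
    2 * (32 * (k.factorial : ℝ) ^ 2 * gammaPar k ε ^ 2 / (k : ℝ) ^ (4 * k)) ≤ ε / (2 * k) := by
  have hk1 : (2 : ℝ) ≤ k := by exact_mod_cast hk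
  have hfac : (0 : ℝ) < k.factorial := by exact_mod_cast k.factorial_pos
  have hε8 := eps_le hk hε
  have hp : (1 : ℝ) ≤ (k : ℝ) ^ (4 * k) := one_le_pow₀ (by linarith)
  have h1 : 2 * (32 * (k.factorial : ℝ) ^ 2 * gammaPar k ε ^ 2 / (k : ℝ) ^ (4 * k)) =
      ε ^ 2 / (k ^ 2 * (k : ℝ) ^ (4 * k)) := by
    rw [gammaPar]
    field_simp
    norm_num
  rw [h1, div_le_div_iff₀ (by positivity) (by positivity)]
  calc ε ^ 2 * (2 * k) = ε * k * (2 * ε) := by ring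
    _ ≤ ε * k * (k * (k : ℝ) ^ (4 * k)) := by
      gcongr
      nlinarith
    _ = _ := by ring

/-- The blocked completions that start with a single vertex. When the threshold for vertices is
given by `ñ_k ^ ((k - 1) / k)`, there are so few heavy vertices that they do not even span many
`k`-cliques. -/
theorem card_blockedCompletions_nil_heavyCliques_le (hk : 2 ≤ k)
    (hα : (graphArboricity G : ℝ) ≤ α) (hε0 : 0 < ε) (hε : ε ≤ 1 / (2 * (k : ℝ) ^ 2)) (hnk : 0 < nk)
    (hle4 : ((G.cliqueFinset k).card : ℝ) / 4 ≤ nk) (hle : nk ≤ (G.cliqueFinset k).card)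
    (hmt : (G.edgeFinset.card : ℝ) / 2 ≤ mt) :
    ((blockedCompletions G (heavyCliques G k α ε nk mt) k []).card : ℝ) ≤
      2 * (32 * (k.factorial : ℝ) ^ 2 * gammaPar k ε ^ 2 / (k : ℝ) ^ (4 * k)) *
        (G.cliqueFinset k).card := by
  have hcard : 0 < (G.cliqueFinset k).card := by exact_mod_cast hnk.trans_le hle
  have hα1 := one_le_of_card_cliqueFinset_pos hk hα hcard
  have hα0 : 0 < α := by linarith
  have hγ := gammaPar_pos hk hε0
  have hk1 : (2 : ℝ) ≤ k := by exact_mod_cast hk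
  have hfac : (2 : ℝ) ≤ k.factorial := by exact_mod_cast Nat.factorial_le hk
  have hheavy := card_heavyCliques_le hk hα hε0 hε hnk hle hmt le_rfl (by omega : 1 < k)
  have hloss := lossFactor_le hk hε0 hε
  rw [tauU_one hk] at hheavy
  set c : ℝ := ((G.cliqueFinset k).card : ℝ) with hc
  set p : ℝ := (k : ℝ) ^ (4 * k) with hp
  have hp0 : 0 < p := by positivity
  have hc0 : 0 < c := hnk.trans_le hle
  rcases le_total (α ^ (k - 1)) (nk ^ (((k : ℝ) - 1) / k)) with hmin | hmin
  · rw [min_eq_left hmin] at hheavy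
    have h := sum_card_blockedCompletions_le (G := G) (N := heavyCliques G k α ε nk mt) (j := 0)
      (k := k) (by omega) hα
    rw [orderedCliques_zero, Finset.sum_singleton] at h
    simp only [Nat.sub_zero, zero_add] at h
    refine h.trans ?_
    calc _ ≤ k.factorial * α ^ (k - 1) *
          (32 * k.factorial * c / (p / gammaPar k ε ^ 2 * α ^ (k - 1))) := by gcongr
      _ = 32 * (k.factorial : ℝ) ^ 2 * gammaPar k ε ^ 2 / p * c := by field_simp
      _ ≤ _ := by
        gcongr
        refine le_mul_of_one_le_left (by positivity) (by norm_num)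
  · rw [min_eq_right hmin] at hheavy
    set y : ℝ := nk ^ (((k : ℝ) - 1) / k) with hy
    have hy0 : 0 < y := by positivity
    have hyk : y ^ k = nk ^ (k - 1) := by
      rw [hy, ← Real.rpow_natCast, ← Real.rpow_mul hnk.le, div_mul_cancel₀ _ (by positivity),
        ← Real.rpow_natCast, Nat.cast_sub (by omega), Nat.cast_one]
    set Q : ℝ := 32 * k.factorial * gammaPar k ε ^ 2 / p with hQ
    have hQ0 : 0 ≤ Q := by positivity
    have hQP : 4 * Q ≤ 2 * (32 * (k.factorial : ℝ) ^ 2 * gammaPar k ε ^ 2 / p) := by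
      calc 4 * Q = 2 * (2 * Q) := by ring
        _ ≤ 2 * (k.factorial * Q) := by gcongr
        _ = _ := by rw [hQ]; ring
    have hQ1 : 4 * Q ≤ 1 := by
      refine (hQP.trans hloss).trans ?_
      rw [div_le_one (by positivity)]
      linarith [eps_le hk hε]
    have hh : (((heavyCliques G k α ε nk mt).filter fun T => T.length = 1).card : ℝ) ≤
        Q * c / y := by
      refine hheavy.trans (le_of_eq ?_)
      rw [hQ]
      field_simp
    calc _ ≤ (((heavyCliques G k α ε nk mt).filter fun T => T.length = 1).card : ℝ) ^ k := by
          exact_mod_cast card_blockedCompletions_nil_le _ k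
      _ ≤ (Q * c / y) ^ k := by gcongr
      _ = Q ^ k * c * (c / nk) ^ (k - 1) := by
          rw [div_pow, mul_pow, hyk, ← mul_pow_sub_one (by omega : k ≠ 0) c, div_pow]
          ring
      _ ≤ Q ^ k * c * 4 ^ (k - 1) := by
          gcongr
          rw [div_le_iff₀ hnk]
          linarith
      _ ≤ Q ^ k * c * 4 ^ k := by
          gcongr
          · norm_num
          · omega
      _ = (4 * Q) ^ k * c := by rw [mul_pow]; ring
      _ ≤ (4 * Q) * c := by
          gcongr
          exact pow_le_of_le_one (by positivity) hQ1 (by omega)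
      _ ≤ _ := by gcongr

/-- Few `k`-cliques have a heavy proper prefix in each of their orderings. -/
theorem card_le_of_forall_take_mem_heavyCliques (hk : 2 ≤ k)
    (hα : (graphArboricity G : ℝ) ≤ α) (hε0 : 0 < ε) (hε : ε ≤ 1 / (2 * (k : ℝ) ^ 2)) (hnk : 0 < nk)
    (hle4 : ((G.cliqueFinset k).card : ℝ) / 4 ≤ nk) (hle : nk ≤ (G.cliqueFinset k).card)
    (hmt : (G.edgeFinset.card : ℝ) / 2 ≤ mt) {𝓑 : Finset (Finset (Fin n))}
    (h𝓑 : ∀ C ∈ 𝓑, G.IsNClique k C ∧ ∀ L : List (Fin n), L.Nodup → L.toFinset = C →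
      ∃ j, 1 ≤ j ∧ j < k ∧ L.take j ∈ heavyCliques G k α ε nk mt) :
    (𝓑.card : ℝ) ≤ ε / 2 * (G.cliqueFinset k).card := by
  have hcard : 0 < (G.cliqueFinset k).card := by exact_mod_cast hnk.trans_le hle
  have hα1 := one_le_of_card_cliqueFinset_pos hk hα hcard
  have hα0 : 0 < α := by linarith
  have hγ := gammaPar_pos hk hε0
  have hβ := betaPar_pos hk
  have hk0 : (0 : ℝ) < k := by positivity
  have hloss := lossFactor_le hk hε0 hε
  have hterm : ∀ j ∈ Finset.range (k - 1), ((∑ T ∈ orderedCliques G j,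
      (blockedCompletions G (heavyCliques G k α ε nk mt) k T).card : ℕ) : ℝ) ≤
      ε / (2 * k) * (G.cliqueFinset k).card := by
    intro j hj
    rw [Finset.mem_range] at hj
    refine le_trans ?_ (mul_le_mul_of_nonneg_right hloss (Nat.cast_nonneg _))
    rcases Nat.eq_zero_or_pos j with rfl | hj0
    · rw [orderedCliques_zero, Finset.sum_singleton]
      exact card_blockedCompletions_nil_heavyCliques_le hk hα hε0 hε hnk hle4 hle hmt
    · have hheavy := card_heavyCliques_le hk hα hε0 hε hnk hle hmt (by omega : 1 ≤ j + 1)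
        (by omega : j + 1 < k)
      rw [tauU_of_lt (by omega) (by omega)] at hheavy
      have hfac : ((k - j).factorial : ℝ) ≤ k.factorial := by
        exact_mod_cast Nat.factorial_le (Nat.sub_le _ _)
      have hβ1 : betaPar k ^ k ≤ 1 := pow_le_one₀ hβ.le (by linarith [betaPar_le hk])
      calc _ ≤ _ := sum_card_blockedCompletions_le (by omega) hα
        _ ≤ k.factorial * α ^ (k - (j + 1)) * (32 * k.factorial * (G.cliqueFinset k).card /
            ((k : ℝ) ^ (4 * k) / (betaPar k ^ k * gammaPar k ε ^ 2) * α ^ (k - (j + 1)))) := by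
          rw [Nat.sub_sub]
          gcongr
        _ = betaPar k ^ k * (32 * (k.factorial : ℝ) ^ 2 * gammaPar k ε ^ 2 / (k : ℝ) ^ (4 * k)) *
            (G.cliqueFinset k).card := by field_simp
        _ ≤ _ := by
          gcongr
          linarith
  calc (𝓑.card : ℝ) ≤ ∑ j ∈ Finset.range (k - 1), ((∑ T ∈ orderedCliques G j,
        (blockedCompletions G (heavyCliques G k α ε nk mt) k T).card : ℕ) : ℝ) := by
        exact_mod_cast card_le_sum_blockedCompletions h𝓑
    _ ≤ (Finset.range (k - 1)).card • (ε / (2 * k) * (G.cliqueFinset k).card) :=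
        Finset.sum_le_card_nsmul _ _ _ hterm
    _ ≤ k * (ε / (2 * k) * (G.cliqueFinset k).card) := by
        rw [Finset.card_range, nsmul_eq_mul]
        gcongr
        exact_mod_cast Nat.sub_le _ _
    _ = _ := by field_simp

/-- A `k`-clique is unassigned only if each of its orderings has a Non-Active, hence heavy, proper
prefix. -/
theorem isGood_of_isTauBounded (hk : 2 ≤ k) (hα : (graphArboricity G : ℝ) ≤ α) (hε0 : 0 < ε)
    (hε : ε ≤ 1 / (2 * (k : ℝ) ^ 2)) (hnk : 0 < nk)
    (hle4 : ((G.cliqueFinset k).card : ℝ) / 4 ≤ nk) (hle : nk ≤ (G.cliqueFinset k).card)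
    (hmt : (G.edgeFinset.card : ℝ) / 2 ≤ mt) {ans : SmallOrderedClique G k → Bool}
    (hb : IsTauBounded G k (tauU k α ε nk) (activeSet G k ans))
    (hact : ∀ I : SmallOrderedClique G k, trialPotential G k α ε nk mt I.1 ≤ 1 / 4 →
      ans I = true) : IsGood G k ε (tauU k α ε nk) (activeSet G k ans) := by
  refine ⟨hb, ?_⟩
  have h := le_sum_cliqueWeight_singleton (G := G) (A := activeSet G k ans) (k := k) (by omega)
    (B := ε / 2 * (G.cliqueFinset k).card) fun 𝓑 h𝓑 => by
      refine card_le_of_forall_take_mem_heavyCliques hk hα hε0 hε hnk hle4 hle hmt fun C hC =>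
        ⟨(h𝓑 C hC).1, fun L hL hLC => ?_⟩
      have hclique := (h𝓑 C hC).1
      have hLk : L.length = k := by rw [← List.toFinset_card_of_nodup hL, hLC, hclique.2]
      have hord := isOrderedClique_of_toFinset hclique.1 hL hLC.le
      have hna := (h𝓑 C hC).2 L hL hLC
      simp only [FullyActive, not_forall] at hna
      obtain ⟨j, hj1, hjL, hj⟩ := hna
      have hlen : (L.take j).length = j := by rw [List.length_take]; omega
      have hordj : IsOrderedClique G (L.take j) := hord.sublist (List.take_sublist _ _)
      have hjk : j < k := by
        refine lt_of_le_of_ne (hLk ▸ hjL) fun h => hj (Or.inr ⟨by omega, hordj⟩)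
      refine ⟨j, hj1, hjk, mem_heavyCliques.2 ⟨by omega, hordj, ?_⟩⟩
      by_contra hp
      exact hj (Or.inl ⟨⟨L.take j, by omega, by omega, hordj⟩, rfl, hact _ (not_lt.1 hp)⟩)
  linarith

/-- With an estimate of the number of `k`-cliques that is not too large, the active subset is good
with high probability. -/
theorem answersLaw_isGood {δ : ℝ} (hn : 2 ≤ n) (hk : 2 ≤ k) (hα : (graphArboricity G : ℝ) ≤ α)
    (hε0 : 0 < ε) (hε : ε ≤ 1 / (2 * (k : ℝ) ^ 2)) (hδ : 0 < δ) (hnk : 0 < nk)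
    (hle4 : ((G.cliqueFinset k).card : ℝ) / 4 ≤ nk) (hle : nk ≤ (G.cliqueFinset k).card)
    (hmt : (G.edgeFinset.card : ℝ) / 2 ≤ mt) :
    ENNReal.ofReal (1 - δ) ≤ answersLaw G nbr k α ε δ nk mt
      {ans | IsGood G k ε (tauU k α ε nk) (activeSet G k ans)} := by
  have hcard : 0 < (G.cliqueFinset k).card := by exact_mod_cast hnk.trans_le hle
  have hα1 := one_le_of_card_cliqueFinset_pos hk hα hcard
  have hmt0 : 0 ≤ mt := le_trans (by positivity) hmt
  refine (answersLaw_bounded_and_active hn hδ (fun t _ _ => tauU_nonneg hk hε0 (by linarith) hnk t)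
    tauU_self.ge {I | trialPotential G k α ε nk mt I.1 ≤ 1 / 4}
    (fun I hI A => cliqueWeight_le_of_trialPotential_le hk hε0 hε (by linarith) hnk hmt0 I.2.1
      I.2.2.1.le hI A)
    (fun I hI => expect_isActive_false_le_of_potential hn hk hα hε0 hε hδ hnk hle hmt I hI)
    (fun I A => expect_isActive_true_le_of_lt_weight hn hk hα hε0 hε hδ hnk I A)).trans
    (MeasureTheory.measure_mono fun ans h => ?_)
  exact isGood_of_isTauBounded hk hα hε0 hε hnk hle4 hle hmt h.1 h.2

/-- Boundedness needs no assumption on the estimates except `ñ_k > 0`. -/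
theorem answersLaw_isTauBounded {δ : ℝ} (hn : 2 ≤ n) (hk : 2 ≤ k)
    (hα : (graphArboricity G : ℝ) ≤ α) (hε0 : 0 < ε) (hε : ε ≤ 1 / (2 * (k : ℝ) ^ 2)) (hδ : 0 < δ)
    (hnk : 0 < nk) :
    ENNReal.ofReal (1 - δ) ≤ answersLaw G nbr k α ε δ nk mt
      {ans | IsTauBounded G k (tauU k α ε nk) (activeSet G k ans)} := by
  have hα0 : 0 ≤ α := (Nat.cast_nonneg _).trans hα
  exact (answersLaw_bounded_and_active hn hδ (fun t _ _ => tauU_nonneg hk hε0 hα0 hnk t)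
    tauU_self.ge ∅ (by simp) (by simp)
    (fun I A => expect_isActive_true_le_of_lt_weight hn hk hα hε0 hε hδ hnk I A)).trans
    (MeasureTheory.measure_mono fun ans h => h.1)

end Goodness

/-! ### The bound on the running time -/

section CostBound

variable {n : ℕ} {G : SimpleGraph (Fin n)} [DecidableRel G.Adj] {nbr : NeighborLists G} {k : ℕ}
  {α ε δ nk mt : ℝ}

theorem boundFactor_le (hk : 2 ≤ k) (hε0 : 0 < ε) :
    boundFactor k ε ≤ 36864 * ((k : ℝ) ^ 4 * 6 ^ k * (k : ℝ) ^ (4 * k)) / ε ^ 3 := by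
  have hk0 : (0 : ℝ) < k := by positivity
  have hlog : Real.log (6 * k) ≤ 6 * k := (Real.log_le_self (by positivity))
  have hfac : (k.factorial : ℝ) ≤ (k : ℝ) ^ k := by exact_mod_cast Nat.factorial_le_pow k
  have hfac0 : (0 : ℝ) < k.factorial := by exact_mod_cast k.factorial_pos
  have h1 : boundFactor k ε =
      12 * Real.log (6 * k) * (6 * k) ^ k * (512 * k ^ 3 * (k.factorial : ℝ) ^ 3) / ε ^ 3 := by
    rw [boundFactor, betaPar, gammaPar, one_div_one_div, one_div, inv_pow]
    field_simp
    ring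
  rw [h1]
  calc _ ≤ 12 * (6 * k) * (6 * k) ^ k * (512 * k ^ 3 * ((k : ℝ) ^ k) ^ 3) / ε ^ 3 := by gcongr
    _ = _ := by
      rw [mul_pow, mul_comm 4 k, pow_mul (k : ℝ) k 4]
      ring

theorem pow_seven_mul_six_pow_le (hk : 2 ≤ k) :
    (k : ℝ) ^ 7 * 6 ^ k ≤ 6 ^ 13 * (k : ℝ) ^ (2 * k) := by
  have hk1 : (1 : ℝ) ≤ k := by exact_mod_cast (by omega : 1 ≤ k)
  rcases Nat.lt_or_ge k 7 with h | h
  · have h6 : (k : ℝ) ≤ 6 := by exact_mod_cast (by omega : k ≤ 6)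
    calc (k : ℝ) ^ 7 * 6 ^ k ≤ 6 ^ 7 * 6 ^ 6 := by
          gcongr
          · norm_num
          · omega
      _ = 6 ^ 13 * 1 := by norm_num
      _ ≤ _ := by
          gcongr
          exact one_le_pow₀ hk1
  · have h6 : (6 : ℝ) ≤ k := by exact_mod_cast (by omega : 6 ≤ k)
    calc (k : ℝ) ^ 7 * 6 ^ k ≤ (k : ℝ) ^ k * (k : ℝ) ^ k := by gcongr
      _ = 1 * (k : ℝ) ^ (2 * k) := by rw [← pow_add, two_mul, one_mul]
      _ ≤ _ := by
          gcongr
          norm_num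

theorem half_le_log_div (hn : 2 ≤ n) (hδ : 0 < δ) (hδ1 : δ < 1) : 1 / 2 ≤ Real.log (n / δ) := by
  have hn2 : (2 : ℝ) ≤ n := by exact_mod_cast hn
  have h : Real.log 2 ≤ Real.log (n / δ) := by
    refine Real.log_le_log (by norm_num) ?_
    rw [le_div_iff₀ hδ]
    linarith
  linarith [Real.log_two_gt_d9]

/-- The number of trials of Is-Active. -/
theorem ceil_log_le (hn : 2 ≤ n) (hk : 2 ≤ k) (hδ : 0 < δ) (hδ1 : δ < 1) :
    (⌈12 * Real.log ((n : ℝ) ^ k / δ)⌉₊ : ℝ) ≤ 13 * (k * Real.log (n / δ)) := by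
  have hn2 : (2 : ℝ) ≤ n := by exact_mod_cast hn
  have hk2 : (2 : ℝ) ≤ k := by exact_mod_cast hk
  have hlogδ : Real.log δ ≤ 0 := Real.log_nonpos hδ.le hδ1.le
  have hlogn : 0 ≤ Real.log n := Real.log_nonneg (by linarith)
  have hΛ := half_le_log_div hn hδ hδ1
  have h1 : Real.log ((n : ℝ) ^ k / δ) = k * Real.log n - Real.log δ := by
    rw [Real.log_div (by positivity) hδ.ne', Real.log_pow]
  have h2 : Real.log (n / δ) = Real.log n - Real.log δ := by
    rw [Real.log_div (by positivity) hδ.ne']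
  have h3 : Real.log ((n : ℝ) ^ k / δ) ≤ k * Real.log (n / δ) := by
    rw [h1, h2]
    nlinarith
  have h4 : 0 ≤ Real.log ((n : ℝ) ^ k / δ) := by
    rw [h1]
    have : 0 ≤ k * Real.log n := by positivity
    linarith
  have h5 := (Nat.ceil_lt_add_one (a := 12 * Real.log ((n : ℝ) ^ k / δ)) (by positivity)).le
  nlinarith

/-- The number of samples drawn in a trial. -/
theorem sum_floor_sampleBound_le (hk : 2 ≤ k) (hε0 : 0 < ε) (hε : ε ≤ 1 / (2 * (k : ℝ) ^ 2))
    (hα : 0 ≤ α) (hnk : 0 < nk) :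
    ((∑ t ∈ Finset.Ico 1 k, ⌊sampleBound k α ε nk mt (tauU k α ε nk) t⌋₊ : ℕ) : ℝ) ≤
      2 * boundFactor k ε * max 1
        (mt / nk * ∑ t ∈ Finset.Icc 2 k, α ^ (t - 2) * tauU k α ε nk t) := by
  have hB := two_le_boundFactor hk hε0 hε
  rcases le_total 0 mt with hmt | hmt
  · have hsum : ∑ t ∈ Finset.Ico 1 k, sampleBound k α ε nk mt (tauU k α ε nk) t =
        2 * boundFactor k ε *
          (mt / nk * ∑ t ∈ Finset.Icc 2 k, α ^ (t - 2) * tauU k α ε nk t) := by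
      have hre : ∑ t ∈ Finset.Icc 2 k, α ^ (t - 2) * tauU k α ε nk t =
          ∑ t ∈ Finset.Ico 1 k, α ^ (t - 1) * tauU k α ε nk (t + 1) := by
        rw [← Finset.Ico_add_one_right_eq_Icc, ← Finset.sum_Ico_add' _ 1 k 1]
        rfl
      rw [hre, Finset.mul_sum, Finset.mul_sum]
      refine Finset.sum_congr rfl fun t _ => ?_
      rw [sampleBound_eq]
      ring
    push_cast
    calc _ ≤ ∑ t ∈ Finset.Ico 1 k, sampleBound k α ε nk mt (tauU k α ε nk) t := by
          refine Finset.sum_le_sum fun t _ => Nat.floor_le ?_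
          have := tauU_nonneg hk hε0 hα hnk (t + 1)
          rw [sampleBound_eq]
          positivity
      _ ≤ _ := by
          rw [hsum]
          gcongr
          exact le_max_right _ _
  · have hzero : ∀ t, ⌊sampleBound k α ε nk mt (tauU k α ε nk) t⌋₊ = 0 := by
      intro t
      refine Nat.floor_of_nonpos ?_
      have := tauU_nonneg hk hε0 hα hnk (t + 1)
      rw [sampleBound_eq]
      refine mul_nonpos_of_nonpos_of_nonneg (div_nonpos_of_nonpos_of_nonneg ?_ hnk.le)
        (by linarith)
      exact mul_nonpos_of_nonpos_of_nonneg
        (mul_nonpos_of_nonpos_of_nonneg (by linarith) (by positivity)) this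
    simp only [hzero, Finset.sum_const_zero, Nat.cast_zero]
    positivity

/-- The running time of an invocation of Is-Active, in every outcome. -/
theorem steps_isActive_le (hn : 2 ≤ n) (hk : 2 ≤ k) (hα : 0 ≤ α) (hε0 : 0 < ε)
    (hε : ε ≤ 1 / (2 * (k : ℝ) ^ 2)) (hδ : 0 < δ) (hδ1 : δ < 1) (hnk : 0 < nk)
    (I : SmallOrderedClique G k) {r : Execution Bool}
    (hr : r ∈ ((isActive I.1 k α ε δ nk mt (tauU k α ε nk)).run G nbr).support) :
    r.queries ≤ r.steps ∧ (r.steps : ℝ) ≤ 1400 * 36864 * 6 ^ 13 * max 1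
      (mt / nk * ∑ t ∈ Finset.Icc 2 k, α ^ (t - 2) * tauU k α ε nk t) *
      ((k : ℝ) ^ (6 * k) * Real.log (n / δ) ^ 2 / ε ^ 3) := by
  have h := within_isActive (n := n) (G := G) (nbr := nbr) (α := α) (ε := ε) (δ := δ) (nk := nk)
    (mt := mt) (τ := tauU k α ε nk) hk
    (b := fun t => ⌊sampleBound k α ε nk mt (tauU k α ε nk) t⌋₊)
    (fun t s hs => Nat.le_floor hs) I.2.1 I.2.2.1 r hr
  refine ⟨h.2.1, (Nat.cast_le (α := ℝ).2 h.2.2).trans ?_⟩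
  have hs := sum_floor_sampleBound_le (mt := mt) hk hε0 hε hα hnk
  have hq := ceil_log_le hn hk hδ hδ1
  have hΛ := half_le_log_div hn hδ hδ1
  have hB := two_le_boundFactor hk hε0 hε
  have hB2 := boundFactor_le hk hε0
  set X := mt / nk * ∑ t ∈ Finset.Icc 2 k, α ^ (t - 2) * tauU k α ε nk t
  have hZ : 1 ≤ max 1 X := le_max_left _ _
  set Z := max 1 X
  set Λ := Real.log (n / δ)
  set B := boundFactor k ε
  have hk2 : (2 : ℝ) ≤ k := by exact_mod_cast hk
  have hBZ : 2 ≤ B * Z := by nlinarith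
  have htrial : 40 * (k : ℝ) ^ 2 + 32 * k * (2 * B * Z) ≤ 52 * k ^ 2 * (B * Z) := by
    have h1 : (k : ℝ) ^ 2 * 2 ≤ k ^ 2 * (B * Z) := by gcongr
    have h2 : 2 * (k * (B * Z)) ≤ (k : ℝ) * (k * (B * Z)) := by gcongr
    linarith
  have hΛ2 : Λ ≤ 2 * Λ ^ 2 := by nlinarith
  have h6k : 6 * (k : ℝ) ≤ 24 * (k * Λ) * (k ^ 2 * (B * Z)) := by
    have h1 : 1 ≤ 4 * (Λ * (k ^ 2 * (B * Z))) := by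
      have : (1 : ℝ) ≤ k ^ 2 * (B * Z) := by
        nlinarith [one_le_pow₀ (by linarith : 1 ≤ (k : ℝ)) (n := 2)]
      nlinarith
    have := mul_le_mul_of_nonneg_left h1 (by positivity : (0 : ℝ) ≤ 6 * k)
    linarith
  push_cast at hs ⊢
  calc _ ≤ 6 * (k : ℝ) + 13 * (k * Λ) * (40 * k ^ 2 + 32 * k * (2 * B * Z)) := by gcongr
    _ ≤ 24 * (k * Λ) * (k ^ 2 * (B * Z)) + 13 * (k * Λ) * (52 * k ^ 2 * (B * Z)) := by gcongr
    _ = 700 * k ^ 3 * (B * Z) * Λ := by ring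
    _ ≤ 700 * k ^ 3 * (B * Z) * (2 * Λ ^ 2) := by gcongr
    _ = 1400 * Z * (k ^ 3 * B * Λ ^ 2) := by ring
    _ ≤ 1400 * Z *
        (k ^ 3 * (36864 * ((k : ℝ) ^ 4 * 6 ^ k * (k : ℝ) ^ (4 * k)) / ε ^ 3) * Λ ^ 2) := by
      gcongr
    _ = 1400 * 36864 * Z * ((k : ℝ) ^ 7 * 6 ^ k * (k : ℝ) ^ (4 * k) * Λ ^ 2 / ε ^ 3) := by ring
    _ ≤ 1400 * 36864 * Z * (6 ^ 13 * (k : ℝ) ^ (2 * k) * (k : ℝ) ^ (4 * k) * Λ ^ 2 / ε ^ 3) := by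
      gcongr 1400 * 36864 * Z * (?_ * _ * _ / _)
      exact pow_seven_mul_six_pow_le hk
    _ = _ := by
      rw [show 6 * k = 2 * k + 4 * k by ring, pow_add]
      ring

/-- The last term of the sum in the running time is at least `1 / 2`. -/
theorem half_le_mul_sum_tauU (hk : 2 ≤ k) (hα : (graphArboricity G : ℝ) ≤ α) (hε0 : 0 < ε)
    (hnk : 0 < nk) (hle : nk ≤ (G.cliqueFinset k).card)
    (hmt : (G.edgeFinset.card : ℝ) / 2 ≤ mt) :
    1 / 2 ≤ mt / nk * ∑ t ∈ Finset.Icc 2 k, α ^ (t - 2) * tauU k α ε nk t := by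
  have hα0 : 0 ≤ α := (Nat.cast_nonneg _).trans hα
  have hmt0 : 0 ≤ mt := le_trans (by positivity) hmt
  have hlast : α ^ (k - 2) ≤ ∑ t ∈ Finset.Icc 2 k, α ^ (t - 2) * tauU k α ε nk t := by
    have := Finset.single_le_sum (f := fun t => α ^ (t - 2) * tauU k α ε nk t)
      (fun t _ => mul_nonneg (pow_nonneg hα0 _) (tauU_nonneg hk hε0 hα0 hnk t))
      (Finset.mem_Icc.2 ⟨hk, le_rfl⟩)
    simpa only [tauU_self, mul_one] using this
  calc (1 : ℝ) / 2 ≤ mt / nk * α ^ (k - 2) := by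
        rw [div_mul_eq_mul_div, le_div_iff₀ hnk]
        have h1 := hle.trans (card_cliqueFinset_le hk hα)
        have h2 := mul_le_mul_of_nonneg_right hmt (pow_nonneg hα0 (k - 2))
        linarith
    _ ≤ _ := by gcongr

end CostBound

end IsActive

theorem mainTheorem5 :
    ∃ K : ℝ, 0 < K ∧
      ∀ (n k : ℕ) (G : SimpleGraph (Fin n)) [DecidableRel G.Adj] (nbr : NeighborLists G)
        (α ε δ nk mt : ℝ),
        2 ≤ n → 2 ≤ k → (graphArboricity G : ℝ) ≤ α →
        0 < ε → ε ≤ 1 / (2 * (k : ℝ) ^ 2) → 0 < δ → δ < 1 → 0 < nk →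
        -- correctness for an estimate that is not too large
        (((G.cliqueFinset k).card : ℝ) / 4 ≤ nk → nk ≤ (G.cliqueFinset k).card →
            (G.edgeFinset.card : ℝ) / 2 ≤ mt →
          ENNReal.ofReal (1 - δ) ≤ answersLaw G nbr k α ε δ nk mt
            {ans | IsGood G k ε (tauU k α ε nk) (activeSet G k ans)}) ∧
        -- correctness for an overestimate
        (((G.cliqueFinset k).card : ℝ) < nk →
          ENNReal.ofReal (1 - δ) ≤ answersLaw G nbr k α ε δ nk mt
            {ans | IsTauBounded G k (tauU k α ε nk) (activeSet G k ans)}) ∧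
        -- query complexity and running time of every invocation
        (∀ (I : SmallOrderedClique G k),
          ∀ r ∈ ((isActive I.1 k α ε δ nk mt (tauU k α ε nk)).run G nbr).support,
            ((r.queries : ℝ) ≤ K * max 1
                (mt / nk * ∑ t ∈ Finset.Icc 2 k, α ^ (t - 2) * tauU k α ε nk t) *
                ((k : ℝ) ^ (6 * k) * Real.log (n / δ) ^ 2 / ε ^ 3) ∧
              (r.steps : ℝ) ≤ K * max 1
                (mt / nk * ∑ t ∈ Finset.Icc 2 k, α ^ (t - 2) * tauU k α ε nk t) *
                ((k : ℝ) ^ (6 * k) * Real.log (n / δ) ^ 2 / ε ^ 3)) ∧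
            (nk ≤ (G.cliqueFinset k).card → (G.edgeFinset.card : ℝ) / 2 ≤ mt →
              (r.queries : ℝ) ≤ K *
                (mt / nk * ∑ t ∈ Finset.Icc 2 k, α ^ (t - 2) * tauU k α ε nk t) *
                ((k : ℝ) ^ (6 * k) * Real.log (n / δ) ^ 2 / ε ^ 3) ∧
              (r.steps : ℝ) ≤ K *
                (mt / nk * ∑ t ∈ Finset.Icc 2 k, α ^ (t - 2) * tauU k α ε nk t) *
                ((k : ℝ) ^ (6 * k) * Real.log (n / δ) ^ 2 / ε ^ 3))) := by
  refine ⟨2 * (1400 * 36864 * 6 ^ 13), by norm_num, ?_⟩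
  intro n k G _ nbr α ε δ nk mt hn hk hα hε0 hε hδ hδ1 hnk
  refine ⟨fun hle4 hle hmt => answersLaw_isGood hn hk hα hε0 hε hδ hnk hle4 hle hmt,
    fun _ => answersLaw_isTauBounded hn hk hα hε0 hε hδ hnk, fun I r hr => ?_⟩
  obtain ⟨hqs, hsteps⟩ :=
    steps_isActive_le hn hk ((Nat.cast_nonneg _).trans hα) hε0 hε hδ hδ1 hnk I hr
  have hqs : (r.queries : ℝ) ≤ r.steps := by exact_mod_cast hqs
  set X := mt / nk * ∑ t ∈ Finset.Icc 2 k, α ^ (t - 2) * tauU k α ε nk t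
  set D := (k : ℝ) ^ (6 * k) * Real.log (n / δ) ^ 2 / ε ^ 3
  have hD : 0 ≤ D := by positivity
  constructor
  · have h : (r.steps : ℝ) ≤ 2 * (1400 * 36864 * 6 ^ 13) * max 1 X * D := by
      have : 0 ≤ max 1 X * D := by positivity
      linarith
    exact ⟨hqs.trans h, h⟩
  · intro hle hmt
    have hX : 1 / 2 ≤ X := half_le_mul_sum_tauU hk hα hε0 hnk hle hmt
    have hmax : max 1 X ≤ 2 * X := max_le (by linarith) (by linarith)
    have h : (r.steps : ℝ) ≤ 2 * (1400 * 36864 * 6 ^ 13) * X * D := by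
      calc _ ≤ 1400 * 36864 * 6 ^ 13 * max 1 X * D := hsteps
        _ ≤ 1400 * 36864 * 6 ^ 13 * (2 * X) * D := by gcongr
        _ = _ := by ring
    exact ⟨hqs.trans h, h⟩
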